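/- **Notation.** Let $n\in\mathbb N$, let $1\le p<\infty$, $1\le q\le\infty$. Fix Schwartz functions $(\varphi_j)_{j\ge 0}$ on $\mathbb R^n$ with $\operatorname{supp}\varphi_0\subset B(0,2)$, $\operatorname{supp}\varphi_j\subset B(0,2^{j+1})\setminus B(0,2^{j-1})$ for $j\ge1$, $\sup_{j,x}2^{j|\alpha|}|\partial^\alpha\varphi_j(x)|<\infty$ for every multi-index $\alpha$, and $\sum_{j\ge0}\varphi_j(x)=1$ for every $x$. For $\sigma\in\mathbb R$: * $B^\sigma_{p,q}(\mathbb R^n)$ is the set of tempered distributions $f$ such that the sequence $\big(2^{\sigma j}\|\mathcal F^{-1}(\varphi_j\mathcal F f)\|_{L^p(\mathbb R^n)}\big)_{j\ge0}$ is in $\ell^q$ (with $\mathcal F f(\xi)=\int f(x)e^{-i x\cdot\xi}\,dx$); * for an open set $\Omega\subset\mathbb R^n$, $B^\sigma_{p,q}(\Omega)$ is the set of distributions on $\Omega$ that are the restriction to $\Omega$ of some element of $B^\sigma_{p,q}(\mathbb R^n)$; * $B^\sigma_{p,q}(\mathbb T^n)$, where $\mathbb T^n=\mathbb R^n/\mathbb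 Z^n$, is the set of distributions on $\mathbb T^n$ whose Fourier coefficients $(a_m)_{m\in\mathbb Z^n}$ are such that the sequence $\big(2^{\sigma j}\|\sum_{m}a_m\varphi_j(2\pi m)e^{2\pi i m\cdot x}\|_{L^p(\mathbb T^n)}\big)_{j\ge0}$ is in $\ell^q$. **Lemma 6.20.** Let $\Omega$ be either a bounded open subset of $\mathbb R^n$ with $C^\infty$ boundary, or $(0,1)^n$, or $\mathbb T^n$. Let $s>1$, $1\le p<\infty$ and $1\le q\le\infty$, and let $u,v\in B^s_{p,q}(\Omega)\cap L^\infty(\Omega)$ be complex-valued. Then the distributional gradient $\nabla v$ is a function in $L^p(\Omega)$, and the product $u\nabla v$ belongs to $B^{s-1}_{p,q}(\Omega)$, that is, $u\,\partial_i v\in B^{s-1}_{p,q}(\Omega)$ for every $i=1,\dots,n$. -/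

import Mathlib

open MeasureTheory TopologicalSpace Set Filter
open scoped ENNReal Topology ContDiff SchwartzMap Distributions LineDeriv

namespace Besov

/-- A smooth dyadic partition of unity on `ℝⁿ`, as used in Littlewood–Paley theory. -/
structure DyadicPartition (n : ℕ) where
  φ : ℕ → 𝓢(EuclideanSpace ℝ (Fin n), ℂ)
  tsupport_zero : tsupport (φ 0) ⊆ Metric.ball 0 2
  tsupport_succ : ∀ j : ℕ,
    tsupport (φ (j + 1)) ⊆ Metric.ball 0 ((2 : ℝ) ^ (j + 2)) \ Metric.ball 0 ((2 : ℝ) ^ j)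
  deriv_bound : ∀ k : ℕ, ∃ c : ℝ, ∀ (j : ℕ) (x : EuclideanSpace ℝ (Fin n)),
    ‖iteratedFDeriv ℝ k (φ j) x‖ ≤ c * ((2 : ℝ) ^ (j * k))⁻¹
  sum_eq_one : ∀ x, HasSum (fun j => φ j x) 1

variable {n : ℕ}

/-- The `j`-th Littlewood–Paley piece `ℱ⁻¹(φⱼ ℱ g)` of a tempered distribution. The
frequency variable is the angular one (characters `e^{i x·ξ}`, as in the periodic case below) while
Mathlib's Fourier transform uses `e^{2π i x·ξ}`, hence the factor `2π`. -/
noncomputable def lpPiece (Φ : DyadicPartition n) (j : ℕ)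
    (g : 𝓢'(EuclideanSpace ℝ (Fin n), ℂ)) : 𝓢'(EuclideanSpace ℝ (Fin n), ℂ) :=
  TemperedDistribution.fourierMultiplierCLM ℂ (fun ξ => Φ.φ j ((2 * Real.pi) • ξ)) g

/-- `g ∈ B^s_{p,q}(ℝⁿ)`: every Littlewood–Paley piece `gⱼ` of `g` is (given by) an `Lᵖ` function and
the sequence `2^{sj} ‖gⱼ‖_{Lᵖ}` lies in `ℓ^q`. -/
def MemBesov (Φ : DyadicPartition n) (s : ℝ) (p q : ℝ≥0∞) [Fact (1 ≤ p)]
    (g : 𝓢'(EuclideanSpace ℝ (Fin n), ℂ)) : Prop :=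
  ∃ G : ℕ → Lp ℂ p (volume : Measure (EuclideanSpace ℝ (Fin n))),
    (∀ j, Lp.toTemperedDistribution (G j) = lpPiece Φ j g) ∧
    Memℓp (fun j : ℕ => (2 : ℝ) ^ (s * (j : ℝ)) * ‖G j‖) q

/-- A real test function on `Ω`, extended by zero and seen as a complex Schwartz function. -/
noncomputable def testToSchwartz {Ω : Opens (EuclideanSpace ℝ (Fin n))} (ψ : 𝓓(Ω, ℝ)) :
    𝓢(EuclideanSpace ℝ (Fin n), ℂ) :=
  HasCompactSupport.toSchwartzMap (f := fun x => ((ψ x : ℝ) : ℂ))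
    (ψ.hasCompactSupport.comp_left (g := fun t : ℝ => (t : ℂ)) Complex.ofReal_zero)
    (Complex.ofRealCLM.contDiff.comp ψ.contDiff)

/-- `T ∈ B^s_{p,q}(Ω)`: the distribution `T` on `Ω` is the restriction to `Ω` of some
`g ∈ B^s_{p,q}(ℝⁿ)`. -/
def MemBesovOn (Φ : DyadicPartition n) (s : ℝ) (p q : ℝ≥0∞) [Fact (1 ≤ p)]
    (Ω : Opens (EuclideanSpace ℝ (Fin n))) (T : 𝓓'(Ω, ℂ)) : Prop :=
  ∃ g : 𝓢'(EuclideanSpace ℝ (Fin n), ℂ), MemBesov Φ s p q g ∧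
    ∀ ψ : 𝓓(Ω, ℝ), T ψ = g (testToSchwartz ψ)

/-- The distribution `ψ ↦ ∫ ψ f` on `Ω` given by a function `f` that is locally integrable on `Ω`
(the zero distribution otherwise). -/
noncomputable def toDistribution (Ω : Opens (EuclideanSpace ℝ (Fin n)))
    (f : EuclideanSpace ℝ (Fin n) → ℂ) : 𝓓'(Ω, ℂ) :=
  (TestFunction.integralAgainstBilinCLM (ContinuousLinearMap.lsmul ℝ ℝ) volume f :
    𝓓(Ω, ℝ) →L[ℝ] ℂ)

/-- `Ω` has a `C^∞` boundary: near each boundary point, `Ω` is the set where a smooth function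
with nonvanishing differential is positive (so `Ω` lies locally on one side of a smooth
hypersurface). -/
def HasSmoothBoundary (Ω : Opens (EuclideanSpace ℝ (Fin n))) : Prop :=
  ∀ x ∈ frontier (Ω : Set (EuclideanSpace ℝ (Fin n))),
    ∃ U ∈ 𝓝 x, ∃ ρ : EuclideanSpace ℝ (Fin n) → ℝ,
      ContDiff ℝ ∞ ρ ∧ fderiv ℝ ρ x ≠ 0 ∧ ∀ y ∈ U, (y ∈ Ω ↔ 0 < ρ y)

/-- The open cube `(0,1)ⁿ`. -/
def unitCube (n : ℕ) : Opens (EuclideanSpace ℝ (Fin n)) where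
  carrier := {x | ∀ i, x i ∈ Ioo (0 : ℝ) 1}
  is_open' := by
    simp only [ofPred_forall]
    exact isOpen_iInter_of_finite fun i =>
      isOpen_Ioo.preimage (EuclideanSpace.proj (𝕜 := ℝ) i).continuous

/-- The Haar probability measure on `𝕋ⁿ = ℝⁿ/ℤⁿ`. -/
noncomputable def torusMeasure (n : ℕ) : Measure (UnitAddTorus (Fin n)) :=
  Measure.pi fun _ => AddCircle.haarAddCircle

/-- The `j`-th Littlewood–Paley piece `x ↦ ∑ₘ aₘ φⱼ(2πm) e^{2πi m·x}` (a finite sum) of the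
distribution on `𝕋ⁿ` with Fourier coefficients `a`. -/
noncomputable def torusPiece (Φ : DyadicPartition n) (j : ℕ) (a : (Fin n → ℤ) → ℂ)
    (x : UnitAddTorus (Fin n)) : ℂ :=
  ∑' m : Fin n → ℤ, a m * Φ.φ j (WithLp.toLp 2 fun i => 2 * Real.pi * (m i : ℝ)) *
    UnitAddTorus.mFourier m x

/-- The distribution on `𝕋ⁿ` with Fourier coefficients `a` is in `B^s_{p,q}(𝕋ⁿ)`. -/
def MemBesovTorus (Φ : DyadicPartition n) (s : ℝ) (p q : ℝ≥0∞) (a : (Fin n → ℤ) → ℂ) : Prop :=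
  Memℓp (fun j : ℕ => (2 : ℝ) ^ (s * (j : ℝ)) *
    (eLpNorm (torusPiece Φ j a) p (torusMeasure n)).toReal) q

/-- `w` is the `i`-th weak partial derivative of `v` on `𝕋ⁿ`:
`∫ v ∂ᵢψ = - ∫ w ψ` for all smooth `ψ` on `𝕋ⁿ`. -/
def IsWeakPartialTorus (i : Fin n) (v w : UnitAddTorus (Fin n) → ℂ) : Prop :=
  ∀ ψ : UnitAddTorus (Fin n) → ℂ,
    ContDiff ℝ ∞ (fun x : EuclideanSpace ℝ (Fin n) => ψ fun k => (x k : UnitAddCircle)) →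
    ∫ x, v x * deriv (fun h : ℝ => ψ (x + Pi.single i (h : UnitAddCircle))) 0 ∂(torusMeasure n) =
      -∫ x, w x * ψ x ∂(torusMeasure n)

end Besov

set_option linter.unusedSectionVars false

/-! The proof is a paraproduct argument in which frequency localisation is replaced by mollification
with one-sided kernels, so that it can be run on a domain.

Smoothness `σ > 0` is described without Fourier supports: `f = ∑ F_k` in `Lᵖ`, with `F_k` smooth and
`‖D^m F_k‖_p ≤ C_m 2^{k(m-σ)} b_k` for every `m`, where `b ∈ ℓ^q` (`IsDecomposition`,
`Approximates`). Littlewood–Paley pieces furnish such series (`MemBesov.exists_decomposition`,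
`MemBesovTorus.exists_decomposition`). Conversely, in the `l`-th Littlewood–Paley piece of such a
sum, the terms with `k ≥ l` are estimated by their `Lᵖ` norms, and those with `k < l` by many
derivatives against a kernel of mean zero. Both estimates decay geometrically in `|k - l|` because
`σ > 0` (`IsDecomposition.exists_tsum_supNorm_lpKernel_le`).

Let `R_j` be convolution with the kernel `η` dilated to scale `2^{-j}`, and put `S_j = 1 - (1 -
R_j)^L` with `L > s`, `S_{-1} = 0` and `Δ_j = S_j - S_{j-1}` (`moll`, `mollPrev`, `band`).
Derivatives of `Δ_j f` may fall on the kernel, at the cost `2^{jm}`, or `L` further derivatives of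
`f` may be spent to gain `2^{-jL}`. The same summation then shows that the `Δ_j f` again form a
decomposition (`IsMollifier.isDecomposition_band`).

The product is the telescoping sum of `S_j u ∂Δ_j v + ∂S_{j-1}v Δ_j u`. In `L^∞`, the `i`-th
derivatives of `S_j u` and of `∂S_{j-1}v` are `O(2^{ji})` and `O(2^{j(i+1)})`, since `u` and `v` are
bounded. The Leibniz rule gives both terms smoothness `s - 1`
(`IsMollifier.isDecomposition_productPiece`), and `s - 1 > 0` gives convergence and membership in
the Besov space.

On a domain, the extensions of `u` and `v` to `ℝⁿ` need not be bounded, so the mollifiers may only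
see values in `Ω`. Near a point of its closure, `Ω` coincides with a set `A` that is stable under
translation along a cone; with `η` supported in the reflected cone, `S_j f` on `A` depends only on
`f` on `A`. This covers smooth boundaries and the cube alike (`HasInnerCone.hasLocalMollifier`). A
decomposition on `A` extends to `ℝⁿ` as the sum of `(S_j + S_{j-1})(1_A Δ_j f)`, which telescopes to
`S_J² f` on `A` (`IsMollifier.exists_extension`). Finitely many local products are then patched with
cutoffs (`exists_global_of_local`).

On the torus the same argument applies to periodic lifts, with the norm taken as the supremum of
`Lᵖ` norms over all unit cubes. Every displacement is then admissible, and neither extension nor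
patching is needed. -/

namespace Besov

/-! ### Minkowski's integral inequality. -/

section Minkowski

/-- Minkowski's integral inequality, with a uniform bound on the norms of the integrated
functions. -/
theorem eLpNorm_lintegral_le {T X : Type*} [MeasurableSpace T] [MeasurableSpace X]
    {ν : Measure T} [IsFiniteMeasure ν] {μ : Measure X} [SFinite μ] {p : ℝ≥0∞} (hp : 1 ≤ p)
    {G : T → X → ℝ≥0∞} (hG : Measurable (Function.uncurry G)) {B : ℝ≥0∞}
    (hB : ∀ᵐ t ∂ν, eLpNorm (G t) p μ ≤ B) :
    eLpNorm (fun x => ∫⁻ t, G t x ∂ν) p μ ≤ ν univ * B := by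
  have hGx : ∀ x, Measurable fun t => G t x := fun x => hG.comp (measurable_id.prodMk measurable_const)
  rcases eq_or_ne p ⊤ with rfl | hpt
  · rw [eLpNorm_exponent_top]
    refine eLpNormEssSup_le_of_ae_enorm_bound ?_
    have h1 : ∀ᵐ t ∂ν, ∀ᵐ x ∂μ, G t x ≤ B := by
      filter_upwards [hB] with t ht
      rw [eLpNorm_exponent_top] at ht
      filter_upwards [enorm_ae_le_eLpNormEssSup (G t) μ] with x hx
      exact (by simpa using hx : G t x ≤ _).trans ht
    have h2 := (Measure.ae_ae_comm (μ := ν) (ν := μ) (p := fun t x => G t x ≤ B)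
      (measurableSet_le hG measurable_const)).1 h1
    filter_upwards [h2] with x hx
    calc ‖∫⁻ t, G t x ∂ν‖ₑ = ∫⁻ t, G t x ∂ν := by simp
      _ ≤ ∫⁻ _, B ∂ν := lintegral_mono_ae hx
      _ = ν univ * B := by simp [mul_comm]
  · have hp0 : p ≠ 0 := (zero_lt_one.trans_le hp).ne'
    set r := p.toReal with hr
    have hr1 : 1 ≤ r := by
      rw [hr, ← ENNReal.toReal_one]; exact ENNReal.toReal_mono hpt hp
    have hr0 : 0 < r := by linarith
    -- Hölder's inequality against the finite measure `ν`. After Tonelli the uniform bound `B`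
    -- closes the estimate, so no duality argument is needed.
    have key : ∀ x, (∫⁻ t, G t x ∂ν) ^ r ≤ (∫⁻ t, G t x ^ r ∂ν) * ν univ ^ (r - 1) := by
      intro x
      have := eLpNorm_le_eLpNorm_mul_rpow_measure_univ (p := 1) (q := p) hp
        (hGx x).aestronglyMeasurable (μ := ν)
      rw [eLpNorm_one_eq_lintegral_enorm, eLpNorm_eq_lintegral_rpow_enorm_toReal hp0 hpt] at this
      simp only [enorm_eq_self, ENNReal.toReal_one, ← hr] at this
      calc _ ≤ ((∫⁻ t, G t x ^ r ∂ν) ^ (1 / r) * ν univ ^ (1 / 1 - 1 / r)) ^ r := by gcongr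
        _ = _ := by
          rw [ENNReal.mul_rpow_of_nonneg _ _ hr0.le, ← ENNReal.rpow_mul, ← ENNReal.rpow_mul,
            one_div_mul_cancel hr0.ne', ENNReal.rpow_one]
          congr 2
          field_simp
    have hB' : ∀ᵐ t ∂ν, ∫⁻ x, G t x ^ r ∂μ ≤ B ^ r := by
      filter_upwards [hB] with t ht
      rw [eLpNorm_eq_lintegral_rpow_enorm_toReal hp0 hpt] at ht
      simp only [enorm_eq_self, ← hr] at ht
      calc _ = ((∫⁻ x, G t x ^ r ∂μ) ^ (1 / r)) ^ r := by
            rw [← ENNReal.rpow_mul, one_div_mul_cancel hr0.ne', ENNReal.rpow_one]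
        _ ≤ _ := by gcongr
    rw [eLpNorm_eq_lintegral_rpow_enorm_toReal hp0 hpt]
    simp only [enorm_eq_self, ← hr]
    have hGr : Measurable (fun z : T × X => G z.1 z.2 ^ r) := hG.pow_const r
    have : ∫⁻ x, (∫⁻ t, G t x ∂ν) ^ r ∂μ ≤ (ν univ * B) ^ r := calc
      _ ≤ ∫⁻ x, (∫⁻ t, G t x ^ r ∂ν) * ν univ ^ (r - 1) ∂μ := lintegral_mono key
      _ = (∫⁻ x, ∫⁻ t, G t x ^ r ∂ν ∂μ) * ν univ ^ (r - 1) := by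
        rw [lintegral_mul_const]
        exact hGr.lintegral_prod_left'
      _ = (∫⁻ t, ∫⁻ x, G t x ^ r ∂μ ∂ν) * ν univ ^ (r - 1) := by
        rw [lintegral_lintegral_swap]
        exact (hGr.comp measurable_swap).aemeasurable
      _ ≤ (∫⁻ _, B ^ r ∂ν) * ν univ ^ (r - 1) := by exact mul_le_mul_left (lintegral_mono_ae hB') _
      _ = (ν univ * B) ^ r := by
        rw [lintegral_const, ENNReal.mul_rpow_of_nonneg _ _ hr0.le, mul_assoc, mul_comm]
        congr 1
        rcases eq_or_ne (ν univ) 0 with h0 | h0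
        · simp [h0, hr0]
        · nth_rw 1 [← ENNReal.rpow_one (ν univ)]
          rw [← ENNReal.rpow_add _ _ h0 (measure_ne_top _ _)]
          congr 1; ring
    calc _ ≤ ((ν univ * B) ^ r) ^ (1 / r) := by gcongr
      _ = _ := by rw [← ENNReal.rpow_mul, mul_one_div_cancel hr0.ne', ENNReal.rpow_one]

end Minkowski

/-! ### `Lᵖ` norms uniform over a family of sets, and their behaviour under translation. -/

section SupNorm

variable {E F F' : Type} [NormedAddCommGroup E] [InnerProductSpace ℝ E] [FiniteDimensional ℝ E]
  [MeasurableSpace E] [BorelSpace E] [NormedAddCommGroup F] [NormedAddCommGroup F']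
  {𝒜 : Set (Set E)} {D : Set E} {p : ℝ≥0∞}

/-- The supremum of the `Lᵖ` norms of `f` on the members of a family of sets. -/
noncomputable def supNorm (𝒜 : Set (Set E)) (p : ℝ≥0∞) (f : E → F) : ℝ≥0∞ :=
  ⨆ A ∈ 𝒜, eLpNorm f p (volume.restrict A)

/-- `𝒜` consists of measurable sets, and `D` is a set of displacements, star-shaped about `0`, along
which the members of `𝒜` can be translated backwards within `𝒜`. -/
structure Admissible (𝒜 : Set (Set E)) (D : Set E) : Prop where
  meas : ∀ A ∈ 𝒜, MeasurableSet A
  shift : ∀ y ∈ D, ∀ A ∈ 𝒜, ∃ A' ∈ 𝒜, ∀ x ∈ A, x - y ∈ A'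
  smul_mem : ∀ y ∈ D, ∀ t ∈ Icc (0 : ℝ) 1, t • y ∈ D

theorem eLpNorm_le_supNorm {A : Set E} (hA : A ∈ 𝒜) (f : E → F) :
    eLpNorm f p (volume.restrict A) ≤ supNorm 𝒜 p f :=
  le_iSup₂ (f := fun A (_ : A ∈ 𝒜) => eLpNorm f p (volume.restrict A)) A hA

theorem supNorm_le {f : E → F} {B : ℝ≥0∞}
    (h : ∀ A ∈ 𝒜, eLpNorm f p (volume.restrict A) ≤ B) : supNorm 𝒜 p f ≤ B :=
  iSup₂_le h

theorem supNorm_mono {f : E → F} {g : E → F'} (h : ∀ x, ‖f x‖ ≤ ‖g x‖) :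
    supNorm 𝒜 p f ≤ supNorm 𝒜 p g :=
  supNorm_le fun _ hA => (eLpNorm_mono h).trans (eLpNorm_le_supNorm hA g)

theorem supNorm_congr_norm {f : E → F} {g : E → F'} (h : ∀ x, ‖f x‖ = ‖g x‖) :
    supNorm 𝒜 p f = supNorm 𝒜 p g :=
  le_antisymm (supNorm_mono fun x => (h x).le) (supNorm_mono fun x => (h x).ge)

theorem supNorm_zero : supNorm 𝒜 p (fun _ : E => (0 : F)) = 0 :=
  le_antisymm (supNorm_le fun A _ => by simp) bot_le

theorem supNorm_sub_comm (f g : E → F) :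
    supNorm 𝒜 p (fun x => f x - g x) = supNorm 𝒜 p (fun x => g x - f x) :=
  supNorm_congr_norm fun _ => norm_sub_rev _ _

theorem supNorm_add_le (hp : 1 ≤ p) {f g : E → F} (hf : AEStronglyMeasurable f)
    (hg : AEStronglyMeasurable g) :
    supNorm 𝒜 p (fun x => f x + g x) ≤ supNorm 𝒜 p f + supNorm 𝒜 p g :=
  supNorm_le fun _ hA => (eLpNorm_add_le hf.restrict hg.restrict hp).trans
    (add_le_add (eLpNorm_le_supNorm hA f) (eLpNorm_le_supNorm hA g))

theorem supNorm_sub_le (hp : 1 ≤ p) {f g : E → F} (hf : AEStronglyMeasurable f)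
    (hg : AEStronglyMeasurable g) :
    supNorm 𝒜 p (fun x => f x - g x) ≤ supNorm 𝒜 p f + supNorm 𝒜 p g :=
  supNorm_le fun _ hA => (eLpNorm_sub_le hf.restrict hg.restrict hp).trans
    (add_le_add (eLpNorm_le_supNorm hA f) (eLpNorm_le_supNorm hA g))

theorem supNorm_sub_le_add (hp : 1 ≤ p) {f g h : E → F} (hf : AEStronglyMeasurable f)
    (hg : AEStronglyMeasurable g) (hh : AEStronglyMeasurable h) :
    supNorm 𝒜 p (fun x => f x - h x) ≤
      supNorm 𝒜 p (fun x => f x - g x) + supNorm 𝒜 p (fun x => g x - h x) := by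
  have := supNorm_add_le (𝒜 := 𝒜) hp (hf.sub hg) (hg.sub hh)
  simpa only [Pi.sub_apply, sub_add_sub_cancel] using! this

theorem supNorm_sum_le (hp : 1 ≤ p) {ι : Type*} (s : Finset ι) {f : ι → E → F}
    (hf : ∀ i ∈ s, AEStronglyMeasurable (f i)) :
    supNorm 𝒜 p (fun x => ∑ i ∈ s, f i x) ≤ ∑ i ∈ s, supNorm 𝒜 p (f i) := by
  refine supNorm_le fun A hA => ?_
  have := eLpNorm_sum_le (p := p) (μ := volume.restrict A) (fun i hi => (hf i hi).restrict) hp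
  rw [Finset.sum_fn] at this
  exact this.trans (Finset.sum_le_sum fun i _ => eLpNorm_le_supNorm hA (f i))

theorem supNorm_const_mul_le (c : ℝ) {f : E → F} {g : E → F'} (h : ∀ x, ‖f x‖ ≤ c * ‖g x‖) :
    supNorm 𝒜 p f ≤ ENNReal.ofReal c * supNorm 𝒜 p g :=
  supNorm_le fun A hA => (eLpNorm_le_mul_eLpNorm_of_ae_le_mul (ae_of_all _ h) p).trans
    (by gcongr; exact eLpNorm_le_supNorm hA g)

/-- Lebesgue measure is translation invariant, so the norm over `A` becomes a norm over the
translate `A - y`, which lies in a member of the family. -/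
theorem Admissible.supNorm_shift_le (h : Admissible 𝒜 D) {f : E → F} (hf : AEStronglyMeasurable f)
    {y : E} (hy : y ∈ D) : supNorm 𝒜 p (fun x => f (x - y)) ≤ supNorm 𝒜 p f := by
  refine supNorm_le fun A hA => ?_
  obtain ⟨A', hA', hs⟩ := h.shift y hy A hA
  have hmp := (measurePreserving_sub_right (volume : Measure E) y).restrict_preimage (h.meas A' hA')
  calc _ ≤ eLpNorm (fun x => f (x - y)) p (volume.restrict ((fun x => x - y) ⁻¹' A')) :=
        eLpNorm_mono_measure _ (Measure.restrict_mono hs le_rfl)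
    _ = eLpNorm f p (volume.restrict A') := eLpNorm_comp_measurePreserving hf.restrict hmp
    _ ≤ _ := eLpNorm_le_supNorm hA' f

/-- A Minkowski-type bound for the mixed norm `supNorm`. -/
theorem supNorm_le_of_enorm_le_lintegral {T : Type*} [MeasurableSpace T] {ν : Measure T}
    [IsFiniteMeasure ν] (hp : 1 ≤ p) {h : E → F'} {G : T → E → F}
    (hG : StronglyMeasurable (Function.uncurry G))
    (hh : ∀ x, ‖h x‖ₑ ≤ ∫⁻ t, ‖G t x‖ₑ ∂ν) {B : ℝ≥0∞}
    (hB : ∀ᵐ t ∂ν, supNorm 𝒜 p (G t) ≤ B) :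
    supNorm 𝒜 p h ≤ ν univ * B := by
  refine supNorm_le fun A hA => ?_
  calc eLpNorm h p (volume.restrict A)
      ≤ eLpNorm (fun x => ∫⁻ t, ‖G t x‖ₑ ∂ν) p (volume.restrict A) :=
        eLpNorm_mono_enorm fun x => by simpa using hh x
    _ ≤ _ := by
      refine eLpNorm_lintegral_le (G := fun t x => ‖G t x‖ₑ) hp hG.enorm ?_
      filter_upwards [hB] with t ht
      rw [eLpNorm_enorm]
      exact (eLpNorm_le_supNorm hA _).trans ht

end SupNorm

/-! ### Convolution with Schwartz kernels: norm bounds and derivatives. -/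

section Conv

variable {E F : Type} [NormedAddCommGroup E] [InnerProductSpace ℝ E] [FiniteDimensional ℝ E]
  [MeasurableSpace E] [BorelSpace E] [NormedAddCommGroup F] [NormedSpace ℂ F]
  {𝒜 : Set (Set E)} {D : Set E} {p : ℝ≥0∞}

/-- Strongly measurable functions dominated by the sum of an integrable function and a constant. -/
def IsDominated (f : E → F) : Prop :=
  StronglyMeasurable f ∧ ∃ (g : E → ℝ) (C : ℝ), Integrable g ∧ 0 ≤ C ∧ ∀ x, ‖f x‖ ≤ |g x| + C

/-- Smooth functions all of whose derivatives are bounded. -/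
def IsBddSmooth (f : E → F) : Prop :=
  ContDiff ℝ ∞ f ∧ ∀ m : ℕ, ∃ C : ℝ, ∀ x, ‖iteratedFDeriv ℝ m f x‖ ≤ C

/-- Convolution with a Schwartz kernel. -/
noncomputable def conv (κ : 𝓢(E, ℂ)) (f : E → F) (x : E) : F := ∫ y, κ y • f (x - y)

/-- Convolution of a scalar function with a vector-valued Schwartz kernel. -/
noncomputable def kconv (f : E → ℂ) (κ : 𝓢(E, F)) (x : E) : F := ∫ y, f y • κ (x - y)

/-- The supremum over the family `𝒜` of the `Lᵖ` norms of the `m`-th derivative. -/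
noncomputable def derivNorm (𝒜 : Set (Set E)) (p : ℝ≥0∞) (m : ℕ) (f : E → F) : ℝ≥0∞ :=
  supNorm 𝒜 p (iteratedFDeriv ℝ m f)

/-- The `L¹` norm of the `m`-th derivative of a kernel. -/
noncomputable def kernelNorm (m : ℕ) (κ : 𝓢(E, F)) : ℝ≥0∞ := ∫⁻ y, ‖iteratedFDeriv ℝ m κ y‖ₑ

/-- The first absolute moment of a kernel. -/
noncomputable def kernelMoment (κ : 𝓢(E, ℂ)) : ℝ≥0∞ := ∫⁻ y, ‖κ y‖ₑ * ‖y‖ₑ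

theorem kernelNorm_lt_top (m : ℕ) (κ : 𝓢(E, F)) : kernelNorm m κ < ⊤ := by
  have := (κ.integrable_pow_mul_iteratedFDeriv volume 0 m).2
  simpa [HasFiniteIntegral, kernelNorm] using this

theorem kernelMoment_lt_top (κ : 𝓢(E, ℂ)) : kernelMoment κ < ⊤ := by
  have := (κ.integrable_pow_mul volume 1).2
  simpa [HasFiniteIntegral, kernelMoment, mul_comm] using this

theorem kernelNorm_zero (κ : 𝓢(E, F)) : kernelNorm 0 κ = ∫⁻ y, ‖κ y‖ₑ := by
  simp only [kernelNorm, ← ofReal_norm, norm_iteratedFDeriv_zero]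

theorem kernelNorm_fderiv (m : ℕ) (κ : 𝓢(E, F)) :
    kernelNorm m (SchwartzMap.fderivCLM ℝ E F κ) = kernelNorm (m + 1) κ := by
  simp only [kernelNorm, ← ofReal_norm]
  congr 1; ext y
  rw [← norm_iteratedFDeriv_fderiv]
  rfl

theorem derivNorm_zero (f : E → F) : derivNorm 𝒜 p 0 f = supNorm 𝒜 p f :=
  supNorm_congr_norm fun _ => norm_iteratedFDeriv_zero

theorem derivNorm_succ (m : ℕ) (f : E → F) :
    derivNorm 𝒜 p (m + 1) f = derivNorm 𝒜 p m (fderiv ℝ f) :=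
  supNorm_congr_norm fun _ => norm_iteratedFDeriv_fderiv.symm

/-! ### Dominated functions -/

theorem IsDominated.of_le {f : E → F} (hf : StronglyMeasurable f) {g : E → ℝ} {C : ℝ}
    (hg : Integrable g) (h : ∀ x, ‖f x‖ ≤ |g x| + C) : IsDominated f :=
  ⟨hf, g, |C|, hg, abs_nonneg _, fun x => (h x).trans (by gcongr; exact le_abs_self C)⟩

/-- The reason is `‖f‖ ≤ ‖f‖^p + 1`. Dominated functions thus include `Lᵖ` functions with `p` finite
as well as bounded periodic lifts, which lie in no `Lᵖ(ℝⁿ)` with `p` finite unless they vanish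
almost everywhere. -/
theorem IsDominated.of_memLp {f : E → F} (hf : StronglyMeasurable f) (hp : 1 ≤ p) (hpt : p ≠ ⊤)
    (h : MemLp f p) : IsDominated f := by
  refine .of_le hf (h.integrable_norm_rpow (zero_lt_one.trans_le hp).ne' hpt) (C := 1) fun x => ?_
  have hr1 : 1 ≤ p.toReal := by
    rw [← ENNReal.toReal_one]; exact ENNReal.toReal_mono hpt hp
  rcases le_total ‖f x‖ 1 with h1 | h1
  · exact h1.trans (by simp)
  · rw [abs_of_nonneg (by positivity)]
    have := Real.rpow_le_rpow_of_exponent_le h1 hr1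
    rw [Real.rpow_one] at this
    linarith

theorem IsDominated.of_bounded {f : E → F} (hf : StronglyMeasurable f) {C : ℝ}
    (h : ∀ x, ‖f x‖ ≤ C) : IsDominated f :=
  .of_le hf (integrable_zero E ℝ volume) (C := C) fun x => by simpa using h x

theorem IsBddSmooth.isDominated {f : E → F} (hf : IsBddSmooth f) : IsDominated f := by
  obtain ⟨C, hC⟩ := hf.2 0
  exact .of_bounded hf.1.continuous.stronglyMeasurable fun x => by
    simpa [norm_iteratedFDeriv_zero] using hC x

theorem IsDominated.sub {f g : E → F} (hf : IsDominated f) (hg : IsDominated g) :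
    IsDominated (fun x => f x - g x) := by
  obtain ⟨hfm, f', C, hf', hC, hfle⟩ := hf
  obtain ⟨hgm, g', C', hg', hC', hgle⟩ := hg
  refine .of_le (hfm.sub hgm) (hf'.abs.add hg'.abs) (C := C + C') fun x => ?_
  have := norm_sub_le (f x) (g x)
  have h2 := hfle x
  have h3 := hgle x
  simp only [Pi.add_apply]
  rw [abs_of_nonneg (by positivity)]
  linarith

theorem stronglyMeasurable_conv_integrand {κ : E → ℂ} (hκ : StronglyMeasurable κ) {f : E → F}
    (hf : StronglyMeasurable f) :
    StronglyMeasurable (Function.uncurry fun x y : E => κ y • f (x - y)) :=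
  (hκ.comp_measurable measurable_snd).smul (hf.comp_measurable (measurable_fst.sub measurable_snd))

theorem stronglyMeasurable_conv (κ : 𝓢(E, ℂ)) {f : E → F} (hf : StronglyMeasurable f) :
    StronglyMeasurable (conv κ f) :=
  (stronglyMeasurable_conv_integrand κ.continuous.stronglyMeasurable hf).integral_prod_right

theorem exists_bound (κ : 𝓢(E, F)) : ∃ M, 0 ≤ M ∧ ∀ x, ‖κ x‖ ≤ M := by
  obtain ⟨C, _, hC⟩ := κ.decay 0 0
  exact ⟨C, (norm_nonneg _).trans (by simpa using hC 0), fun x => by simpa using hC x⟩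

theorem IsDominated.integrable_smul_kernel {f : E → ℂ} (hf : IsDominated f) (κ : 𝓢(E, F)) (x : E) :
    Integrable fun y => f y • κ (x - y) := by
  obtain ⟨hfm, g, C, hg, hC, hle⟩ := hf
  obtain ⟨M, hM0, hM⟩ := exists_bound κ
  refine ((hg.norm.const_mul M).add ((κ.integrable.comp_sub_left x).norm.const_mul C)).mono'
    (hfm.aestronglyMeasurable.smul
      (κ.continuous.comp (continuous_sub_left x)).aestronglyMeasurable) (ae_of_all _ fun y => ?_)
  rw [norm_smul]
  simp only [Pi.add_apply, Real.norm_eq_abs]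
  have h1 := hle y
  have h2 := hM (x - y)
  have := norm_nonneg (κ (x - y))
  have := norm_nonneg (f y)
  nlinarith [abs_nonneg (g y)]

theorem IsDominated.integrable_conv {f : E → F} (hf : IsDominated f) (κ : 𝓢(E, ℂ)) (x : E) :
    Integrable fun y => κ y • f (x - y) := by
  obtain ⟨hfm, g, C, hg, hC, hle⟩ := hf
  obtain ⟨M, hM0, hM⟩ := exists_bound κ
  refine (((hg.comp_sub_left x).norm.const_mul M).add (κ.integrable.norm.const_mul C)).mono'
    (κ.continuous.aestronglyMeasurable.smul
      (hfm.comp_measurable (measurable_const.sub measurable_id)).aestronglyMeasurable)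
    (ae_of_all _ fun y => ?_)
  rw [norm_smul]
  simp only [Pi.add_apply, Real.norm_eq_abs]
  have h1 := hle (x - y)
  have h2 := hM y
  have := norm_nonneg (κ y)
  have := norm_nonneg (f (x - y))
  nlinarith [abs_nonneg (g (x - y))]

theorem conv_eq_kconv (κ : 𝓢(E, ℂ)) (f : E → ℂ) : conv κ f = kconv f κ := by
  ext x
  rw [conv, ← integral_sub_left_eq_self _ _ x]
  simp [kconv, mul_comm]

theorem conv_sub {f g : E → F} (hf : IsDominated f) (hg : IsDominated g) (κ : 𝓢(E, ℂ)) :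
    conv κ (fun x => f x - g x) = fun x => conv κ f x - conv κ g x := by
  ext x
  simp only [conv, smul_sub]
  exact integral_sub (hf.integrable_conv κ x) (hg.integrable_conv κ x)

/-- The integrable part of the majorant stays integrable by `L¹ * L¹ ⊆ L¹`, and the constant part is
multiplied by the `L¹` norm of the kernel. This is what permits iterated convolutions. -/
theorem IsDominated.conv {f : E → F} (hf : IsDominated f) (κ : 𝓢(E, ℂ)) :
    IsDominated (conv κ f) := by
  have hint := hf.integrable_conv κ
  obtain ⟨hfm, g, C, hg, hC, hle⟩ := hf
  have hconv := κ.integrable.norm.integrable_convolution (ContinuousLinearMap.mul ℝ ℝ) hg.norm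
  set h := convolution (fun y => ‖κ y‖) (fun y => ‖g y‖) (ContinuousLinearMap.mul ℝ ℝ) volume
  obtain ⟨M, hM0, hM⟩ := exists_bound κ
  refine .of_le (stronglyMeasurable_conv κ hfm) hconv (C := C * ∫ y, ‖κ y‖) fun x => ?_
  have hgx : Integrable fun y => ‖κ y‖ * ‖g (x - y)‖ := by
    refine ((hg.comp_sub_left x).norm.const_mul M).mono'
      (κ.continuous.norm.aestronglyMeasurable.mul (hg.comp_sub_left x).norm.1)
      (ae_of_all _ fun y => ?_)
    rw [Real.norm_of_nonneg (by positivity)]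
    gcongr; exact hM y
  calc ‖Besov.conv κ f x‖ ≤ ∫ y, ‖κ y • f (x - y)‖ := norm_integral_le_integral_norm _
    _ ≤ ∫ y, (‖κ y‖ * ‖g (x - y)‖ + C * ‖κ y‖) := by
      refine integral_mono (hint x).norm (hgx.add (κ.integrable.norm.const_mul C)) fun y => ?_
      simp only [norm_smul]
      have := hle (x - y)
      rw [← Real.norm_eq_abs] at this
      nlinarith [norm_nonneg (κ y)]
    _ = h x + C * ∫ y, ‖κ y‖ := by
      rw [integral_add hgx (κ.integrable.norm.const_mul C), integral_const_mul]
      rfl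
    _ ≤ _ := by gcongr; exact le_abs_self _

/-! ### Bounds -/

/-- Young's inequality, obtained from Minkowski's inequality for the finite measure `‖κ y‖ dy`. That
measure only charges displacements in `D`, along which translation does not increase the norm. The
pointwise hypothesis on `h` serves both forms of convolution. -/
theorem supNorm_le_of_convolution_bound {F' : Type} [NormedAddCommGroup F'] (h𝒜 : Admissible 𝒜 D)
    (hp : 1 ≤ p) {F'' : Type} [NormedAddCommGroup F''] [NormedSpace ℝ F''] (κ : 𝓢(E, F''))
    (hκ : ∀ y, κ y ≠ 0 → y ∈ D)
    {f : E → F} (hf : StronglyMeasurable f) {h : E → F'}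
    (hh : ∀ x, ‖h x‖ₑ ≤ ∫⁻ y, ‖κ y‖ₑ * ‖f (x - y)‖ₑ) :
    supNorm 𝒜 p h ≤ (∫⁻ y, ‖κ y‖ₑ) * supNorm 𝒜 p f := by
  have hκm : Measurable fun y => ‖κ y‖ₑ := κ.continuous.enorm.measurable
  have hfin : ∫⁻ y, ‖κ y‖ₑ ≠ ⊤ := κ.integrable.2.ne
  have : IsFiniteMeasure (volume.withDensity fun y => ‖κ y‖ₑ) := isFiniteMeasure_withDensity hfin
  have := supNorm_le_of_enorm_le_lintegral (𝒜 := 𝒜) (p := p)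
    (ν := volume.withDensity fun y => ‖κ y‖ₑ) hp (h := h)
    (G := fun y x => f (x - y)) (hf.comp_measurable (measurable_snd.sub measurable_fst))
    (B := supNorm 𝒜 p f) (fun x => ?_) ?_
  · rwa [withDensity_apply _ MeasurableSet.univ, setLIntegral_univ] at this
  · rw [lintegral_withDensity_eq_lintegral_mul _ hκm]
    · exact hh x
    · exact (hf.comp_measurable (measurable_const.sub measurable_id)).enorm
  · rw [ae_withDensity_iff hκm]
    exact ae_of_all _ fun y hy => h𝒜.supNorm_shift_le hf.aestronglyMeasurable (hκ y (by simpa using hy))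

theorem supNorm_conv_le (h𝒜 : Admissible 𝒜 D) (hp : 1 ≤ p) (κ : 𝓢(E, ℂ))
    (hκ : ∀ y, κ y ≠ 0 → y ∈ D) {f : E → F} (hf : StronglyMeasurable f) :
    supNorm 𝒜 p (conv κ f) ≤ kernelNorm 0 κ * supNorm 𝒜 p f := by
  rw [kernelNorm_zero]
  refine supNorm_le_of_convolution_bound h𝒜 hp κ hκ hf fun x => ?_
  refine (enorm_integral_le_lintegral_enorm _).trans ?_
  simp [enorm_smul]

theorem supNorm_kconv_le [CompleteSpace F] (h𝒜 : Admissible 𝒜 D) (hp : 1 ≤ p) (κ : 𝓢(E, F))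
    (hκ : ∀ y, κ y ≠ 0 → y ∈ D) {f : E → ℂ} (hf : StronglyMeasurable f) :
    supNorm 𝒜 p (kconv f κ) ≤ kernelNorm 0 κ * supNorm 𝒜 p f := by
  rw [kernelNorm_zero]
  refine supNorm_le_of_convolution_bound h𝒜 hp κ hκ hf fun x => ?_
  rw [kconv, ← integral_sub_left_eq_self _ _ x]
  refine (enorm_integral_le_lintegral_enorm _).trans ?_
  simp [enorm_smul, mul_comm]

/-! ### Derivatives falling on the kernel -/

theorem IsDominated.hasFDerivAt_kconv {f : E → ℂ} (hf : IsDominated f) (κ : 𝓢(E, F)) (x₀ : E) :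
    HasFDerivAt (kconv f κ) (kconv f (SchwartzMap.fderivCLM ℝ E F κ) x₀) x₀ := by
  have hint := hf.integrable_smul_kernel κ
  obtain ⟨hfm, g, C, hg, hC, hle⟩ := hf
  set κ' := SchwartzMap.fderivCLM ℝ E F κ
  obtain ⟨M, hM0, hM⟩ := exists_bound κ'
  -- The constant part of the domination requires a majorant of `κ' (x - y)` that is integrable in
  -- `y` and uniform for `x` in the unit ball about `x₀`. Decay of order one more than the dimension
  -- suffices, and moving the centre from `x` to `x₀` costs the factor `2 ^ N`.
  set N := Module.finrank ℝ E + 1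
  set S := 2 ^ N * ((Finset.Iic (N, 0)).sup fun m => SchwartzMap.seminorm ℝ m.1 m.2) κ'
  have hS : ∀ z, (1 + ‖z‖) ^ N * ‖κ' z‖ ≤ S := fun z => by
    simpa [norm_iteratedFDeriv_zero] using
      SchwartzMap.one_add_le_sup_seminorm_apply (𝕜 := ℝ) (m := (N, 0)) le_rfl le_rfl κ' z
  have hS0 : 0 ≤ S := (by positivity : (0 : ℝ) ≤ _).trans (hS 0)
  have hNint : Integrable fun y : E => (1 + ‖y - x₀‖) ^ (-(N : ℝ)) :=
    (integrable_one_add_norm (by simp [N])).comp_sub_right x₀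
  refine hasFDerivAt_integral_of_dominated_of_fderiv_le
    (bound := fun y => M * |g y| + C * S * 2 ^ N * (1 + ‖y - x₀‖) ^ (-(N : ℝ)))
    (s := Metric.ball x₀ 1) (Metric.ball_mem_nhds x₀ one_pos)
    (F' := fun x y => f y • κ' (x - y)) ?_ (hint x₀) ?_ ?_ ?_ ?_
  · exact Eventually.of_forall fun x => (hint x).1
  · exact hfm.aestronglyMeasurable.smul
      (κ'.continuous.comp (continuous_sub_left x₀)).aestronglyMeasurable
  · refine ae_of_all _ fun y x hx => ?_
    rw [norm_smul]
    have h1 : 1 + ‖y - x₀‖ ≤ 2 * (1 + ‖x - y‖) := by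
      have : ‖y - x₀‖ ≤ ‖x - y‖ + ‖x - x₀‖ := by
        rw [norm_sub_rev x y]; simpa using norm_add_le (y - x) (x - x₀)
      have h3 : ‖x - x₀‖ < 1 := by simpa [dist_eq_norm] using hx
      have := norm_nonneg (x - y)
      linarith
    have h2 : ‖κ' (x - y)‖ ≤ S * 2 ^ N * (1 + ‖y - x₀‖) ^ (-(N : ℝ)) := by
      have hpos : 0 < 1 + ‖y - x₀‖ := by positivity
      rw [Real.rpow_neg hpos.le, Real.rpow_natCast, ← div_eq_mul_inv, le_div_iff₀ (by positivity)]
      calc ‖κ' (x - y)‖ * (1 + ‖y - x₀‖) ^ N ≤ ‖κ' (x - y)‖ * (2 * (1 + ‖x - y‖)) ^ N := by gcongr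
        _ = (1 + ‖x - y‖) ^ N * ‖κ' (x - y)‖ * 2 ^ N := by rw [mul_pow]; ring
        _ ≤ _ := by gcongr; exact hS _
    calc ‖f y‖ * ‖κ' (x - y)‖ ≤ (|g y| + C) * ‖κ' (x - y)‖ := by gcongr; exact hle y
      _ = |g y| * ‖κ' (x - y)‖ + C * ‖κ' (x - y)‖ := by ring
      _ ≤ |g y| * M + C * (S * 2 ^ N * (1 + ‖y - x₀‖) ^ (-(N : ℝ))) := by
        gcongr; exact hM _
      _ = _ := by ring
  · exact (hg.abs.const_mul M).add (hNint.const_mul _)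
  · refine ae_of_all _ fun y x _ => ?_
    have : HasFDerivAt (fun x => κ (x - y)) (κ' (x - y)) x := by
      have h : HasFDerivAt κ (κ' (x - y)) (x - y) := κ.differentiableAt.hasFDerivAt
      exact (h.comp x ((hasFDerivAt_id x).sub_const y)).congr_fderiv
        (ContinuousLinearMap.comp_id _)
    exact this.const_smul (f y)

theorem IsDominated.fderiv_kconv {f : E → ℂ} (hf : IsDominated f) (κ : 𝓢(E, F)) :
    fderiv ℝ (kconv f κ) = kconv f (SchwartzMap.fderivCLM ℝ E F κ) :=
  funext fun x => (hf.hasFDerivAt_kconv κ x).fderiv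

theorem IsDominated.norm_kconv_le {f : E → ℂ} (hf : IsDominated f) (κ : 𝓢(E, F)) :
    ∃ B, ∀ x, ‖kconv f κ x‖ ≤ B := by
  have hint := hf.integrable_smul_kernel κ
  obtain ⟨hfm, g, C, hg, hC, hle⟩ := hf
  obtain ⟨M, hM0, hM⟩ := exists_bound κ
  refine ⟨M * (∫ y, ‖g y‖) + C * ∫ y, ‖κ y‖, fun x => ?_⟩
  calc ‖kconv f κ x‖ ≤ ∫ y, ‖f y • κ (x - y)‖ := norm_integral_le_integral_norm _
    _ ≤ ∫ y, (M * ‖g y‖ + C * ‖κ (x - y)‖) := by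
      refine integral_mono (hint x).norm ((hg.norm.const_mul M).add
        ((κ.integrable.comp_sub_left x).norm.const_mul C)) fun y => ?_
      simp only [norm_smul]
      have h1 := hle y
      rw [← Real.norm_eq_abs] at h1
      have h2 := hM (x - y)
      nlinarith [norm_nonneg (κ (x - y)), norm_nonneg (f y), norm_nonneg (g y)]
    _ = _ := by
      rw [integral_add (hg.norm.const_mul M) ((κ.integrable.comp_sub_left x).norm.const_mul C),
        integral_const_mul, integral_const_mul, integral_sub_left_eq_self (fun y => ‖κ y‖)]

theorem IsDominated.isBddSmooth_kconv {f : E → ℂ} (hf : IsDominated f) (κ : 𝓢(E, F)) :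
    IsBddSmooth (kconv f κ) := by
  constructor
  · rw [contDiff_infty]
    intro m
    induction m generalizing F with
    | zero =>
      exact contDiff_zero.2 (continuous_iff_continuousAt.2 fun x =>
        (hf.hasFDerivAt_kconv κ x).continuousAt)
    | succ m ih =>
      rw [Nat.cast_succ, contDiff_succ_iff_fderiv]
      refine ⟨fun x => (hf.hasFDerivAt_kconv κ x).differentiableAt, by simp, ?_⟩
      rw [hf.fderiv_kconv]
      exact ih _
  · intro m
    induction m generalizing F with
    | zero => simpa only [norm_iteratedFDeriv_zero] using hf.norm_kconv_le κ
    | succ m ih =>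
      obtain ⟨C, hC⟩ := ih (SchwartzMap.fderivCLM ℝ E F κ)
      refine ⟨C, fun x => ?_⟩
      rw [← norm_iteratedFDeriv_fderiv, hf.fderiv_kconv]
      exact hC x

theorem IsDominated.isBddSmooth_conv {f : E → ℂ} (hf : IsDominated f) (κ : 𝓢(E, ℂ)) :
    IsBddSmooth (Besov.conv κ f) := by
  rw [conv_eq_kconv]; exact hf.isBddSmooth_kconv κ

/-- All derivatives are put on the kernel. Closedness of `D` ensures that the derivatives of the
kernel are still supported in `D`. -/
theorem derivNorm_kconv_le [CompleteSpace F] (h𝒜 : Admissible 𝒜 D) (hD : IsClosed D) (hp : 1 ≤ p)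
    (m : ℕ) (κ : 𝓢(E, F)) (hκ : ∀ y, κ y ≠ 0 → y ∈ D) {f : E → ℂ} (hf : IsDominated f) :
    derivNorm 𝒜 p m (kconv f κ) ≤ kernelNorm m κ * supNorm 𝒜 p f := by
  induction m generalizing F with
  | zero => rw [derivNorm_zero]; exact supNorm_kconv_le h𝒜 hp κ hκ hf.1
  | succ m ih =>
    rw [derivNorm_succ, hf.fderiv_kconv, ← kernelNorm_fderiv]
    refine ih _ fun y hy => ?_
    have h1 : tsupport κ ⊆ D := closure_minimal (fun y hy => hκ y hy) hD
    exact h1 (SchwartzMap.tsupport_fderivCLM_subset ℝ κ (subset_tsupport _ hy))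

/-! ### Smooth functions with bounded derivatives -/

theorem IsBddSmooth.fderiv {f : E → F} (hf : IsBddSmooth f) : IsBddSmooth (fderiv ℝ f) :=
  ⟨(contDiff_infty_iff_fderiv.1 hf.1).2, fun m => by
    simpa only [norm_iteratedFDeriv_fderiv] using hf.2 (m + 1)⟩

theorem IsBddSmooth.differentiable {f : E → F} (hf : IsBddSmooth f) : Differentiable ℝ f :=
  hf.1.differentiable (by simp)

theorem IsBddSmooth.norm_le {f : E → F} (hf : IsBddSmooth f) : ∃ C, ∀ x, ‖f x‖ ≤ C := by
  simpa only [norm_iteratedFDeriv_zero] using hf.2 0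

theorem IsBddSmooth.continuous_iteratedFDeriv {f : E → F} (hf : IsBddSmooth f) (m : ℕ) :
    Continuous (iteratedFDeriv ℝ m f) := hf.1.continuous_iteratedFDeriv (by exact_mod_cast le_top)

theorem IsBddSmooth.aestronglyMeasurable_iteratedFDeriv {f : E → F} (hf : IsBddSmooth f) (m : ℕ) :
    AEStronglyMeasurable (iteratedFDeriv ℝ m f) :=
  (hf.continuous_iteratedFDeriv m).aestronglyMeasurable

theorem IsBddSmooth.iteratedFDeriv_add {f g : E → F} (hf : IsBddSmooth f) (hg : IsBddSmooth g)
    (m : ℕ) (x : E) : iteratedFDeriv ℝ m (fun x => f x + g x) x =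
      iteratedFDeriv ℝ m f x + iteratedFDeriv ℝ m g x :=
  iteratedFDeriv_add_apply (hf.1.of_le (by exact_mod_cast le_top)).contDiffAt
    (hg.1.of_le (by exact_mod_cast le_top)).contDiffAt

theorem iteratedFDeriv_neg' {f : E → F} (m : ℕ) (x : E) :
    iteratedFDeriv ℝ m (fun x => - f x) x = -iteratedFDeriv ℝ m f x :=
  iteratedFDeriv_neg_apply

theorem IsBddSmooth.neg {f : E → F} (hf : IsBddSmooth f) : IsBddSmooth fun x => -f x :=
  ⟨hf.1.neg, fun m => by simpa only [iteratedFDeriv_neg', norm_neg] using hf.2 m⟩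

theorem IsBddSmooth.add {f g : E → F} (hf : IsBddSmooth f) (hg : IsBddSmooth g) :
    IsBddSmooth fun x => f x + g x := by
  refine ⟨hf.1.add hg.1, fun m => ?_⟩
  obtain ⟨C, hC⟩ := hf.2 m
  obtain ⟨C', hC'⟩ := hg.2 m
  refine ⟨C + C', fun x => ?_⟩
  rw [hf.iteratedFDeriv_add hg]
  exact (norm_add_le _ _).trans (add_le_add (hC x) (hC' x))

theorem IsBddSmooth.sub {f g : E → F} (hf : IsBddSmooth f) (hg : IsBddSmooth g) :
    IsBddSmooth fun x => f x - g x := by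
  simpa only [sub_eq_add_neg] using hf.add hg.neg

theorem IsBddSmooth.zero : IsBddSmooth fun _ : E => (0 : F) :=
  ⟨contDiff_const, fun m => ⟨0, fun x => by
    rw [iteratedFDeriv_fun_zero]; simp⟩⟩

theorem IsBddSmooth.sum {ι : Type*} (s : Finset ι) {f : ι → E → F}
    (hf : ∀ i ∈ s, IsBddSmooth (f i)) : IsBddSmooth fun x => ∑ i ∈ s, f i x := by
  classical
  induction s using Finset.induction_on with
  | empty => simpa using IsBddSmooth.zero
  | insert a s ha ih =>
    simp only [Finset.sum_insert ha]
    exact (hf a (Finset.mem_insert_self a s)).add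
      (ih fun i hi => hf i (Finset.mem_insert_of_mem hi))

theorem IsBddSmooth.mul {f g : E → ℂ} (hf : IsBddSmooth f) (hg : IsBddSmooth g) :
    IsBddSmooth fun x => f x * g x := by
  refine ⟨hf.1.mul hg.1, fun m => ?_⟩
  choose C hC using hf.2
  choose C' hC' using hg.2
  refine ⟨∑ i ∈ Finset.range (m + 1), (m.choose i : ℝ) * C i * C' (m - i), fun x => ?_⟩
  refine (norm_iteratedFDeriv_mul_le hf.1 hg.1 x (by exact_mod_cast le_top)).trans ?_
  refine Finset.sum_le_sum fun i _ => ?_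
  have := (norm_nonneg _).trans (hC i x)
  gcongr
  · exact hC i x
  · exact hC' _ x

theorem IsBddSmooth.clm_comp {F' : Type} [NormedAddCommGroup F'] [NormedSpace ℂ F'] {f : E → F}
    (hf : IsBddSmooth f) (l : F →L[ℝ] F') : IsBddSmooth fun x => l (f x) := by
  refine ⟨l.contDiff.comp hf.1, fun m => ?_⟩
  obtain ⟨C, hC⟩ := hf.2 m
  refine ⟨‖l‖ * C, fun x => ?_⟩
  refine (l.norm_iteratedFDeriv_comp_left hf.1.contDiffAt (by exact_mod_cast le_top)).trans ?_
  gcongr; exact hC x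

theorem derivNorm_clm_comp_le {F' : Type} [NormedAddCommGroup F'] [NormedSpace ℂ F'] {f : E → F}
    (hf : IsBddSmooth f) (l : F →L[ℝ] F') (m : ℕ) :
    derivNorm 𝒜 p m (fun x => l (f x)) ≤ ‖l‖ₑ * derivNorm 𝒜 p m f := by
  rw [← ofReal_norm]
  exact supNorm_const_mul_le _ fun x =>
    l.norm_iteratedFDeriv_comp_left hf.1.contDiffAt (by exact_mod_cast le_top)

theorem derivNorm_add_le (hp : 1 ≤ p) {f g : E → F} (hf : IsBddSmooth f) (hg : IsBddSmooth g)
    (m : ℕ) : derivNorm 𝒜 p m (fun x => f x + g x) ≤ derivNorm 𝒜 p m f + derivNorm 𝒜 p m g := by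
  refine le_trans (le_of_eq ?_) (supNorm_add_le hp (hf.aestronglyMeasurable_iteratedFDeriv m)
    (hg.aestronglyMeasurable_iteratedFDeriv m))
  exact supNorm_congr_norm fun x => by rw [hf.iteratedFDeriv_add hg]

theorem derivNorm_neg (f : E → F) (m : ℕ) :
    derivNorm 𝒜 p m (fun x => -f x) = derivNorm 𝒜 p m f :=
  supNorm_congr_norm fun x => by rw [iteratedFDeriv_neg', norm_neg]

theorem derivNorm_sub_le (hp : 1 ≤ p) {f g : E → F} (hf : IsBddSmooth f) (hg : IsBddSmooth g)
    (m : ℕ) : derivNorm 𝒜 p m (fun x => f x - g x) ≤ derivNorm 𝒜 p m f + derivNorm 𝒜 p m g := by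
  simpa only [sub_eq_add_neg, derivNorm_neg] using derivNorm_add_le hp hf hg.neg m

theorem derivNorm_zero_fun (m : ℕ) : derivNorm 𝒜 p m (fun _ : E => (0 : F)) = 0 := by
  have h : (iteratedFDeriv ℝ m fun _ : E => (0 : F)) = fun _ => 0 := by
    rw [iteratedFDeriv_fun_zero]; rfl
  rw [derivNorm, h, supNorm_zero]

theorem derivNorm_sum_le (hp : 1 ≤ p) {ι : Type*} (s : Finset ι) {f : ι → E → F}
    (hf : ∀ i ∈ s, IsBddSmooth (f i)) (m : ℕ) :
    derivNorm 𝒜 p m (fun x => ∑ i ∈ s, f i x) ≤ ∑ i ∈ s, derivNorm 𝒜 p m (f i) := by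
  classical
  induction s using Finset.induction_on with
  | empty => simp [derivNorm_zero_fun]
  | insert a s ha ih =>
    simp only [Finset.sum_insert ha]
    have h := fun i hi => hf i (Finset.mem_insert_of_mem (a := i) (b := a) (s := s) hi)
    exact (derivNorm_add_le hp (hf a (Finset.mem_insert_self a s)) (.sum s h) m).trans
      (add_le_add_right (ih h) _)

/-! ### Derivatives falling on the function -/

theorem IsBddSmooth.hasFDerivAt_conv {f : E → F} (hf : IsBddSmooth f) (κ : 𝓢(E, ℂ)) (x₀ : E) :
    HasFDerivAt (Besov.conv κ f) (Besov.conv κ (_root_.fderiv ℝ f) x₀) x₀ := by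
  obtain ⟨C, hC⟩ := hf.fderiv.norm_le
  refine hasFDerivAt_integral_of_dominated_of_fderiv_le (F := fun x y => κ y • f (x - y))
    (bound := fun y => ‖κ y‖ * C) (s := univ) univ_mem
    (F' := fun x y => κ y • _root_.fderiv ℝ f (x - y)) ?_ (hf.isDominated.integrable_conv κ x₀)
    (hf.fderiv.isDominated.integrable_conv κ x₀).1 ?_ (κ.integrable.norm.mul_const C) ?_
  · exact Eventually.of_forall fun x => (hf.isDominated.integrable_conv κ x).1
  · exact ae_of_all _ fun y x _ => by rw [norm_smul]; gcongr; exact hC _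
  · refine ae_of_all _ fun y x _ => ?_
    have h := (hf.differentiable (x - y)).hasFDerivAt
    exact ((h.comp x ((hasFDerivAt_id x).sub_const y)).congr_fderiv
      (ContinuousLinearMap.comp_id _)).const_smul (κ y)

theorem IsBddSmooth.fderiv_conv {f : E → F} (hf : IsBddSmooth f) (κ : 𝓢(E, ℂ)) :
    _root_.fderiv ℝ (Besov.conv κ f) = Besov.conv κ (_root_.fderiv ℝ f) :=
  funext fun x => (hf.hasFDerivAt_conv κ x).fderiv

theorem derivNorm_conv_le (h𝒜 : Admissible 𝒜 D) (hp : 1 ≤ p) (κ : 𝓢(E, ℂ))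
    (hκ : ∀ y, κ y ≠ 0 → y ∈ D) {f : E → F} (hf : IsBddSmooth f) (m : ℕ) :
    derivNorm 𝒜 p m (conv κ f) ≤ kernelNorm 0 κ * derivNorm 𝒜 p m f := by
  induction m generalizing F with
  | zero =>
    rw [derivNorm_zero, derivNorm_zero]
    exact supNorm_conv_le h𝒜 hp κ hκ hf.1.continuous.stronglyMeasurable
  | succ m ih => rw [derivNorm_succ, derivNorm_succ, hf.fderiv_conv]; exact ih hf.fderiv

/-- The fundamental theorem of calculus on the segment from `x` to `x - y`, left in integral form so
that Minkowski's inequality can be applied to it. -/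
theorem enorm_sub_le_lintegral_fderiv [CompleteSpace F] {f : E → F} (hf : IsBddSmooth f)
    (x y : E) :
    ‖f (x - y) - f x‖ₑ ≤ ∫⁻ t in Icc (0 : ℝ) 1, ‖y‖ₑ * ‖fderiv ℝ f (x - t • y)‖ₑ := by
  have hd : ∀ t : ℝ, HasDerivAt (fun t : ℝ => f (x - t • y)) (fderiv ℝ f (x - t • y) (-y)) t := by
    intro t
    have h1 : HasDerivAt (fun t : ℝ => x - t • y) (-y) t := by
      simpa using ((hasDerivAt_id t).smul_const y).const_sub x
    exact (hf.differentiable (x - t • y)).hasFDerivAt.comp_hasDerivAt t h1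
  have hc : Continuous fun t : ℝ => fderiv ℝ f (x - t • y) (-y) :=
    (hf.fderiv.1.continuous.comp (by fun_prop)).clm_apply continuous_const
  have := intervalIntegral.integral_eq_sub_of_hasDerivAt (a := 0) (b := 1) (fun t _ => hd t)
    (hc.intervalIntegrable _ _)
  simp only [one_smul, zero_smul, sub_zero] at this
  rw [← this, intervalIntegral.integral_of_le zero_le_one, ← integral_Icc_eq_integral_Ioc]
  refine (enorm_integral_le_lintegral_enorm _).trans (lintegral_mono fun t => ?_)
  rw [mul_comm, ← enorm_neg y]
  exact ContinuousLinearMap.le_opENorm _ _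

/-- The difference is `∫ κ(y) (f(x - y) - f(x)) dy`, which costs one derivative of `f` and one
moment of `κ`. Minkowski's inequality is applied to the measure `‖κ y‖ ‖y‖ dy ⊗ dt`; the
displacements `t • y` remain in `D` because `D` is star-shaped. Both kernels of integral one
(mollifiers) and of integral zero (Littlewood–Paley kernels) are of interest. -/
theorem supNorm_conv_sub_le [CompleteSpace F] (h𝒜 : Admissible 𝒜 D) (hp : 1 ≤ p) (κ : 𝓢(E, ℂ))
    (hκ : ∀ y, κ y ≠ 0 → y ∈ D) {f : E → F} (hf : IsBddSmooth f) :
    supNorm 𝒜 p (fun x => conv κ f x - (∫ y, κ y) • f x) ≤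
      kernelMoment κ * supNorm 𝒜 p (fderiv ℝ f) := by
  have hm : Measurable fun y => ‖κ y‖ₑ * ‖y‖ₑ :=
    κ.continuous.enorm.measurable.mul continuous_enorm.measurable
  have : IsFiniteMeasure (volume.withDensity fun y => ‖κ y‖ₑ * ‖y‖ₑ) :=
    isFiniteMeasure_withDensity (kernelMoment_lt_top κ).ne
  have hGm : StronglyMeasurable
      (Function.uncurry fun (z : E × ℝ) (x : E) => fderiv ℝ f (x - z.2 • z.1)) :=
    (hf.fderiv.1.continuous.comp (by fun_prop)).stronglyMeasurable
  have := supNorm_le_of_enorm_le_lintegral (𝒜 := 𝒜) (p := p)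
    (ν := (volume.withDensity fun y => ‖κ y‖ₑ * ‖y‖ₑ).prod (volume.restrict (Icc (0 : ℝ) 1))) hp
    (h := fun x => conv κ f x - (∫ y, κ y) • f x)
    (G := fun z x => fderiv ℝ f (x - z.2 • z.1)) hGm
    (B := supNorm 𝒜 p (fderiv ℝ f)) (fun x => ?_) ?_
  · rw [← univ_prod_univ, Measure.prod_prod, withDensity_apply _ MeasurableSet.univ,
      setLIntegral_univ] at this
    simpa [kernelMoment] using this
  · have h1 : conv κ f x - (∫ y, κ y) • f x = ∫ y, κ y • (f (x - y) - f x) := by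
      simp only [smul_sub]
      rw [integral_sub (hf.isDominated.integrable_conv κ x) (κ.integrable.smul_const _),
        integral_smul_const]
      rfl
    have hcx : Continuous fun z : E × ℝ => ‖fderiv ℝ f (x - z.2 • z.1)‖ₑ :=
      (hf.fderiv.1.continuous.comp (by fun_prop)).enorm
    rw [h1, lintegral_prod _ hcx.measurable.aemeasurable,
      lintegral_withDensity_eq_lintegral_mul _ hm hcx.measurable.lintegral_prod_right']
    refine (enorm_integral_le_lintegral_enorm _).trans (lintegral_mono fun y => ?_)
    rw [enorm_smul, Pi.mul_apply, mul_assoc, ← lintegral_const_mul]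
    · gcongr
      exact enorm_sub_le_lintegral_fderiv hf x y
    · exact (hcx.comp (continuous_const.prodMk continuous_id)).measurable
  · have h1 : ∀ᵐ z : E × ℝ ∂((volume.withDensity fun y => ‖κ y‖ₑ * ‖y‖ₑ).prod
        (volume.restrict (Icc (0 : ℝ) 1))), κ z.1 ≠ 0 ∧ z.2 ∈ Icc (0 : ℝ) 1 := by
      refine Filter.Eventually.and ?_ ?_
      · refine Measure.quasiMeasurePreserving_fst.ae (p := fun y : E => κ y ≠ 0) ?_
        rw [ae_withDensity_iff hm]
        exact ae_of_all _ fun y hy h0 => hy (by simp [h0])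
      · exact Measure.quasiMeasurePreserving_snd.ae (p := fun t : ℝ => t ∈ Icc (0 : ℝ) 1)
          (ae_restrict_mem measurableSet_Icc)
    filter_upwards [h1] with z hz
    exact h𝒜.supNorm_shift_le (f := fderiv ℝ f) hf.fderiv.1.continuous.aestronglyMeasurable
      (h𝒜.smul_mem _ (hκ _ hz.1) _ hz.2)

theorem derivNorm_conv_sub_le [CompleteSpace F] (h𝒜 : Admissible 𝒜 D) (hp : 1 ≤ p) (κ : 𝓢(E, ℂ))
    (hκ : ∀ y, κ y ≠ 0 → y ∈ D) {f : E → F} (hf : IsBddSmooth f) (m : ℕ) :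
    derivNorm 𝒜 p m (fun x => conv κ f x - (∫ y, κ y) • f x) ≤
      kernelMoment κ * derivNorm 𝒜 p (m + 1) f := by
  induction m generalizing F with
  | zero =>
    rw [derivNorm_zero, derivNorm_succ, derivNorm_zero]
    exact supNorm_conv_sub_le h𝒜 hp κ hκ hf
  | succ m ih =>
    have : fderiv ℝ (fun x => conv κ f x - (∫ y, κ y) • f x) =
        fun x => conv κ (fderiv ℝ f) x - (∫ y, κ y) • fderiv ℝ f x := by
      ext1 x
      exact ((hf.hasFDerivAt_conv κ x).sub
        ((hf.differentiable x).hasFDerivAt.const_smul (∫ y, κ y))).fderiv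
    rw [derivNorm_succ, this, derivNorm_succ]
    exact ih hf.fderiv

end Conv

/-- Real powers of two in `ℝ≥0∞`. -/
noncomputable def pow2 (x : ℝ) : ℝ≥0∞ := (2 : ℝ≥0∞) ^ x

theorem pow2_add (x y : ℝ) : pow2 (x + y) = pow2 x * pow2 y :=
  ENNReal.rpow_add _ _ (by simp) (by simp)

theorem pow2_zero : pow2 0 = 1 := ENNReal.rpow_zero

theorem pow2_mono {x y : ℝ} (h : x ≤ y) : pow2 x ≤ pow2 y :=
  ENNReal.rpow_le_rpow_of_exponent_le (by norm_num) h

theorem pow2_ne_top (x : ℝ) : pow2 x ≠ ⊤ := ENNReal.rpow_ne_top_of_ne_zero (by simp) (by simp)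

theorem pow2_pow (x : ℝ) (i : ℕ) : pow2 x ^ i = pow2 (x * i) :=
  (ENNReal.rpow_mul_natCast _ _ _).symm

theorem ofReal_two_rpow (x : ℝ) : ENNReal.ofReal ((2 : ℝ) ^ x) = pow2 x := by
  rw [← ENNReal.ofReal_rpow_of_pos two_pos]; simp [pow2]

/-! ### Dyadic dilation of kernels. -/

section Dilate

variable {E F : Type} [NormedAddCommGroup E] [InnerProductSpace ℝ E] [FiniteDimensional ℝ E]
  [MeasurableSpace E] [BorelSpace E] [NormedAddCommGroup F] [NormedSpace ℂ F]
  {𝒜 : Set (Set E)} {D : Set E} {p : ℝ≥0∞}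

/-- The `L¹`-normalised dilation `x ↦ 2^{jd} κ(2^j x)` of a kernel. -/
noncomputable def dilate (j : ℕ) (κ : 𝓢(E, F)) : 𝓢(E, F) :=
  (((2 : ℝ) ^ j) ^ Module.finrank ℝ E) • SchwartzMap.compCLMOfContinuousLinearEquiv ℝ
    (ContinuousLinearEquiv.smulLeft (Units.mk0 ((2 : ℝ) ^ j) (by positivity))) κ

theorem dilate_apply (j : ℕ) (κ : 𝓢(E, F)) (x : E) :
    dilate j κ x = (((2 : ℝ) ^ j) ^ Module.finrank ℝ E) • κ ((2 : ℝ) ^ j • x) := rfl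

theorem lintegral_comp_two_pow_smul (j : ℕ) {f : E → ℝ≥0∞} (hf : Measurable f) :
    ENNReal.ofReal (((2 : ℝ) ^ j) ^ Module.finrank ℝ E) * ∫⁻ x, f ((2 : ℝ) ^ j • x) = ∫⁻ x, f x := by
  have hpos : (0 : ℝ) < ((2 : ℝ) ^ j) ^ Module.finrank ℝ E := by positivity
  have h := Measure.map_addHaar_smul (volume : Measure E) (r := (2 : ℝ) ^ j) (by positivity)
  rw [← lintegral_map (f := f) (g := fun x => (2 : ℝ) ^ j • x) hf (by fun_prop), h,
    lintegral_smul_measure, smul_eq_mul, ← mul_assoc, ← ENNReal.ofReal_mul hpos.le,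
    abs_of_pos (inv_pos.2 hpos), mul_inv_cancel₀ hpos.ne']
  simp

theorem iteratedFDeriv_dilate (m j : ℕ) (κ : 𝓢(E, F)) (x : E) :
    ‖iteratedFDeriv ℝ m (dilate j κ) x‖ = ((2 : ℝ) ^ j) ^ Module.finrank ℝ E *
      (((2 : ℝ) ^ j) ^ m * ‖iteratedFDeriv ℝ m κ ((2 : ℝ) ^ j • x)‖) := by
  have h1 : (dilate j κ : E → F) =
      fun x => (((2 : ℝ) ^ j) ^ Module.finrank ℝ E) • κ ((2 : ℝ) ^ j • x) := rfl
  have hc : ContDiff ℝ m fun x => κ ((2 : ℝ) ^ j • x) :=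
    (κ.smooth m).comp (by fun_prop)
  rw [h1, iteratedFDeriv_const_smul_apply' hc.contDiffAt,
    iteratedFDeriv_comp_const_smul _ (κ.smooth m)]
  simp [norm_smul]

theorem kernelNorm_dilate (m j : ℕ) (κ : 𝓢(E, F)) :
    kernelNorm m (dilate j κ) = pow2 (j * m) * kernelNorm m κ := by
  have hm : Measurable fun y => ‖iteratedFDeriv ℝ m κ y‖ₑ :=
    ((κ.smooth m).continuous_iteratedFDeriv le_rfl).enorm.measurable
  have h2 : ENNReal.ofReal (((2 : ℝ) ^ j) ^ m) = pow2 (j * m) := by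
    rw [← ofReal_two_rpow, ← pow_mul, ← Real.rpow_natCast]; push_cast; rfl
  rw [kernelNorm, kernelNorm, ← lintegral_comp_two_pow_smul j hm, ← h2, ← mul_assoc, mul_comm (_ * _),
    ← lintegral_mul_const' _ _ (ENNReal.mul_ne_top ENNReal.ofReal_ne_top ENNReal.ofReal_ne_top)]
  refine lintegral_congr fun x => ?_
  rw [← ofReal_norm, iteratedFDeriv_dilate, ENNReal.ofReal_mul (by positivity),
    ENNReal.ofReal_mul (by positivity), ofReal_norm]
  ring

theorem kernelMoment_dilate (j : ℕ) (κ : 𝓢(E, ℂ)) :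
    kernelMoment (dilate j κ) = pow2 (-j) * kernelMoment κ := by
  have hm : Measurable fun y : E => ‖κ y‖ₑ * ‖y‖ₑ :=
    κ.continuous.enorm.measurable.mul continuous_enorm.measurable
  rw [kernelMoment, kernelMoment, ← lintegral_comp_two_pow_smul j hm, ← mul_assoc, mul_comm,
    ← lintegral_mul_const' _ _ (ENNReal.mul_ne_top (pow2_ne_top _) ENNReal.ofReal_ne_top)]
  refine lintegral_congr fun x => ?_
  have h2 : pow2 (-j) * ENNReal.ofReal (2 ^ j) = 1 := by
    rw [← Real.rpow_natCast, ofReal_two_rpow, ← pow2_add]; simp [pow2_zero]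
  have h3 : ‖(2 : ℝ) ^ j‖ₑ = ENNReal.ofReal (2 ^ j) := by
    rw [← ofReal_norm, Real.norm_of_nonneg (by positivity)]
  have h4 : ‖((2 : ℝ) ^ j) ^ Module.finrank ℝ E‖ₑ =
      ENNReal.ofReal (((2 : ℝ) ^ j) ^ Module.finrank ℝ E) := by
    rw [← ofReal_norm, Real.norm_of_nonneg (by positivity)]
  rw [dilate_apply, enorm_smul, enorm_smul, h3, h4]
  calc _ = ENNReal.ofReal (((2 : ℝ) ^ j) ^ Module.finrank ℝ E) * ‖κ ((2 : ℝ) ^ j • x)‖ₑ * ‖x‖ₑ *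
        (pow2 (-j) * ENNReal.ofReal (2 ^ j)) := by rw [h2, mul_one]
    _ = _ := by ring

theorem integral_dilate (j : ℕ) (κ : 𝓢(E, F)) : ∫ x, dilate j κ x = ∫ x, κ x := by
  have hpos : (0 : ℝ) < ((2 : ℝ) ^ j) ^ Module.finrank ℝ E := by positivity
  simp only [dilate_apply]
  rw [integral_smul, Measure.integral_comp_smul, smul_smul, abs_of_pos (inv_pos.2 hpos),
    mul_inv_cancel₀ hpos.ne', one_smul]

/-- Dilation contracts the support by `2^{-j} ≤ 1` towards the origin, and `D` is star-shaped. -/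
theorem Admissible.dilate_mem (h : Admissible 𝒜 D) {κ : 𝓢(E, F)} (hκ : ∀ y, κ y ≠ 0 → y ∈ D)
    (j : ℕ) (y : E) (hy : dilate j κ y ≠ 0) : y ∈ D := by
  have h1 : κ ((2 : ℝ) ^ j • y) ≠ 0 := fun h0 => hy (by rw [dilate_apply, h0, smul_zero])
  have h2 := h.smul_mem _ (hκ _ h1) (((2 : ℝ) ^ j)⁻¹)
    ⟨by positivity, inv_le_one_of_one_le₀ (one_le_pow₀ one_le_two)⟩
  rwa [inv_smul_smul₀ (by positivity)] at h2

end Dilate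

/-! ### Higher-order mollifiers and their bands. -/

section Mollifier

variable {E : Type} [NormedAddCommGroup E] [InnerProductSpace ℝ E] [FiniteDimensional ℝ E]
  [MeasurableSpace E] [BorelSpace E]
  {𝒜 : Set (Set E)} {D : Set E} {p : ℝ≥0∞} {η : 𝓢(E, ℂ)}

/-- `η` is a kernel of integral one supported in a set of displacements admissible for `𝒜`. -/
structure IsMollifier (𝒜 : Set (Set E)) (D : Set E) (η : 𝓢(E, ℂ)) : Prop where
  adm : Admissible 𝒜 D
  closed : IsClosed D
  supp : ∀ y, η y ≠ 0 → y ∈ D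
  integral : ∫ y, η y = 1

/-- The iterated residual `(1 - R)^i f` where `R` is convolution with `dilate j η`. -/
noncomputable def resid (η : 𝓢(E, ℂ)) (j : ℕ) : ℕ → (E → ℂ) → E → ℂ
  | 0, f => f
  | i + 1, f => fun x => resid η j i f x - conv (dilate j η) (resid η j i f) x

/-- The higher order mollification `f - (1 - R)^L f` where `R` is convolution with `dilate j η`. -/
noncomputable def moll (η : 𝓢(E, ℂ)) (L j : ℕ) (f : E → ℂ) (x : E) : ℂ :=
  ∑ i ∈ Finset.range L, conv (dilate j η) (resid η j i f) x

/-- The mollification at the previous scale, zero at the coarsest one. -/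
noncomputable def mollPrev (η : 𝓢(E, ℂ)) (L : ℕ) : ℕ → (E → ℂ) → E → ℂ
  | 0, _ => fun _ => 0
  | j + 1, f => moll η L j f

/-- The difference of consecutive mollifications. -/
noncomputable def band (η : 𝓢(E, ℂ)) (L j : ℕ) (f : E → ℂ) (x : E) : ℂ :=
  moll η L j f x - mollPrev η L j f x

/-- Telescoping of `R (1 - R)^i = (1 - R)^i - (1 - R)^{i+1}`. The sum form shows that the
mollification is smooth; this form shows that its error is of order `L`. -/
theorem moll_eq (L j : ℕ) (f : E → ℂ) (x : E) : moll η L j f x = f x - resid η j L f x := by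
  induction L with
  | zero => simp [moll, resid]
  | succ L ih =>
    rw [moll, Finset.sum_range_succ, ← moll, ih, resid]; ring

theorem sum_band (L J : ℕ) (f : E → ℂ) (x : E) :
    ∑ j ∈ Finset.range J, band η L j f x = mollPrev η L J f x := by
  induction J with
  | zero => simp [mollPrev]
  | succ J ih => rw [Finset.sum_range_succ, ih, band, mollPrev]; ring

theorem IsDominated.resid {f : E → ℂ} (hf : IsDominated f) (j i : ℕ) :
    IsDominated (resid η j i f) := by
  induction i with
  | zero => exact hf
  | succ i ih => exact ih.sub (ih.conv _)

theorem IsBddSmooth.resid {f : E → ℂ} (hf : IsBddSmooth f) (j i : ℕ) :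
    IsBddSmooth (resid η j i f) := by
  induction i with
  | zero => exact hf
  | succ i ih => exact ih.sub (ih.isDominated.isBddSmooth_conv _)

theorem IsDominated.isBddSmooth_moll {f : E → ℂ} (hf : IsDominated f) (L j : ℕ) :
    IsBddSmooth (moll η L j f) :=
  .sum _ fun i _ => (hf.resid j i).isBddSmooth_conv _

theorem IsDominated.isBddSmooth_mollPrev {f : E → ℂ} (hf : IsDominated f) (L j : ℕ) :
    IsBddSmooth (mollPrev η L j f) := by
  cases j with
  | zero => exact .zero
  | succ j => exact hf.isBddSmooth_moll L j

theorem IsDominated.isBddSmooth_band {f : E → ℂ} (hf : IsDominated f) (L j : ℕ) :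
    IsBddSmooth (band η L j f) :=
  (hf.isBddSmooth_moll L j).sub (hf.isBddSmooth_mollPrev L j)

theorem resid_sub {f g : E → ℂ} (hf : IsDominated f) (hg : IsDominated g) (j i : ℕ) :
    resid η j i (fun x => f x - g x) = fun x => resid η j i f x - resid η j i g x := by
  induction i with
  | zero => rfl
  | succ i ih =>
    ext x
    simp only [resid, ih]
    rw [conv_sub (hf.resid j i) (hg.resid j i)]
    ring

theorem moll_sub {f g : E → ℂ} (hf : IsDominated f) (hg : IsDominated g) (L j : ℕ) :
    moll η L j (fun x => f x - g x) = fun x => moll η L j f x - moll η L j g x := by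
  ext x; simp only [moll_eq, resid_sub hf hg]; ring

theorem mollPrev_sub {f g : E → ℂ} (hf : IsDominated f) (hg : IsDominated g) (L j : ℕ) :
    mollPrev η L j (fun x => f x - g x) = fun x => mollPrev η L j f x - mollPrev η L j g x := by
  cases j with
  | zero => simp [mollPrev]
  | succ j => exact moll_sub hf hg L j

theorem band_sub {f g : E → ℂ} (hf : IsDominated f) (hg : IsDominated g) (L j : ℕ) :
    band η L j (fun x => f x - g x) = fun x => band η L j f x - band η L j g x := by
  ext x; simp only [band, moll_sub hf hg, mollPrev_sub hf hg]; ring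

namespace IsMollifier

variable (h : IsMollifier 𝒜 D η)
include h

theorem kernelNorm_dilate_zero (j : ℕ) : kernelNorm 0 (dilate j η) = kernelNorm 0 η := by
  rw [kernelNorm_dilate]; simp [pow2_zero]

theorem supNorm_resid_le (hp : 1 ≤ p) {f : E → ℂ} (hf : IsDominated f) (j i : ℕ) :
    supNorm 𝒜 p (resid η j i f) ≤ (1 + kernelNorm 0 η) ^ i * supNorm 𝒜 p f := by
  induction i with
  | zero => simp [resid]
  | succ i ih =>
    have h1 := (hf.resid (η := η) j i)
    calc _ ≤ supNorm 𝒜 p (resid η j i f) + supNorm 𝒜 p (conv (dilate j η) (resid η j i f)) :=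
          supNorm_sub_le hp h1.1.aestronglyMeasurable (h1.conv _).1.aestronglyMeasurable
      _ ≤ supNorm 𝒜 p (resid η j i f) + kernelNorm 0 η * supNorm 𝒜 p (resid η j i f) := by
        gcongr
        rw [← h.kernelNorm_dilate_zero j]
        exact supNorm_conv_le h.adm hp _ (h.adm.dilate_mem h.supp j) h1.1
      _ = (1 + kernelNorm 0 η) * supNorm 𝒜 p (resid η j i f) := by ring
      _ ≤ (1 + kernelNorm 0 η) * ((1 + kernelNorm 0 η) ^ i * supNorm 𝒜 p f) := by gcongr
      _ = _ := by ring

/-- Since `η` has integral one, each factor `1 - R_j` spends one derivative and gains the first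
moment of the dilated kernel, that is `2^{-j}`. -/
theorem derivNorm_resid_le (hp : 1 ≤ p) {f : E → ℂ} (hf : IsBddSmooth f) (j i m : ℕ) :
    derivNorm 𝒜 p m (resid η j i f) ≤
      kernelMoment η ^ i * pow2 (-(j * i)) * derivNorm 𝒜 p (m + i) f := by
  induction i generalizing m with
  | zero => simp [resid, pow2_zero]
  | succ i ih =>
    have h1 := (hf.resid (η := η) j i)
    calc _ = derivNorm 𝒜 p m (fun x => conv (dilate j η) (resid η j i f) x -
            (∫ y, dilate j η y) • resid η j i f x) := by
          rw [← derivNorm_neg]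
          simp [resid, integral_dilate, h.integral]
      _ ≤ kernelMoment (dilate j η) * derivNorm 𝒜 p (m + 1) (resid η j i f) :=
        derivNorm_conv_sub_le h.adm hp _ (h.adm.dilate_mem h.supp j) h1 m
      _ ≤ (pow2 (-j) * kernelMoment η) *
          (kernelMoment η ^ i * pow2 (-(j * i)) * derivNorm 𝒜 p (m + 1 + i) f) := by
        rw [kernelMoment_dilate]; gcongr; exact ih _
      _ = kernelMoment η ^ (i + 1) * (pow2 (-j) * pow2 (-(j * i))) *
          derivNorm 𝒜 p (m + (i + 1)) f := by
        rw [add_assoc, add_comm 1 i]; ring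
      _ = _ := by rw [← pow2_add]; congr 3; push_cast; ring

/-- The derivatives fall on the outermost dilated kernel, which produces `2^{jm}`; the residuals
below it are bounded uniformly in `j`. -/
theorem derivNorm_moll_le (hp : 1 ≤ p) (L m : ℕ) : ∃ C : ℝ≥0∞, C ≠ ⊤ ∧
    ∀ (j : ℕ) (f : E → ℂ), IsDominated f →
      derivNorm 𝒜 p m (moll η L j f) ≤ C * pow2 (j * m) * supNorm 𝒜 p f := by
  refine ⟨∑ i ∈ Finset.range L, kernelNorm m η * (1 + kernelNorm 0 η) ^ i, ?_, fun j f hf => ?_⟩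
  · refine ENNReal.sum_ne_top.2 fun i _ => ENNReal.mul_ne_top (kernelNorm_lt_top _ _).ne
      (ENNReal.pow_ne_top (ENNReal.add_ne_top.2 ⟨ENNReal.one_ne_top, (kernelNorm_lt_top _ _).ne⟩))
  · refine (derivNorm_sum_le hp _ (fun i _ => (hf.resid j i).isBddSmooth_conv _) m).trans ?_
    rw [Finset.sum_mul, Finset.sum_mul]
    refine Finset.sum_le_sum fun i _ => ?_
    rw [conv_eq_kconv]
    refine (derivNorm_kconv_le h.adm h.closed hp m _ (h.adm.dilate_mem h.supp j)
      (hf.resid j i)).trans ?_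
    rw [kernelNorm_dilate]
    calc _ ≤ pow2 (j * m) * kernelNorm m η * ((1 + kernelNorm 0 η) ^ i * supNorm 𝒜 p f) := by
          gcongr; exact h.supNorm_resid_le hp hf j i
      _ = _ := by ring

theorem derivNorm_mollPrev_le (hp : 1 ≤ p) (L m : ℕ) : ∃ C : ℝ≥0∞, C ≠ ⊤ ∧
    ∀ (j : ℕ) (f : E → ℂ), IsDominated f →
      derivNorm 𝒜 p m (mollPrev η L j f) ≤ C * pow2 (j * m) * supNorm 𝒜 p f := by
  obtain ⟨C, hC, hle⟩ := h.derivNorm_moll_le hp L m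
  refine ⟨C, hC, fun j f hf => ?_⟩
  cases j with
  | zero => simp [mollPrev, derivNorm_zero_fun]
  | succ j =>
    refine (hle j f hf).trans ?_
    gcongr
    exact pow2_mono (by gcongr; simp)

theorem derivNorm_band_le (hp : 1 ≤ p) (L m : ℕ) : ∃ C : ℝ≥0∞, C ≠ ⊤ ∧
    ∀ (j : ℕ) (f : E → ℂ), IsDominated f →
      derivNorm 𝒜 p m (band η L j f) ≤ C * pow2 (j * m) * supNorm 𝒜 p f := by
  obtain ⟨C, hC, hle⟩ := h.derivNorm_moll_le hp L m
  obtain ⟨C', hC', hle'⟩ := h.derivNorm_mollPrev_le hp L m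
  refine ⟨C + C', ENNReal.add_ne_top.2 ⟨hC, hC'⟩, fun j f hf => ?_⟩
  refine (derivNorm_sub_le hp (hf.isBddSmooth_moll L j) (hf.isBddSmooth_mollPrev L j) m).trans ?_
  rw [add_mul, add_mul]
  exact add_le_add (hle j f hf) (hle' j f hf)

/-- For `j > 0` the identity cancels and the band is `(1 - R_{j-1})^L f - (1 - R_j)^L f`, where each
term gains `L` powers of its scale. The factor `2^L` in the constant comes from the coarser scale `j
- 1`. The band of index zero is a full mollification and has no such gain. -/
theorem derivNorm_band_le_of_pos (hp : 1 ≤ p) (L m : ℕ) : ∃ C : ℝ≥0∞, C ≠ ⊤ ∧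
    ∀ (j : ℕ) (f : E → ℂ), 0 < j → IsBddSmooth f →
      derivNorm 𝒜 p m (band η L j f) ≤ C * pow2 (-(j * L)) * derivNorm 𝒜 p (m + L) f := by
  refine ⟨kernelMoment η ^ L * pow2 L + kernelMoment η ^ L, ?_, fun j f hj hf => ?_⟩
  · have := ENNReal.pow_ne_top (n := L) (kernelMoment_lt_top η).ne
    exact ENNReal.add_ne_top.2 ⟨ENNReal.mul_ne_top this (pow2_ne_top _), this⟩
  · obtain ⟨j, rfl⟩ := Nat.exists_eq_succ_of_ne_zero hj.ne'
    have h1 : band η L (j + 1) f = fun x => resid η j L f x - resid η (j + 1) L f x := by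
      ext x; simp only [band, mollPrev, moll_eq]; ring
    rw [Nat.succ_eq_add_one, h1]
    refine (derivNorm_sub_le hp (hf.resid _ _) (hf.resid _ _) m).trans ?_
    rw [add_mul, add_mul]
    refine add_le_add ?_ (h.derivNorm_resid_le hp hf _ _ _)
    refine (h.derivNorm_resid_le hp hf _ _ _).trans ?_
    rw [mul_assoc _ (pow2 L), ← pow2_add]
    refine le_of_eq ?_
    congr 3
    push_cast; ring

end IsMollifier

end Mollifier

/-! ### Sequences in `ℓ^q` and discrete convolution with geometric kernels. -/

section Ellq

variable {q : ℝ≥0∞} {b b' : ℕ → ℝ≥0∞}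

/-- Membership of a sequence of extended nonnegative numbers in `ℓ^q`. -/
def MemEllq (q : ℝ≥0∞) (b : ℕ → ℝ≥0∞) : Prop := eLpNorm b q Measure.count < ⊤

theorem MemEllq.mono (hb : MemEllq q b) (h : ∀ k, b' k ≤ b k) : MemEllq q b' :=
  (eLpNorm_mono_enorm fun k => by simpa using h k).trans_lt hb

theorem aestronglyMeasurable_nat (b : ℕ → ℝ≥0∞) : AEStronglyMeasurable b Measure.count :=
  (measurable_of_countable b).aestronglyMeasurable

theorem MemEllq.add (hq : 1 ≤ q) (hb : MemEllq q b) (hb' : MemEllq q b') :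
    MemEllq q fun k => b k + b' k :=
  (eLpNorm_add_le (aestronglyMeasurable_nat b) (aestronglyMeasurable_nat b') hq).trans_lt
    (ENNReal.add_lt_top.2 ⟨hb, hb'⟩)

theorem MemEllq.zero : MemEllq q fun _ => 0 := by simp [MemEllq]

theorem MemEllq.exists_bound (hq : 1 ≤ q) (hb : MemEllq q b) : ∃ B, B ≠ ⊤ ∧ ∀ k, b k ≤ B := by
  refine ⟨eLpNorm b q Measure.count, hb.ne, fun k => ?_⟩
  have hq0 : q ≠ 0 := (zero_lt_one.trans_le hq).ne'
  have h1 : eLpNorm b q (Measure.count.restrict {k}) ≤ eLpNorm b q Measure.count :=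
    eLpNorm_mono_measure _ Measure.restrict_le_self
  have h2 : Measure.count.restrict {k} = Measure.dirac k := by
    rw [Measure.restrict_singleton]; simp
  rw [h2] at h1
  rcases eq_or_ne q ⊤ with rfl | hqt
  · simpa using h1
  · rw [eLpNorm_eq_lintegral_rpow_enorm_toReal hq0 hqt, lintegral_dirac] at h1
    rwa [enorm_eq_self, ← ENNReal.rpow_mul, mul_one_div_cancel
      (ENNReal.toReal_pos hq0 hqt).ne', ENNReal.rpow_one] at h1

theorem tsum_pow2_ne_top {ε : ℝ} (hε : 0 < ε) : ∑' d : ℕ, pow2 (-(ε * d)) ≠ ⊤ := by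
  have h : ∀ d : ℕ, pow2 (-(ε * d)) = pow2 (-ε) ^ d := fun d => by rw [pow2_pow, neg_mul]
  simp_rw [h]
  rw [ENNReal.tsum_geometric]
  have : pow2 (-ε) < 1 := ENNReal.rpow_lt_one_of_one_lt_of_neg (by norm_num) (by linarith)
  exact ENNReal.inv_ne_top.2 (tsub_pos_of_lt this).ne'

/-- Minkowski's inequality in `ℓ^q` for the finite measure on `ℕ` with weights `2^{-εd}`. -/
theorem memEllq_tsum_of_shift_bound (hq : 1 ≤ q) {ε : ℝ} (hε : 0 < ε) {G : ℕ → ℕ → ℝ≥0∞} {B : ℝ≥0∞}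
    (hB : B ≠ ⊤) (hG : ∀ d, eLpNorm (G d) q Measure.count ≤ B) :
    MemEllq q fun l => ∑' d : ℕ, pow2 (-(ε * d)) * G d l := by
  have hm : Measurable fun d : ℕ => pow2 (-(ε * d)) := measurable_of_countable _
  have hfin : IsFiniteMeasure ((Measure.count : Measure ℕ).withDensity fun d : ℕ => pow2 (-(ε * d))) :=
    isFiniteMeasure_withDensity (by rw [lintegral_count]; exact tsum_pow2_ne_top hε)
  have := eLpNorm_lintegral_le (μ := (Measure.count : Measure ℕ))
    (ν := (Measure.count : Measure ℕ).withDensity fun d : ℕ => pow2 (-(ε * d))) hq (G := G)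
    (measurable_of_countable _) (B := B) (ae_of_all _ hG)
  refine lt_of_le_of_lt (le_trans (le_of_eq ?_) this)
    (ENNReal.mul_lt_top (measure_lt_top _ _) hB.lt_top)
  congr 1
  ext l
  rw [lintegral_withDensity_eq_lintegral_mul _ hm (measurable_of_countable _), lintegral_count]
  rfl

theorem eLpNorm_count_comp_le {g : ℕ → ℕ} (hg : Function.Injective g) (b : ℕ → ℝ≥0∞) :
    eLpNorm (fun l => b (g l)) q Measure.count ≤ eLpNorm b q Measure.count := by
  have h1 := eLpNorm_map_measure (μ := (Measure.count : Measure ℕ)) (f := g) (g := b) (p := q)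
    (measurable_of_countable b).aestronglyMeasurable (measurable_of_countable g).aemeasurable
  rw [show (fun l => b (g l)) = b ∘ g from rfl, ← h1]
  refine eLpNorm_mono_measure _ (Measure.le_iff.2 fun s hs => ?_)
  rw [Measure.map_apply (measurable_of_countable g) hs, ← Measure.count_injective_image hg]
  exact measure_mono (image_preimage_subset _ _)

theorem eLpNorm_count_shift_le (d : ℕ) (b : ℕ → ℝ≥0∞) :
    eLpNorm (fun l => if d < l then b (l - 1 - d) else 0) q Measure.count ≤
      eLpNorm b q Measure.count := by
  set c : ℕ → ℝ≥0∞ := fun l => if d < l then b (l - 1 - d) else 0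
  set g : ℕ → ℕ := fun k => k + 1 + d
  have hg : Function.Injective g := fun a b hab => by simpa [g] using hab
  have h1 := eLpNorm_map_measure (μ := (Measure.count : Measure ℕ)) (f := g) (g := c) (p := q)
    (measurable_of_countable c).aestronglyMeasurable (measurable_of_countable g).aemeasurable
  have h2 : c ∘ g = b := by
    ext k
    have : d < k + 1 + d := by omega
    simp only [c, g, Function.comp, this, if_true]
    congr 1; omega
  have h3 : c = (Ioi d).indicator c := by
    ext l
    by_cases hl : d < l <;> simp [c, hl]
  rw [← h2, ← h1, h3, eLpNorm_indicator_eq_eLpNorm_restrict measurableSet_Ioi, ← h3]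
  refine eLpNorm_mono_measure _ (Measure.le_iff.2 fun s hs => ?_)
  rw [Measure.restrict_apply hs, Measure.map_apply (measurable_of_countable g) hs,
    ← Measure.count_injective_image hg (g ⁻¹' s)]
  refine measure_mono fun l hl => ⟨l - 1 - d, ?_, ?_⟩
  · have : d < l := hl.2
    have h4 : l - 1 - d + 1 + d = l := by omega
    simpa [g, h4] using hl.1
  · have : d < l := hl.2
    simp only [g]; omega

/-- The discrete convolution of `b` with a two-sided geometric kernel. -/
noncomputable def geomConv (ε ε' : ℝ) (b : ℕ → ℝ≥0∞) (l : ℕ) : ℝ≥0∞ :=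
  ∑' k : ℕ, (if k < l then pow2 (-(ε' * (l - k))) else pow2 (-(ε * (k - l)))) * b k

/-- Young's inequality `ℓ¹ * ℓ^q ⊆ ℓ^q` on the half-line. The terms `k ≥ l` are left shifts of `b`,
and the terms `k < l` are right shifts padded with zeros; neither increases the norm. -/
theorem memEllq_geomConv (hq : 1 ≤ q) {ε ε' : ℝ} (hε : 0 < ε) (hε' : 0 < ε') (hb : MemEllq q b) :
    MemEllq q (geomConv ε ε' b) := by
  have h1 : MemEllq q fun l => ∑' d : ℕ, pow2 (-(ε * d)) * b (d + l) :=
    memEllq_tsum_of_shift_bound hq hε (G := fun d l => b (d + l)) hb.ne fun d =>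
      eLpNorm_count_comp_le (add_right_injective d) b
  have h2 : MemEllq q fun l => ∑' d : ℕ, pow2 (-(ε' * d)) * if d < l then b (l - 1 - d) else 0 :=
    memEllq_tsum_of_shift_bound hq hε'
      (G := fun d l => if d < l then b (l - 1 - d) else 0) hb.ne fun d => eLpNorm_count_shift_le d b
  have h3 := h2.add hq h1
  refine h3.mono fun l => ?_
  set w : ℕ → ℝ≥0∞ := fun k =>
    (if k < l then pow2 (-(ε' * (l - k))) else pow2 (-(ε * (k - l)))) * b k with hw
  have h4 : geomConv ε ε' b l = ∑ j ∈ Finset.range l, w (l - 1 - j) + ∑' k, w (k + l) := by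
    rw [Finset.sum_range_reflect w l]
    exact (ENNReal.summable.sum_add_tsum_nat_add' (f := w)).symm
  rw [h4]
  refine add_le_add ?_ ?_
  · refine le_trans (Finset.sum_le_sum fun d hd => ?_) (ENNReal.sum_le_tsum (Finset.range l))
    have hdl : d < l := Finset.mem_range.1 hd
    have h3 : l - 1 - d < l := by omega
    simp only [hw]
    rw [if_pos h3, if_pos hdl]
    gcongr
    refine pow2_mono ?_
    -- Here `k = l - 1 - d`, so `l - k = d + 1`; the surplus factor `2^{-ε'}` is discarded.
    have : (l : ℝ) - ((l - 1 - d : ℕ) : ℝ) = d + 1 := by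
      rw [Nat.sub_sub, Nat.cast_sub (by omega)]; push_cast; ring
    rw [this]
    nlinarith
  · refine ENNReal.tsum_le_tsum fun d => ?_
    have : ¬ (d + l < l) := by omega
    simp only [hw]
    rw [if_neg this]
    simp

/-- The summation common to all the band estimates. For `k ≥ l` the first bound is `2^{l(m-σ)}`
times `2^{-σ(k-l)}`. For `k < l` the second is `2^{l(m-σ)}` times `2^{-(m+L-σ)(l-k)}`, of which the
part `m (l - k)` of the exponent is dropped. -/
theorem tsum_le_geomConv {σ : ℝ} {L m : ℕ} (b : ℕ → ℝ≥0∞) {C : ℝ≥0∞}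
    {a : ℕ → ℕ → ℝ≥0∞}
    (h1 : ∀ l k, a l k ≤ C * pow2 (l * m) * (pow2 (-(k * σ)) * b k))
    (h2 : ∀ l k, k < l → a l k ≤ C * pow2 (-(l * L)) * (pow2 (k * (m + L - σ)) * b k)) (l : ℕ) :
    ∑' k, a l k ≤ C * pow2 (l * (m - σ)) * geomConv σ (L - σ) b l := by
  rw [geomConv, ← ENNReal.tsum_mul_left]
  refine ENNReal.tsum_le_tsum fun k => ?_
  split_ifs with hkl
  · refine (h2 l k hkl).trans ?_
    calc _ = C * (pow2 (-(l * L)) * pow2 (k * (m + L - σ))) * b k := by ring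
      _ ≤ C * (pow2 (l * (m - σ)) * pow2 (-((L - σ) * (l - k)))) * b k := by
        rw [← pow2_add, ← pow2_add]
        gcongr
        refine pow2_mono ?_
        have hk : (k : ℝ) ≤ l := by exact_mod_cast hkl.le
        nlinarith [mul_le_mul_of_nonneg_right hk (Nat.cast_nonneg (α := ℝ) m)]
      _ = _ := by ring
  · refine (h1 l k).trans ?_
    calc _ = C * (pow2 (l * m) * pow2 (-(k * σ))) * b k := by ring
      _ = C * (pow2 (l * (m - σ)) * pow2 (-(σ * (k - l)))) * b k := by
        rw [← pow2_add, ← pow2_add]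
        congr 3; ring
      _ ≤ _ := le_of_eq (by ring)

end Ellq

/-! ### Smoothness expressed by series of smooth pieces. -/

section Decomposition

variable {E : Type} [NormedAddCommGroup E] [InnerProductSpace ℝ E] [FiniteDimensional ℝ E]
  [MeasurableSpace E] [BorelSpace E]
  {𝒜 : Set (Set E)} {p q : ℝ≥0∞} {σ : ℝ} {F : ℕ → E → ℂ}

/-- The functions `F k` satisfy the bounds of a Littlewood–Paley decomposition of a function of
smoothness `σ`. -/
structure IsDecomposition (𝒜 : Set (Set E)) (p q : ℝ≥0∞) (σ : ℝ) (F : ℕ → E → ℂ) : Prop where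
  smooth : ∀ k, IsBddSmooth (F k)
  bound : ∃ b, MemEllq q b ∧ ∀ m : ℕ, ∃ C : ℝ≥0∞, C ≠ ⊤ ∧
    ∀ k : ℕ, derivNorm 𝒜 p m (F k) ≤ C * (pow2 (k * (m - σ)) * b k)

/-- The series `∑ F k` converges to `f` in the norm `supNorm`. -/
def Approximates (𝒜 : Set (Set E)) (p : ℝ≥0∞) (F : ℕ → E → ℂ) (f : E → ℂ) : Prop :=
  Tendsto (fun K => supNorm 𝒜 p fun x => f x - ∑ k ∈ Finset.range K, F k x) atTop (𝓝 0)

theorem supNorm_mono_family {𝒜 ℬ : Set (Set E)} (h : ∀ A ∈ 𝒜, ∃ B ∈ ℬ, A ⊆ B)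
    {G : Type} [NormedAddCommGroup G] (f : E → G) : supNorm 𝒜 p f ≤ supNorm ℬ p f := by
  refine supNorm_le fun A hA => ?_
  obtain ⟨B, hB, hAB⟩ := h A hA
  exact (eLpNorm_mono_measure _ (Measure.restrict_mono hAB le_rfl)).trans (eLpNorm_le_supNorm hB f)

theorem IsDecomposition.mono_family {ℬ : Set (Set E)} (hF : IsDecomposition ℬ p q σ F)
    (h : ∀ A ∈ 𝒜, ∃ B ∈ ℬ, A ⊆ B) : IsDecomposition 𝒜 p q σ F := by
  obtain ⟨hs, b, hb, hle⟩ := hF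
  refine ⟨hs, b, hb, fun m => ?_⟩
  obtain ⟨C, hC, hm⟩ := hle m
  exact ⟨C, hC, fun k => (supNorm_mono_family h _).trans (hm k)⟩

theorem Approximates.mono_family {ℬ : Set (Set E)} {f : E → ℂ} (hF : Approximates ℬ p F f)
    (h : ∀ A ∈ 𝒜, ∃ B ∈ ℬ, A ⊆ B) : Approximates 𝒜 p F f :=
  tendsto_of_tendsto_of_tendsto_of_le_of_le tendsto_const_nhds hF (fun _ => bot_le)
    fun _ => supNorm_mono_family h _

theorem IsDecomposition.derivNorm_ne_top (hq : 1 ≤ q) (hF : IsDecomposition 𝒜 p q σ F) (m k : ℕ) :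
    derivNorm 𝒜 p m (F k) ≠ ⊤ := by
  obtain ⟨_, b, hb, hle⟩ := hF
  obtain ⟨B, hB, hbB⟩ := hb.exists_bound hq
  obtain ⟨C, hC, hm⟩ := hle m
  exact ((hm k).trans_lt (ENNReal.mul_lt_top hC.lt_top (ENNReal.mul_lt_top (pow2_ne_top _).lt_top
    ((hbB k).trans_lt hB.lt_top)))).ne

/-- For derivatives of order below `σ` the factors `2^{k(m-σ)}` are summable, and boundedness of `b`
is enough. -/
theorem IsDecomposition.tsum_derivNorm_ne_top (hq : 1 ≤ q) (hF : IsDecomposition 𝒜 p q σ F) {m : ℕ}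
    (hm : m < σ) : ∑' k, derivNorm 𝒜 p m (F k) ≠ ⊤ := by
  obtain ⟨_, b, hb, hle⟩ := hF
  obtain ⟨B, hB, hbB⟩ := hb.exists_bound hq
  obtain ⟨C, hC, hmC⟩ := hle m
  have h1 : ∑' k : ℕ, C * (pow2 (k * (m - σ)) * B) ≠ ⊤ := by
    rw [ENNReal.tsum_mul_left, ENNReal.tsum_mul_right]
    refine ENNReal.mul_ne_top hC (ENNReal.mul_ne_top ?_ hB)
    have := tsum_pow2_ne_top (sub_pos.2 hm)
    simpa only [show ∀ k : ℕ, -((σ - m) * k) = k * (m - σ) from fun k => by ring] using this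
  refine ne_top_of_le_ne_top h1 (ENNReal.tsum_le_tsum fun k => (hmC k).trans ?_)
  gcongr
  exact hbB k

theorem IsDecomposition.add (hp : 1 ≤ p) (hq : 1 ≤ q) {F' : ℕ → E → ℂ}
    (hF : IsDecomposition 𝒜 p q σ F) (hF' : IsDecomposition 𝒜 p q σ F') :
    IsDecomposition 𝒜 p q σ fun k x => F k x + F' k x := by
  obtain ⟨hs, b, hb, hle⟩ := hF
  obtain ⟨hs', b', hb', hle'⟩ := hF'
  refine ⟨fun k => (hs k).add (hs' k), fun k => b k + b' k, hb.add hq hb', fun m => ?_⟩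
  obtain ⟨C, hC, hm⟩ := hle m
  obtain ⟨C', hC', hm'⟩ := hle' m
  refine ⟨C + C', ENNReal.add_ne_top.2 ⟨hC, hC'⟩, fun k => ?_⟩
  refine (derivNorm_add_le hp (hs k) (hs' k) m).trans ((add_le_add (hm k) (hm' k)).trans ?_)
  calc _ ≤ C * (pow2 (k * (m - σ)) * (b k + b' k)) + C' * (pow2 (k * (m - σ)) * (b k + b' k)) := by
        gcongr <;> simp
    _ = _ := by ring

theorem IsDecomposition.zero : IsDecomposition 𝒜 p q σ fun _ _ => 0 :=
  ⟨fun _ => .zero, fun _ => 0, .zero, fun m => ⟨0, by simp, fun k => by simp [derivNorm_zero_fun]⟩⟩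

theorem supNorm_mul_le {f g : E → ℂ} (hg : AEStronglyMeasurable g) :
    supNorm 𝒜 p (fun x => f x * g x) ≤ supNorm 𝒜 ⊤ f * supNorm 𝒜 p g := by
  refine supNorm_le fun A hA => ?_
  have := eLpNorm_le_eLpNorm_top_mul_eLpNorm (μ := volume.restrict A) p f hg.restrict
    (fun x y => x * y) 1 (ae_of_all _ fun x => by simp)
  refine this.trans ?_
  rw [ENNReal.coe_one, one_mul]
  exact mul_le_mul' (eLpNorm_le_supNorm hA f) (eLpNorm_le_supNorm hA g)

/-- The Leibniz rule for the norms of the derivatives of a product. -/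
theorem derivNorm_mul_le (hp : 1 ≤ p) {f g : E → ℂ} (hf : IsBddSmooth f) (hg : IsBddSmooth g)
    (m : ℕ) : derivNorm 𝒜 p m (fun x => f x * g x) ≤ ∑ i ∈ Finset.range (m + 1),
      (m.choose i : ℝ≥0∞) * (derivNorm 𝒜 ⊤ i f * derivNorm 𝒜 p (m - i) g) := by
  have hm : ∀ i, AEStronglyMeasurable fun x => ‖iteratedFDeriv ℝ i g x‖ := fun i =>
    (hg.aestronglyMeasurable_iteratedFDeriv i).norm
  have hm' : ∀ i, AEStronglyMeasurable fun x => ‖iteratedFDeriv ℝ i f x‖ := fun i =>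
    (hf.aestronglyMeasurable_iteratedFDeriv i).norm
  have h1 : derivNorm 𝒜 p m (fun x => f x * g x) ≤ supNorm 𝒜 p fun x =>
      ∑ i ∈ Finset.range (m + 1),
        (m.choose i : ℝ) * (‖iteratedFDeriv ℝ i f x‖ * ‖iteratedFDeriv ℝ (m - i) g x‖) := by
    refine supNorm_mono fun x => ?_
    refine (norm_iteratedFDeriv_mul_le hf.1 hg.1 x (by exact_mod_cast le_top)).trans ?_
    simp only [mul_assoc]
    exact le_abs_self _
  refine h1.trans ((supNorm_sum_le hp _ fun i _ => ((hm' i).mul (hm _)).const_mul _).trans ?_)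
  refine Finset.sum_le_sum fun i _ => ?_
  refine (supNorm_const_mul_le (m.choose i : ℝ) (fun x => le_of_eq ?_)
    (g := fun x => ((‖iteratedFDeriv ℝ i f x‖ : ℝ) : ℂ) *
      ((‖iteratedFDeriv ℝ (m - i) g x‖ : ℝ) : ℂ))).trans ?_
  · simp
  · rw [ENNReal.ofReal_natCast]
    gcongr
    refine (supNorm_mul_le
      (Complex.continuous_ofReal.comp_aestronglyMeasurable (hm (m - i)))).trans (le_of_eq ?_)
    congr 1 <;> exact supNorm_congr_norm fun x => by simp

theorem IsBddSmooth.derivNorm_top_ne_top {f : E → ℂ} (hf : IsBddSmooth f) (m : ℕ) :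
    derivNorm 𝒜 ⊤ m f ≠ ⊤ := by
  obtain ⟨C, hC⟩ := hf.2 m
  refine ne_top_of_le_ne_top (ENNReal.ofReal_ne_top (r := C)) (supNorm_le fun A _ => ?_)
  rw [eLpNorm_exponent_top]
  exact eLpNormEssSup_le_of_ae_bound (ae_of_all _ hC)

/-- A derivative that falls on the fixed function `χ` costs no power of `2^k`, so each Leibniz term
is at most of the size required of the pure derivative of `F k`. -/
theorem IsDecomposition.mul_left (hp : 1 ≤ p) {χ : E → ℂ} (hχ : IsBddSmooth χ)
    (hF : IsDecomposition 𝒜 p q σ F) : IsDecomposition 𝒜 p q σ fun k x => χ x * F k x := by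
  obtain ⟨hs, b, hb, hle⟩ := hF
  choose C hC hm using hle
  refine ⟨fun k => hχ.mul (hs k), b, hb, fun m => ⟨∑ i ∈ Finset.range (m + 1),
    (m.choose i : ℝ≥0∞) * (derivNorm 𝒜 ⊤ i χ * C (m - i)), ?_, fun k => ?_⟩⟩
  · exact ENNReal.sum_ne_top.2 fun i _ => ENNReal.mul_ne_top (by simp)
      (ENNReal.mul_ne_top (hχ.derivNorm_top_ne_top i) (hC _))
  · refine (derivNorm_mul_le hp hχ (hs k) m).trans ?_
    rw [Finset.sum_mul]
    refine Finset.sum_le_sum fun i hi => ?_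
    rw [mul_assoc, mul_assoc]
    gcongr
    refine (hm (m - i) k).trans ?_
    gcongr
    refine pow2_mono ?_
    gcongr
    omega

end Decomposition

/-! ### Bands of decomposable functions, and the paraproduct. -/

section Bands

variable {E : Type} [NormedAddCommGroup E] [InnerProductSpace ℝ E] [FiniteDimensional ℝ E]
  [MeasurableSpace E] [BorelSpace E]
  {𝒜 : Set (Set E)} {D : Set E} {p q : ℝ≥0∞} {σ s : ℝ} {η : 𝓢(E, ℂ)} {F : ℕ → E → ℂ}
  {f u v w : E → ℂ} {L : ℕ}

theorem IsDominated.sub_sum (hf : IsDominated f) (hF : ∀ k, IsBddSmooth (F k)) (K : ℕ) :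
    IsDominated fun x => f x - ∑ k ∈ Finset.range K, F k x :=
  hf.sub (IsBddSmooth.sum _ fun k _ => hF k).isDominated

theorem apply_eq_add_sum {T : (E → ℂ) → E → ℂ}
    (hsub : ∀ f g, IsDominated f → IsDominated g →
      T (fun x => f x - g x) = fun x => T f x - T g x)
    (hf : IsDominated f) (hF : ∀ k, IsBddSmooth (F k)) (K : ℕ) (x : E) :
    T f x = T (fun x => f x - ∑ k ∈ Finset.range K, F k x) x +
      ∑ k ∈ Finset.range K, T (F k) x := by
  induction K with
  | zero => simp
  | succ K ih =>
    have h1 : (fun x => f x - ∑ k ∈ Finset.range (K + 1), F k x) =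
        fun x => (fun x => f x - ∑ k ∈ Finset.range K, F k x) x - F K x := by
      ext x; rw [Finset.sum_range_succ]; ring
    rw [h1, hsub _ _ (hf.sub_sum hF K) (hF K).isDominated, Finset.sum_range_succ, ih]
    ring

/-- The operator `T` is linear and bounded from the norm in which `∑ F k` converges, so the image of
the remainder tends to zero. Only the finiteness of `C` matters: it may grow with the scale without
affecting the conclusion. -/
theorem derivNorm_le_tsum (hp : 1 ≤ p) {T : (E → ℂ) → E → ℂ} {m : ℕ}
    (hsub : ∀ f g, IsDominated f → IsDominated g →
      T (fun x => f x - g x) = fun x => T f x - T g x)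
    (hsmooth : ∀ f, IsDominated f → IsBddSmooth (T f)) {C : ℝ≥0∞} (hC : C ≠ ⊤)
    (hle : ∀ f, IsDominated f → derivNorm 𝒜 p m (T f) ≤ C * supNorm 𝒜 p f)
    (hf : IsDominated f) (hF : ∀ k, IsBddSmooth (F k)) (happ : Approximates 𝒜 p F f) :
    derivNorm 𝒜 p m (T f) ≤ ∑' k, derivNorm 𝒜 p m (T (F k)) := by
  have h1 : ∀ K, derivNorm 𝒜 p m (T f) ≤
      C * supNorm 𝒜 p (fun x => f x - ∑ k ∈ Finset.range K, F k x) +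
        ∑' k, derivNorm 𝒜 p m (T (F k)) := by
    intro K
    have hTF := fun k => hsmooth _ (hF k).isDominated
    calc derivNorm 𝒜 p m (T f)
        = derivNorm 𝒜 p m (fun x => T (fun x => f x - ∑ k ∈ Finset.range K, F k x) x +
          ∑ k ∈ Finset.range K, T (F k) x) := by
          congr 1; ext x; exact apply_eq_add_sum hsub hf hF K x
      _ ≤ _ := derivNorm_add_le hp (hsmooth _ (hf.sub_sum hF K)) (.sum _ fun k _ => hTF k) m
      _ ≤ _ := add_le_add (hle _ (hf.sub_sum hF K))
        ((derivNorm_sum_le hp _ (fun k _ => hTF k) m).trans (ENNReal.sum_le_tsum _))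
  have h2 := (ENNReal.Tendsto.const_mul (a := C) happ (Or.inr hC)).add_const
    (∑' k, derivNorm 𝒜 p m (T (F k)))
  rw [mul_zero, zero_add] at h2
  exact ge_of_tendsto' h2 h1

theorem Approximates.shift (happ : Approximates 𝒜 p F f) (K : ℕ) :
    Approximates 𝒜 p (fun k => F (K + k)) fun x => f x - ∑ k ∈ Finset.range K, F k x := by
  have := happ.comp (tendsto_add_atTop_nat K)
  refine this.congr fun n => ?_
  simp only [Function.comp]
  congr 1; ext x
  rw [add_comm, Finset.sum_range_add]; ring

namespace IsMollifier

variable (h : IsMollifier 𝒜 D η)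
include h

/-- The frequency bands of a decomposable function form a decomposition. -/
theorem isDecomposition_band (hp : 1 ≤ p) (hq : 1 ≤ q) (hσ : 0 < σ) (hσL : σ < L)
    (hf : IsDominated f) (hF : IsDecomposition 𝒜 p q σ F) (happ : Approximates 𝒜 p F f) :
    IsDecomposition 𝒜 p q σ fun j => band η L j f := by
  obtain ⟨hs, b, hb, hle⟩ := hF
  choose C hC hm using hle
  refine ⟨fun j => hf.isBddSmooth_band L j, geomConv σ (L - σ) b,
    memEllq_geomConv hq hσ (sub_pos.2 hσL) hb, fun m => ?_⟩
  obtain ⟨C₁, hC₁, h₁⟩ := h.derivNorm_band_le hp L m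
  obtain ⟨C₂, hC₂, h₂⟩ := h.derivNorm_band_le_of_pos hp L m
  refine ⟨C₁ * C 0 + C₂ * C (m + L), ENNReal.add_ne_top.2 ⟨ENNReal.mul_ne_top hC₁ (hC _),
    ENNReal.mul_ne_top hC₂ (hC _)⟩, fun j => ?_⟩
  have h3 : derivNorm 𝒜 p m (band η L j f) ≤ ∑' k, derivNorm 𝒜 p m (band η L j (F k)) :=
    derivNorm_le_tsum hp (fun f g hf hg => band_sub hf hg L j)
      (fun f hf => hf.isBddSmooth_band L j) (ENNReal.mul_ne_top hC₁ (pow2_ne_top (j * m)))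
      (h₁ j) hf hs happ
  refine h3.trans ((tsum_le_geomConv (σ := σ) (L := L) (m := m) b
    (a := fun l k => derivNorm 𝒜 p m (band η L l (F k)))
    (C := C₁ * C 0 + C₂ * C (m + L)) ?_ ?_ j).trans (le_of_eq (mul_assoc _ _ _)))
  · intro l k
    refine (h₁ l _ (hs k).isDominated).trans ?_
    rw [← derivNorm_zero]
    calc _ ≤ C₁ * pow2 (l * m) * (C 0 * (pow2 (k * ((0 : ℕ) - σ)) * b k)) := by
          gcongr; exact hm 0 k
      _ = C₁ * C 0 * pow2 (l * m) * (pow2 (-(k * σ)) * b k) := by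
        rw [show (k : ℝ) * ((0 : ℕ) - σ) = -(k * σ) by push_cast; ring]; ring
      _ ≤ _ := by gcongr; simp
  -- The inequality `k < l` makes `l` positive, so the gain of `L` derivatives is available for this
  -- band.
  · intro l k hkl
    refine (h₂ l _ (by omega) (hs k)).trans ?_
    calc _ ≤ C₂ * pow2 (-(l * L)) * (C (m + L) * (pow2 (k * ((m + L : ℕ) - σ)) * b k)) := by
          gcongr; exact hm _ k
      _ = C₂ * C (m + L) * pow2 (-(l * L)) * (pow2 (k * (m + L - σ)) * b k) := by
        push_cast; ring
      _ ≤ _ := by gcongr; simp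

theorem derivNorm_resid_le_self (hp : 1 ≤ p) (hf : IsBddSmooth f) (j i m : ℕ) :
    derivNorm 𝒜 p m (resid η j i f) ≤ (1 + kernelNorm 0 η) ^ i * derivNorm 𝒜 p m f := by
  induction i with
  | zero => simp [resid]
  | succ i ih =>
    have h1 := (hf.resid (η := η) j i)
    calc _ ≤ derivNorm 𝒜 p m (resid η j i f) +
            derivNorm 𝒜 p m (conv (dilate j η) (resid η j i f)) :=
          derivNorm_sub_le hp h1 (h1.isDominated.isBddSmooth_conv _) m
      _ ≤ derivNorm 𝒜 p m (resid η j i f) +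
          kernelNorm 0 η * derivNorm 𝒜 p m (resid η j i f) := by
        gcongr
        rw [← h.kernelNorm_dilate_zero j]
        exact derivNorm_conv_le h.adm hp _ (h.adm.dilate_mem h.supp j) h1 m
      _ = (1 + kernelNorm 0 η) * derivNorm 𝒜 p m (resid η j i f) := by ring
      _ ≤ (1 + kernelNorm 0 η) * ((1 + kernelNorm 0 η) ^ i * derivNorm 𝒜 p m f) := by gcongr
      _ = _ := by ring

theorem derivNorm_moll_le_self (hp : 1 ≤ p) (hf : IsBddSmooth f) (L j m : ℕ) :
    derivNorm 𝒜 p m (moll η L j f) ≤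
      (1 + (1 + kernelNorm 0 η) ^ L) * derivNorm 𝒜 p m f := by
  have h1 : moll η L j f = fun x => f x - resid η j L f x := funext fun x => moll_eq L j f x
  rw [h1, add_mul, one_mul]
  exact (derivNorm_sub_le hp hf (hf.resid j L) m).trans
    (add_le_add le_rfl (h.derivNorm_resid_le_self hp hf j L m))

/-- With `f_K` the `K`-th partial sum, `S_J f - f_K = S_J (f - f_K) - (1 - S_J) f_K`. The first term
is bounded by the tail of the series uniformly in `J`, because derivatives pass through `S_J` to the
pieces. The second tends to zero as `J → ∞`, because `f_K` has finite derivative norms of all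
orders. -/
theorem eventually_derivNorm_moll_sub_le (hp : 1 ≤ p) (hq : 1 ≤ q) (hL : 0 < L)
    (hf : IsDominated f) (hF : IsDecomposition 𝒜 p q σ F) (happ : Approximates 𝒜 p F f) (m K : ℕ)
    {δ : ℝ≥0∞} (hδ : 0 < δ) :
    ∀ᶠ J in atTop, derivNorm 𝒜 p m (fun x => moll η L J f x - ∑ k ∈ Finset.range K, F k x) ≤
      (1 + (1 + kernelNorm 0 η) ^ L) * (∑' k, derivNorm 𝒜 p m (F (K + k))) + δ := by
  set fK : E → ℂ := fun x => ∑ k ∈ Finset.range K, F k x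
  have hfK : IsBddSmooth fK := .sum _ fun k _ => hF.smooth k
  have hfin : derivNorm 𝒜 p (m + L) fK ≠ ⊤ :=
    ne_top_of_le_ne_top (ENNReal.sum_ne_top.2 fun k _ => hF.derivNorm_ne_top hq (m + L) k)
      (derivNorm_sum_le hp _ (fun k _ => hF.smooth k) _)
  have h0 : Tendsto (fun J : ℕ => kernelMoment η ^ L * pow2 (-(J * L)) *
      derivNorm 𝒜 p (m + L) fK) atTop (𝓝 0) := by
    have h1 : Tendsto (fun J : ℕ => pow2 (-(J * L))) atTop (𝓝 0) := by
      have h2 : ∀ J : ℕ, pow2 (-(J * L)) = pow2 (-L) ^ J := fun J => by rw [pow2_pow]; congr 1; ring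
      simp_rw [h2]
      exact ENNReal.tendsto_pow_atTop_nhds_zero_of_lt_one
        (ENNReal.rpow_lt_one_of_one_lt_of_neg (by norm_num) (by simpa using hL))
    have h3 := ENNReal.Tendsto.const_mul (a := kernelMoment η ^ L) h1
      (Or.inr (ENNReal.pow_ne_top (kernelMoment_lt_top η).ne))
    have h4 := ENNReal.Tendsto.mul_const (b := derivNorm 𝒜 p (m + L) fK) h3 (Or.inr hfin)
    simpa using h4
  filter_upwards [h0.eventually (gt_mem_nhds hδ)] with J hJ
  have hd := hf.sub_sum hF.smooth K
  have e1 : (fun x => moll η L J f x - fK x) =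
      fun x => moll η L J (fun x => f x - fK x) x - resid η J L fK x := by
    rw [moll_sub hf hfK.isDominated]
    ext x
    have h1 := moll_eq (η := η) L J fK x
    linear_combination h1
  obtain ⟨C, hC, hle⟩ := h.derivNorm_moll_le hp L m
  rw [e1]
  refine (derivNorm_sub_le hp (hd.isBddSmooth_moll L J) (hfK.resid J L) m).trans
    (add_le_add ?_ ((h.derivNorm_resid_le hp hfK J L m).trans hJ.le))
  have h3 := derivNorm_le_tsum (T := moll η L J) hp (fun f g hf hg => moll_sub hf hg L J)
      (fun f hf => hf.isBddSmooth_moll L J) (ENNReal.mul_ne_top hC (pow2_ne_top (J * m)))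
      (hle J) hd (fun k => hF.smooth (K + k)) (happ.shift K)
  refine h3.trans ?_
  rw [← ENNReal.tsum_mul_left]
  exact ENNReal.tsum_le_tsum fun k => h.derivNorm_moll_le_self hp (hF.smooth _) L J m

/-- If a linear operator `Λ` of order `m < σ` applied to the pieces of a decomposition gives an
approximation of `w`, then so does `Λ` applied to the frequency bands. -/
theorem approximates_band (hp : 1 ≤ p) (hq : 1 ≤ q) (hL : 0 < L) (hf : IsDominated f)
    (hF : IsDecomposition 𝒜 p q σ F) (happ : Approximates 𝒜 p F f) {m : ℕ} (hm : m < σ)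
    {Λ : (E → ℂ) → E → ℂ} {c : ℝ≥0∞} (hc : c ≠ ⊤)
    (hΛ : ∀ g, IsBddSmooth g → supNorm 𝒜 p (Λ g) ≤ c * derivNorm 𝒜 p m g)
    (hΛm : ∀ g, IsBddSmooth g → AEStronglyMeasurable (Λ g))
    (hΛsub : ∀ g₁ g₂, IsBddSmooth g₁ → IsBddSmooth g₂ →
      Λ (fun x => g₁ x - g₂ x) = fun x => Λ g₁ x - Λ g₂ x)
    (hΛsum : ∀ (K : ℕ) (G : ℕ → E → ℂ), (∀ k, IsBddSmooth (G k)) →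
      Λ (fun x => ∑ k ∈ Finset.range K, G k x) = fun x => ∑ k ∈ Finset.range K, Λ (G k) x)
    (hw : AEStronglyMeasurable w) (happw : Approximates 𝒜 p (fun k => Λ (F k)) w) :
    Approximates 𝒜 p (fun j => Λ (band η L j f)) w := by
  set c' := 1 + (1 + kernelNorm 0 η) ^ L
  have hc' : c' ≠ ⊤ := ENNReal.add_ne_top.2 ⟨ENNReal.one_ne_top, ENNReal.pow_ne_top
    (ENNReal.add_ne_top.2 ⟨ENNReal.one_ne_top, (kernelNorm_lt_top _ _).ne⟩)⟩
  rw [Approximates, ← tendsto_add_atTop_iff_nat 1]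
  -- The bands of index `0, …, J` telescope to the mollification of index `J`, whence the shift of
  -- the limit by one.
  have hsum : ∀ J, (fun x => ∑ j ∈ Finset.range (J + 1), Λ (band η L j f) x) =
      Λ (moll η L J f) := fun J => by
    rw [← hΛsum _ _ fun j => hf.isBddSmooth_band L j]
    congr 1; ext x; rw [sum_band]; rfl
  rw [ENNReal.tendsto_nhds_zero]
  intro ε hε
  have htail : Tendsto (fun K => supNorm 𝒜 p (fun x => w x - ∑ k ∈ Finset.range K, Λ (F k) x) +
      c * (c' * ∑' k, derivNorm 𝒜 p m (F (K + k)))) atTop (𝓝 (0 + c * (c' * 0))) := by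
    refine Tendsto.add happw (ENNReal.Tendsto.const_mul
      (ENNReal.Tendsto.const_mul ?_ (Or.inr hc')) (Or.inr hc))
    simpa only [add_comm] using ENNReal.tendsto_sum_nat_add _ (hF.tsum_derivNorm_ne_top hq hm)
  rw [mul_zero, mul_zero, add_zero] at htail
  obtain ⟨ε', hε', hεε'⟩ := exists_between hε
  obtain ⟨K, hK⟩ := (htail.eventually (gt_mem_nhds hε')).exists
  -- The error `ε` is split into `ε'` for the tails and `ε - ε'` for the mollification error. Since
  -- `c` may vanish, the division is by `c + 1`.
  obtain ⟨δ, hδ, hδc⟩ : ∃ δ : ℝ≥0∞, 0 < δ ∧ c * δ ≤ ε - ε' := by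
    refine ⟨(ε - ε') / (c + 1), ENNReal.div_pos (tsub_pos_of_lt hεε').ne'
      (ENNReal.add_ne_top.2 ⟨hc, ENNReal.one_ne_top⟩), ?_⟩
    rw [← mul_div_assoc, mul_comm]
    refine ENNReal.div_le_of_le_mul ?_
    gcongr; exact le_self_add
  filter_upwards [h.eventually_derivNorm_moll_sub_le hp hq hL hf hF happ m K hδ] with J hJ
  have hs := hf.isBddSmooth_moll (η := η) L J
  have hsK : IsBddSmooth (fun x => ∑ k ∈ Finset.range K, F k x) := .sum _ fun k _ => hF.smooth k
  have e1 : (fun x => w x - ∑ j ∈ Finset.range (J + 1), Λ (band η L j f) x) =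
      fun x => w x - Λ (moll η L J f) x := by
    ext x; rw [← hsum]
  have e2 := hΛsum K F hF.smooth
  rw [e1]
  refine (supNorm_sub_le_add hp hw (hΛm _ hsK) (hΛm _ hs)).trans ?_
  rw [supNorm_sub_comm (Λ _)]
  have e3 : supNorm 𝒜 p (fun x => Λ (moll η L J f) x - Λ (fun x => ∑ k ∈ Finset.range K, F k x) x)
      ≤ c * (c' * (∑' k, derivNorm 𝒜 p m (F (K + k))) + δ) := by
    rw [← hΛsub _ _ hs hsK]
    exact (hΛ _ (hs.sub hsK)).trans (by gcongr)
  rw [e2] at e3 ⊢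
  calc _ ≤ _ := add_le_add le_rfl e3
    _ = (supNorm 𝒜 p (fun x => w x - ∑ k ∈ Finset.range K, Λ (F k) x) +
        c * (c' * ∑' k, derivNorm 𝒜 p m (F (K + k)))) + c * δ := by ring
    _ ≤ ε' + (ε - ε') := add_le_add hK.le hδc
    _ = ε := add_tsub_cancel_of_le hεε'.le

theorem approximates_band_self (hp : 1 ≤ p) (hq : 1 ≤ q) (hL : 0 < L) (hσ : 0 < σ)
    (hf : IsDominated f) (hF : IsDecomposition 𝒜 p q σ F) (happ : Approximates 𝒜 p F f) :
    Approximates 𝒜 p (fun j => band η L j f) f :=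
  h.approximates_band (m := 0) (Λ := id) hp hq hL hf hF happ (by simpa using hσ) ENNReal.one_ne_top
    (fun g _ => by rw [derivNorm_zero, one_mul]; rfl) (fun g hg => hg.1.continuous.aestronglyMeasurable)
    (fun _ _ _ _ => rfl) (fun _ _ _ => rfl) hf.1.aestronglyMeasurable happ

end IsMollifier

/-! ### Directional derivatives -/

theorem IsBddSmooth.fderiv_apply (hf : IsBddSmooth f) (e : E) :
    IsBddSmooth fun x => _root_.fderiv ℝ f x e :=
  hf.fderiv.clm_comp (ContinuousLinearMap.apply ℝ ℂ e)

theorem derivNorm_fderiv_apply_le (hf : IsBddSmooth f) (e : E) (m : ℕ) :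
    derivNorm 𝒜 p m (fun x => fderiv ℝ f x e) ≤
      ‖ContinuousLinearMap.apply ℝ ℂ e‖ₑ * derivNorm 𝒜 p (m + 1) f := by
  rw [derivNorm_succ]
  exact derivNorm_clm_comp_le hf.fderiv (ContinuousLinearMap.apply ℝ ℂ e) m

theorem IsDecomposition.fderiv_apply (hF : IsDecomposition 𝒜 p q σ F) (e : E) :
    IsDecomposition 𝒜 p q (σ - 1) fun k x => fderiv ℝ (F k) x e := by
  obtain ⟨hs, b, hb, hle⟩ := hF
  refine ⟨fun k => (hs k).fderiv_apply e, b, hb, fun m => ?_⟩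
  obtain ⟨C, hC, hm⟩ := hle (m + 1)
  refine ⟨‖ContinuousLinearMap.apply ℝ ℂ e‖ₑ * C, ENNReal.mul_ne_top (by simp) hC, fun k => ?_⟩
  refine (derivNorm_fderiv_apply_le (hs k) e m).trans ?_
  rw [mul_assoc]
  gcongr
  refine (hm k).trans (le_of_eq ?_)
  congr 3; push_cast; ring

theorem fderiv_sum_apply (hF : ∀ k, IsBddSmooth (F k)) (e : E) (K : ℕ) :
    (fun x => fderiv ℝ (fun x => ∑ k ∈ Finset.range K, F k x) x e) =
      fun x => ∑ k ∈ Finset.range K, fderiv ℝ (F k) x e := by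
  ext x
  rw [fderiv_fun_sum fun k _ => (hF k).differentiable x]
  simp

theorem IsMollifier.approximates_fderiv_band (h : IsMollifier 𝒜 D η) (hp : 1 ≤ p) (hq : 1 ≤ q)
    (hL : 0 < L) (hσ : 1 < σ) (hf : IsDominated f) (hF : IsDecomposition 𝒜 p q σ F)
    (happ : Approximates 𝒜 p F f) (e : E) (hw : AEStronglyMeasurable w)
    (happw : Approximates 𝒜 p (fun k x => fderiv ℝ (F k) x e) w) :
    Approximates 𝒜 p (fun j x => fderiv ℝ (band η L j f) x e) w := by
  refine h.approximates_band (m := 1) (Λ := fun g x => fderiv ℝ g x e) hp hq hL hf hF happ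
    (by simpa using hσ) (c := ‖ContinuousLinearMap.apply ℝ ℂ e‖ₑ) (by simp) (fun g hg => ?_)
    (fun g hg => (hg.fderiv_apply e).1.continuous.aestronglyMeasurable) (fun g₁ g₂ h₁ h₂ => ?_)
    (fun K G hG => fderiv_sum_apply hG e K) hw happw
  · rw [← derivNorm_zero]; exact derivNorm_fderiv_apply_le hg e 0
  · ext x
    rw [fderiv_fun_sub (h₁.differentiable x) (h₂.differentiable x)]; rfl

/-! ### Products -/

/-- The product of a decomposition with functions whose derivatives grow like powers of the
frequency. -/
theorem IsDecomposition.mul_of_growth (hp : 1 ≤ p) (hF : IsDecomposition 𝒜 p q σ F) {τ : ℝ}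
    {H : ℕ → E → ℂ} (hH : ∀ k, IsBddSmooth (H k)) (hle : ∀ i : ℕ, ∃ C : ℝ≥0∞, C ≠ ⊤ ∧
      ∀ k : ℕ, derivNorm 𝒜 ⊤ i (H k) ≤ C * pow2 (k * (i + τ))) :
    IsDecomposition 𝒜 p q (σ - τ) fun k x => H k x * F k x := by
  obtain ⟨hs, b, hb, hm⟩ := hF
  choose C hC hm using hm
  choose C' hC' hle using hle
  refine ⟨fun k => (hH k).mul (hs k), b, hb, fun m => ⟨∑ i ∈ Finset.range (m + 1),
    (m.choose i : ℝ≥0∞) * (C' i * C (m - i)), ?_, fun k => ?_⟩⟩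
  · exact ENNReal.sum_ne_top.2 fun i _ => ENNReal.mul_ne_top (by simp)
      (ENNReal.mul_ne_top (hC' i) (hC _))
  · refine (derivNorm_mul_le hp (hH k) (hs k) m).trans ?_
    rw [Finset.sum_mul]
    refine Finset.sum_le_sum fun i hi => ?_
    rw [mul_assoc]
    refine mul_le_mul' le_rfl ?_
    have hi' : i ≤ m := by have := Finset.mem_range.1 hi; omega
    calc _ ≤ (C' i * pow2 (k * (i + τ))) * (C (m - i) * (pow2 (k * ((m - i : ℕ) - σ)) * b k)) := by
          gcongr
          · exact hle i k
          · exact hm _ k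
      _ = C' i * C (m - i) * ((pow2 (k * (i + τ)) * pow2 (k * ((m - i : ℕ) - σ))) * b k) := by ring
      _ = _ := by
        rw [← pow2_add, Nat.cast_sub hi']
        congr 3; ring

/-- The pieces of the paraproduct-type decomposition of `u ∂ₑv`. -/
noncomputable def productPiece (η : 𝓢(E, ℂ)) (L : ℕ) (e : E) (u v : E → ℂ) (j : ℕ) (x : E) : ℂ :=
  moll η L j u x * fderiv ℝ (band η L j v) x e +
    fderiv ℝ (mollPrev η L j v) x e * band η L j u x

/-- Summation by parts: each piece equals `S_j u ∂S_j v - S_{j-1}u ∂S_{j-1}v`. -/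
theorem sum_productPiece (hv : IsDominated v) (e : E) (J : ℕ) (x : E) :
    ∑ j ∈ Finset.range J, productPiece η L e u v j x =
      mollPrev η L J u x * fderiv ℝ (mollPrev η L J v) x e := by
  induction J with
  | zero => simp [mollPrev]
  | succ J ih =>
    have h1 : fderiv ℝ (band η L J v) x =
        fderiv ℝ (moll η L J v) x - fderiv ℝ (mollPrev η L J v) x :=
      fderiv_fun_sub ((hv.isBddSmooth_moll L J).differentiable x)
        ((hv.isBddSmooth_mollPrev L J).differentiable x)
    rw [Finset.sum_range_succ, ih, productPiece, h1]
    simp only [band, mollPrev, sub_apply]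
    ring

namespace IsMollifier

variable (h : IsMollifier 𝒜 D η)
include h

/-- In the first term the bounded factor `S_j u` costs only the derivatives that fall on it (`τ =
0`), and `∂Δ_j v` already has smoothness `s - 1`. In the second, `∂S_{j-1}v` costs one more power of
`2^j` (`τ = 1`), which lowers the smoothness `s` of `Δ_j u` by one. -/
theorem isDecomposition_productPiece (hp : 1 ≤ p) (hq : 1 ≤ q) (hs : 0 < s) (hsL : s < L)
    (hu : IsDominated u) (hv : IsDominated v) (hub : supNorm 𝒜 ⊤ u ≠ ⊤) (hvb : supNorm 𝒜 ⊤ v ≠ ⊤)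
    {G : ℕ → E → ℂ} (hF : IsDecomposition 𝒜 p q s F) (happu : Approximates 𝒜 p F u)
    (hG : IsDecomposition 𝒜 p q s G) (happv : Approximates 𝒜 p G v) (e : E) :
    IsDecomposition 𝒜 p q (s - 1) (productPiece η L e u v) := by
  have hU := h.isDecomposition_band hp hq hs hsL hu hF happu
  have hV := (h.isDecomposition_band hp hq hs hsL hv hG happv).fderiv_apply e
  have h1 := hV.mul_of_growth hp (τ := 0) (H := fun j => moll η L j u)
    (fun j => hu.isBddSmooth_moll L j) fun i => by
      obtain ⟨C, hC, hle⟩ := h.derivNorm_moll_le (p := ⊤) le_top L i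
      refine ⟨C * supNorm 𝒜 ⊤ u, ENNReal.mul_ne_top hC hub, fun k => ?_⟩
      refine (hle k u hu).trans (le_of_eq ?_)
      rw [add_zero]; ring
  have h2 := hU.mul_of_growth hp (τ := 1) (H := fun j x => fderiv ℝ (mollPrev η L j v) x e)
    (fun j => (hv.isBddSmooth_mollPrev L j).fderiv_apply e) fun i => by
      obtain ⟨C, hC, hle⟩ := h.derivNorm_mollPrev_le (p := ⊤) le_top L (i + 1)
      refine ⟨‖ContinuousLinearMap.apply ℝ ℂ e‖ₑ * (C * supNorm 𝒜 ⊤ v),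
        ENNReal.mul_ne_top (by simp) (ENNReal.mul_ne_top hC hvb), fun k => ?_⟩
      refine (derivNorm_fderiv_apply_le (hv.isBddSmooth_mollPrev L k) e i).trans ?_
      rw [mul_assoc]
      gcongr
      refine (hle k v hv).trans (le_of_eq ?_)
      push_cast; ring
  rw [sub_zero] at h1
  exact h1.add hp hq h2

/-- Convergence of both factors in `Lᵖ` does not by itself give convergence of the product in `Lᵖ`.
The product is therefore identified almost everywhere along a subsequence, and Fatou's lemma bounds
the remainder by the tail of `∑ ‖P_j‖`, which converges because `s - 1 > 0`. -/
theorem approximates_productPiece (hp : 1 ≤ p) (hq : 1 ≤ q) (hs : 1 < s) (hsL : s < L)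
    (hu : IsDominated u) (hv : IsDominated v) (hub : supNorm 𝒜 ⊤ u ≠ ⊤) (hvb : supNorm 𝒜 ⊤ v ≠ ⊤)
    {G : ℕ → E → ℂ} (hF : IsDecomposition 𝒜 p q s F) (happu : Approximates 𝒜 p F u)
    (hG : IsDecomposition 𝒜 p q s G) (happv : Approximates 𝒜 p G v) (e : E)
    (hw : AEStronglyMeasurable w) (happw : Approximates 𝒜 p (fun k x => fderiv ℝ (G k) x e) w) :
    Approximates 𝒜 p (productPiece η L e u v) fun x => u x * w x := by
  have hp0 : p ≠ 0 := (zero_lt_one.trans_le hp).ne'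
  have hL : 0 < L := by
    rcases Nat.eq_zero_or_pos L with rfl | h0
    · norm_num at hsL; linarith
    · exact h0
  have hP := h.isDecomposition_productPiece hp hq (by linarith) hsL hu hv hub hvb hF happu hG
    happv e
  have hU := h.approximates_band_self (L := L) hp hq hL (by linarith) hu hF happu
  have hV := h.approximates_fderiv_band (L := L) hp hq hL hs hv hG happv e hw happw
  set P := productPiece η L e u v
  have hmU : ∀ J, Continuous (mollPrev η L J u) := fun J =>
    (hu.isBddSmooth_mollPrev L J).1.continuous
  have hmV : ∀ J, Continuous fun x => fderiv ℝ (mollPrev η L J v) x e := fun J =>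
    ((hv.isBddSmooth_mollPrev L J).fderiv_apply e).1.continuous
  have hsumV : ∀ J x, ∑ j ∈ Finset.range J, fderiv ℝ (band η L j v) x e =
      fderiv ℝ (mollPrev η L J v) x e := fun J x => by
    rw [← congrFun (fderiv_sum_apply (fun j => hv.isBddSmooth_band L j) e J) x]
    congr 2; ext y; exact sum_band L J v y
  have htail : ∀ J, supNorm 𝒜 p (fun x => u x * w x - ∑ j ∈ Finset.range J, P j x) ≤
      ∑' j, derivNorm 𝒜 p 0 (P (j + J)) := by
    intro J
    refine supNorm_le fun A hA => ?_
    set μ := (volume : Measure E).restrict A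
    have hUA : Tendsto (fun J => eLpNorm (mollPrev η L J u - u) p μ) atTop (𝓝 0) := by
      refine tendsto_of_tendsto_of_tendsto_of_le_of_le tendsto_const_nhds hU (fun _ => bot_le)
        fun J => ?_
      simp only [sum_band]
      rw [eLpNorm_sub_comm]
      exact eLpNorm_le_supNorm hA _
    have hVA : Tendsto (fun J => eLpNorm ((fun x => fderiv ℝ (mollPrev η L J v) x e) - w) p μ)
        atTop (𝓝 0) := by
      refine tendsto_of_tendsto_of_tendsto_of_le_of_le tendsto_const_nhds hV (fun _ => bot_le)
        fun J => ?_
      simp only [hsumV]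
      rw [eLpNorm_sub_comm]
      exact eLpNorm_le_supNorm hA _
    -- Nested extraction: `n₁` makes the first factor converge almost everywhere, and `n₂` is
    -- extracted along `n₁` for the second.
    obtain ⟨n₁, hn₁, h₁⟩ := (tendstoInMeasure_of_tendsto_eLpNorm hp0
      (fun J => (hmU J).aestronglyMeasurable) hu.1.aestronglyMeasurable hUA).exists_seq_tendsto_ae
    obtain ⟨n₂, hn₂, h₂⟩ := (tendstoInMeasure_of_tendsto_eLpNorm hp0
      (fun J => (hmV (n₁ J)).aestronglyMeasurable) hw.restrict
      (hVA.comp hn₁.tendsto_atTop)).exists_seq_tendsto_ae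
    have hlim : ∀ᵐ x ∂μ, Tendsto (fun i => (∑ j ∈ Finset.range (n₁ (n₂ i)), P j x) -
        ∑ j ∈ Finset.range J, P j x) atTop
        (𝓝 (u x * w x - ∑ j ∈ Finset.range J, P j x)) := by
      filter_upwards [h₁, h₂] with x hx₁ hx₂
      refine Tendsto.sub_const ?_ _
      simp only [P, sum_productPiece hv]
      exact (hx₁.comp hn₂.tendsto_atTop).mul hx₂
    refine (Lp.eLpNorm_lim_le_liminf_eLpNorm (fun i => ?_) _ hlim).trans ?_
    · exact ((continuous_finsetSum _ fun j _ => (hP.smooth j).1.continuous).sub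
        (continuous_finsetSum _ fun j _ => (hP.smooth j).1.continuous)).aestronglyMeasurable
    refine liminf_le_of_frequently_le' (Eventually.frequently ?_)
    have hev : ∀ᶠ i in atTop, J ≤ n₁ (n₂ i) :=
      (hn₁.tendsto_atTop.comp hn₂.tendsto_atTop).eventually_ge_atTop J
    filter_upwards [hev] with i hi
    obtain ⟨r, hr⟩ := Nat.exists_eq_add_of_le hi
    have e1 : (fun x => (∑ j ∈ Finset.range (n₁ (n₂ i)), P j x) - ∑ j ∈ Finset.range J, P j x) =
        fun x => ∑ j ∈ Finset.range r, P (j + J) x := by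
      ext x
      rw [hr, Finset.sum_range_add]
      simp [add_comm]
    rw [e1]
    refine (eLpNorm_le_supNorm hA _).trans ?_
    rw [← derivNorm_zero]
    exact (derivNorm_sum_le hp _ (fun j _ => hP.smooth _) 0).trans (ENNReal.sum_le_tsum _)
  refine tendsto_of_tendsto_of_tendsto_of_le_of_le tendsto_const_nhds
    (ENNReal.tendsto_sum_nat_add (fun j => derivNorm 𝒜 p 0 (P j)) ?_) (fun _ => bot_le) htail
  exact hP.tsum_derivNorm_ne_top hq (by push_cast; linarith)

end IsMollifier

/-! ### Periodicity -/

theorem conv_periodic {κ : 𝓢(E, ℂ)} {c : E} (hf : ∀ x, f (x + c) = f x) (x : E) :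
    conv κ f (x + c) = conv κ f x := by
  simp only [conv, add_sub_right_comm, hf]

theorem resid_periodic {c : E} (hf : ∀ x, f (x + c) = f x) (j i : ℕ) (x : E) :
    resid η j i f (x + c) = resid η j i f x := by
  induction i generalizing x with
  | zero => exact hf x
  | succ i ih => simp only [resid, ih, conv_periodic ih]

theorem moll_periodic {c : E} (hf : ∀ x, f (x + c) = f x) (j : ℕ) (x : E) :
    moll η L j f (x + c) = moll η L j f x := by
  simp only [moll_eq, resid_periodic hf, hf]

theorem mollPrev_periodic {c : E} (hf : ∀ x, f (x + c) = f x) (j : ℕ) (x : E) :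
    mollPrev η L j f (x + c) = mollPrev η L j f x := by
  cases j with
  | zero => rfl
  | succ j => exact moll_periodic hf j x

theorem fderiv_periodic {c : E} (hf : ∀ x, f (x + c) = f x) (x : E) :
    fderiv ℝ f (x + c) = fderiv ℝ f x := by
  rw [← fderiv_comp_add_right]; simp only [hf]

theorem productPiece_periodic {c : E} (hu : ∀ x, u (x + c) = u x) (hv : ∀ x, v (x + c) = v x)
    (e : E) (j : ℕ) (x : E) :
    productPiece η L e u v j (x + c) = productPiece η L e u v j x := by
  have hb : ∀ {f : E → ℂ}, (∀ x, f (x + c) = f x) → ∀ x, band η L j f (x + c) = band η L j f x :=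
    fun hf x => by simp only [band, moll_periodic hf, mollPrev_periodic hf]
  simp only [productPiece, moll_periodic hu, hb hu, fderiv_periodic (hb hv),
    fderiv_periodic (mollPrev_periodic hv j)]

end Bands

/-! ### Commutation and locality of the mollifiers, and extension from `A` to the whole space. -/

section Extension

variable {E : Type} [NormedAddCommGroup E] [InnerProductSpace ℝ E] [FiniteDimensional ℝ E]
  [MeasurableSpace E] [BorelSpace E]
  {A D : Set E} {p q : ℝ≥0∞} {σ s : ℝ} {η : 𝓢(E, ℂ)} {F : ℕ → E → ℂ}
  {f g u v w : E → ℂ} {L : ℕ}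

/-! ### Composition of convolutions -/

theorem IsDominated.integrable_conv_conv (hf : IsDominated f) (κ κ' : 𝓢(E, ℂ)) (x : E) :
    Integrable (Function.uncurry fun y z : E => κ y * (κ' (z - y) * f (x - z)))
      (volume.prod volume) := by
  obtain ⟨hfm, g, C, hg, hC, hle⟩ := hf
  obtain ⟨M, hM0, hM⟩ := exists_bound κ'
  have h1 : Integrable (fun z : E × E => ‖κ z.1‖ * ‖g (x - z.2)‖) (volume.prod volume) :=
    κ.integrable.norm.mul_prod (hg.comp_sub_left x).norm
  have h2 : Integrable (fun z : E × E => ‖κ z.1‖ * ‖κ' (z.2 - z.1)‖) (volume.prod volume) := by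
    have := (κ.integrable.norm.convolution_integrand (.mul ℝ ℝ) κ'.integrable.norm
      (μ := volume) (ν := volume)).swap
    exact this
  refine ((h1.const_mul M).add (h2.const_mul C)).mono' ?_ (ae_of_all _ fun z => ?_)
  · refine ((κ.continuous.comp continuous_fst).aestronglyMeasurable).mul
      (((κ'.continuous.comp (continuous_snd.sub continuous_fst)).aestronglyMeasurable).mul ?_)
    exact (hfm.comp_measurable (measurable_const.sub measurable_snd)).aestronglyMeasurable
  · simp only [Function.uncurry, Pi.add_apply, norm_mul]
    have a1 := hle (x - z.2)
    have a2 := hM (z.2 - z.1)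
    have a3 := norm_nonneg (κ z.1)
    have a4 := norm_nonneg (κ' (z.2 - z.1))
    calc ‖κ z.1‖ * (‖κ' (z.2 - z.1)‖ * ‖f (x - z.2)‖)
        ≤ ‖κ z.1‖ * (‖κ' (z.2 - z.1)‖ * (|g (x - z.2)| + C)) := by gcongr
      _ = ‖κ z.1‖ * (‖κ' (z.2 - z.1)‖ * |g (x - z.2)|) +
          C * (‖κ z.1‖ * ‖κ' (z.2 - z.1)‖) := by ring
      _ ≤ ‖κ z.1‖ * (M * |g (x - z.2)|) + C * (‖κ z.1‖ * ‖κ' (z.2 - z.1)‖) := by gcongr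
      _ = _ := by rw [Real.norm_eq_abs]; ring

/-- Fubini's theorem. The composite kernel may be any Schwartz function equal to the convolution, so
that it can also be recognised from its Fourier transform. -/
theorem conv_conv (hf : IsDominated f) {κ κ' κ'' : 𝓢(E, ℂ)} (h : ∀ z, κ'' z = conv κ κ' z) :
    conv κ (conv κ' f) = conv κ'' f := by
  ext x
  have h1 : ∀ z, κ'' z • f (x - z) = ∫ y, κ y * (κ' (z - y) * f (x - z)) := fun z => by
    rw [h, conv, smul_eq_mul, ← integral_mul_const]
    simp only [smul_eq_mul, mul_assoc]
  have h2 : ∀ y, κ y • conv κ' f (x - y) = ∫ z, κ y * (κ' (z - y) * f (x - z)) := fun y => by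
    rw [integral_const_mul, smul_eq_mul, conv, ← integral_sub_right_eq_self _ y]
    simp only [smul_eq_mul, sub_sub_sub_cancel_right]
  rw [conv, conv]
  simp only [h1, h2]
  exact integral_integral_swap (hf.integrable_conv_conv κ κ' x)

/-- The convolution of two Schwartz functions. -/
noncomputable def schwartzConv (κ κ' : 𝓢(E, ℂ)) : 𝓢(E, ℂ) :=
  SchwartzMap.convolution (ContinuousLinearMap.lsmul ℂ ℂ) κ κ'

theorem schwartzConv_apply (κ κ' : 𝓢(E, ℂ)) (z : E) : schwartzConv κ κ' z = conv κ κ' z :=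
  SchwartzMap.convolution_apply _ κ κ' z

theorem conv_comm (hf : IsDominated f) (κ κ' : 𝓢(E, ℂ)) :
    conv κ (conv κ' f) = conv κ' (conv κ f) := by
  rw [conv_conv hf (schwartzConv_apply κ κ'), conv_conv hf (κ'' := schwartzConv κ κ')]
  intro z
  rw [schwartzConv_apply, conv_eq_kconv]; rfl

theorem conv_resid (hf : IsDominated f) (κ : 𝓢(E, ℂ)) (j i : ℕ) :
    conv κ (resid η j i f) = resid η j i (conv κ f) := by
  induction i with
  | zero => rfl
  | succ i ih =>
    have h1 := hf.resid (η := η) j i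
    simp only [resid]
    rw [conv_sub h1 (h1.conv _), conv_comm h1, ih]

theorem resid_comm (hf : IsDominated f) (j i j' i' : ℕ) :
    resid η j i (resid η j' i' f) = resid η j' i' (resid η j i f) := by
  induction i with
  | zero => rfl
  | succ i ih =>
    have h1 := hf.resid (η := η) j i
    simp only [resid]
    rw [ih, conv_resid h1, ← resid_sub h1 (h1.conv _)]

theorem IsDominated.moll (hf : IsDominated f) (L j : ℕ) : IsDominated (moll η L j f) :=
  (hf.isBddSmooth_moll L j).isDominated

theorem IsDominated.mollPrev (hf : IsDominated f) (L j : ℕ) : IsDominated (mollPrev η L j f) :=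
  (hf.isBddSmooth_mollPrev L j).isDominated

theorem moll_moll (hf : IsDominated f) (j j' : ℕ) (x : E) :
    moll η L j (moll η L j' f) x =
      f x - resid η j' L f x - resid η j L f x + resid η j L (resid η j' L f) x := by
  have h1 : moll η L j' f = fun x => f x - resid η j' L f x := funext fun x => moll_eq L j' f x
  rw [moll_eq, h1, resid_sub hf (hf.resid j' L)]
  ring

theorem moll_comm (hf : IsDominated f) (j j' : ℕ) (x : E) :
    moll η L j (moll η L j' f) x = moll η L j' (moll η L j f) x := by
  rw [moll_moll hf, moll_moll hf, resid_comm hf]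
  ring

/-! ### Locality -/

theorem Admissible.sub_mem (h : Admissible {A} D) {x y : E} (hx : x ∈ A) (hy : y ∈ D) :
    x - y ∈ A := by
  obtain ⟨A', rfl, hA⟩ := h.shift y hy A rfl
  exact hA x hx

namespace IsMollifier

variable (h : IsMollifier {A} D η)
include h

/-- At a point `x ∈ A` the convolution uses only the values at `x - y` with `y ∈ D`, and these
points lie in `A`. This one-sidedness is what allows mollification of functions known only on `A`.
-/
theorem conv_eqOn (hfg : EqOn f g A) (j : ℕ) :
    EqOn (conv (dilate j η) f) (conv (dilate j η) g) A := by
  intro x hx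
  refine integral_congr_ae (ae_of_all _ fun y => ?_)
  by_cases hy : dilate j η y = 0
  · simp [hy]
  · simp only [hfg (h.adm.sub_mem hx (h.adm.dilate_mem h.supp j y hy))]

theorem resid_eqOn (hfg : EqOn f g A) (j i : ℕ) : EqOn (resid η j i f) (resid η j i g) A := by
  induction i with
  | zero => exact hfg
  | succ i ih =>
    intro x hx
    simp only [resid, ih hx, h.conv_eqOn ih j hx]

theorem moll_eqOn (hfg : EqOn f g A) (j : ℕ) : EqOn (moll η L j f) (moll η L j g) A := by
  intro x hx
  rw [moll_eq, moll_eq, hfg hx, h.resid_eqOn hfg j L hx]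

theorem mollPrev_eqOn (hfg : EqOn f g A) (j : ℕ) :
    EqOn (mollPrev η L j f) (mollPrev η L j g) A := by
  cases j with
  | zero => exact fun _ _ => rfl
  | succ j => exact h.moll_eqOn hfg j

end IsMollifier

/-! ### Limits of decompositions on the whole space -/

theorem supNorm_singleton {G : Type} [NormedAddCommGroup G] (f : E → G) :
    supNorm {A} p f = eLpNorm f p (volume.restrict A) := by simp [supNorm]

theorem supNorm_univ {G : Type} [NormedAddCommGroup G] (f : E → G) :
    supNorm {(univ : Set E)} p f = eLpNorm f p volume := by
  rw [supNorm_singleton, Measure.restrict_univ]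

theorem IsDecomposition.memLp (hq : 1 ≤ q) (hF : IsDecomposition {(univ : Set E)} p q σ F) (k : ℕ) :
    MemLp (F k) p volume := by
  refine ⟨(hF.smooth k).1.continuous.aestronglyMeasurable, ?_⟩
  have := hF.derivNorm_ne_top hq 0 k
  rwa [derivNorm_zero, supNorm_univ, ← lt_top_iff_ne_top] at this

theorem tendsto_sum_toLp_iff {α : Type*} [MeasurableSpace α] {μ : Measure α} [Fact (1 ≤ p)]
    {F : ℕ → α → ℂ} {f : α → ℂ} (hF : ∀ k, MemLp (F k) p μ) (hf : MemLp f p μ) :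
    Tendsto (fun K => ∑ k ∈ Finset.range K, (hF k).toLp (F k)) atTop (𝓝 (hf.toLp f)) ↔
      Tendsto (fun K => eLpNorm (fun x => f x - ∑ k ∈ Finset.range K, F k x) p μ) atTop (𝓝 0) := by
  rw [tendsto_iff_edist_tendsto_0]
  refine iff_of_eq (congrArg (fun a => Tendsto a atTop (𝓝 0)) (funext fun K => ?_))
  rw [edist_comm, Lp.edist_def]
  refine eLpNorm_congr_ae ?_
  have h2 : ∀ᵐ x ∂μ, ∀ k, (hF k).toLp (F k) x = F k x := ae_all_iff.2 fun k => (hF k).coeFn_toLp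
  filter_upwards [h2, Lp.coeFn_finsetSum (Finset.range K) fun k => (hF k).toLp (F k),
    hf.coeFn_toLp] with x h2 h3 h4
  rw [Pi.sub_apply, h3, h4, Finset.sum_apply]
  simp only [h2]

theorem approximates_univ_iff [Fact (1 ≤ p)] (hF : ∀ k, MemLp (F k) p volume)
    (hf : MemLp f p volume) : Approximates {univ} p F f ↔
      Tendsto (fun K => ∑ k ∈ Finset.range K, (hF k).toLp (F k)) atTop (𝓝 (hf.toLp f)) := by
  simp only [tendsto_sum_toLp_iff, Approximates, supNorm_univ]

/-- Absolutely convergent series in `Lᵖ` converge. -/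
theorem exists_limit_of_tsum_eLpNorm_ne_top {α : Type*} [MeasurableSpace α] {μ : Measure α}
    (hp : 1 ≤ p) {F : ℕ → α → ℂ} (hF : ∀ k, MemLp (F k) p μ)
    (hsum : ∑' k, eLpNorm (F k) p μ ≠ ⊤) :
    ∃ f : α → ℂ, StronglyMeasurable f ∧ MemLp f p μ ∧
      Tendsto (fun K => eLpNorm (fun x => f x - ∑ k ∈ Finset.range K, F k x) p μ) atTop (𝓝 0) := by
  have : Fact (1 ≤ p) := ⟨hp⟩
  have hs : Summable fun k => ‖(hF k).toLp (F k)‖ := by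
    simp only [Lp.norm_toLp]
    exact ENNReal.summable_toReal hsum
  have ht := hs.of_norm.hasSum.tendsto_sum_nat
  set T := ∑' k, (hF k).toLp (F k)
  refine ⟨T, Lp.stronglyMeasurable T, Lp.memLp T, (tendsto_sum_toLp_iff hF (Lp.memLp T)).1 ?_⟩
  rwa [Lp.toLp_coeFn]

theorem IsDecomposition.exists_limit (hp : 1 ≤ p) (hq : 1 ≤ q) (hσ : 0 < σ)
    (hF : IsDecomposition {(univ : Set E)} p q σ F) :
    ∃ f : E → ℂ, StronglyMeasurable f ∧ MemLp f p volume ∧ Approximates {univ} p F f := by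
  have h := hF.tsum_derivNorm_ne_top (m := 0) hq (by simpa using hσ)
  simp only [derivNorm_zero, supNorm_univ] at h
  simpa only [Approximates, supNorm_univ] using
    exists_limit_of_tsum_eLpNorm_ne_top hp (hF.memLp hq) h

theorem Approximates.add (hp : 1 ≤ p) {𝒜 : Set (Set E)} {G : ℕ → E → ℂ}
    (hFs : ∀ k, IsBddSmooth (F k)) (hGs : ∀ k, IsBddSmooth (G k)) (hf : AEStronglyMeasurable f)
    (hg : AEStronglyMeasurable g) (hF : Approximates 𝒜 p F f) (hG : Approximates 𝒜 p G g) :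
    Approximates 𝒜 p (fun k x => F k x + G k x) fun x => f x + g x := by
  have := Tendsto.add hF hG
  rw [add_zero] at this
  refine tendsto_of_tendsto_of_tendsto_of_le_of_le tendsto_const_nhds this (fun _ => bot_le)
    fun K => ?_
  refine le_trans (le_of_eq ?_) (supNorm_add_le hp
    (hf.sub (IsBddSmooth.sum _ fun k _ => hFs k).1.continuous.aestronglyMeasurable)
    (hg.sub (IsBddSmooth.sum _ fun k _ => hGs k).1.continuous.aestronglyMeasurable))
  congr 1; ext x
  simp only [Finset.sum_add_distrib]
  ring

theorem Approximates.mul_left {𝒜 : Set (Set E)} {χ : E → ℂ} (hχ : IsBddSmooth χ)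
    (hFs : ∀ k, IsBddSmooth (F k)) (hf : AEStronglyMeasurable f) (hF : Approximates 𝒜 p F f) :
    Approximates 𝒜 p (fun k x => χ x * F k x) fun x => χ x * f x := by
  have := ENNReal.Tendsto.const_mul (a := supNorm 𝒜 ⊤ χ) hF (Or.inr (by
    have := hχ.derivNorm_top_ne_top (𝒜 := 𝒜) 0
    rwa [derivNorm_zero] at this))
  rw [mul_zero] at this
  refine tendsto_of_tendsto_of_tendsto_of_le_of_le tendsto_const_nhds this (fun _ => bot_le)
    fun K => ?_
  refine le_trans (le_of_eq ?_) (supNorm_mul_le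
    (hf.sub (IsBddSmooth.sum _ fun k _ => hFs k).1.continuous.aestronglyMeasurable))
  congr 1; ext x
  simp only [mul_sub, Finset.mul_sum]

/-! ### Extension operator -/

/-- The pieces of the extension to the whole space of a function given on `A`. -/
noncomputable def extendPiece (η : 𝓢(E, ℂ)) (L : ℕ) (A : Set E) (f : E → ℂ) (j : ℕ) (x : E) : ℂ :=
  moll η L j (A.indicator (band η L j f)) x + mollPrev η L j (A.indicator (band η L j f)) x

namespace IsMollifier

variable (h : IsMollifier {A} D η) (h' : IsMollifier {univ} D η)
include h

/-- By locality the indicator of `A` is invisible on `A`. Since the mollifications commute, a piece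
is there `(S_j + S_{j-1})(S_j - S_{j-1}) f = S_j² f - S_{j-1}² f`. -/
theorem sum_extendPiece (hf : IsDominated f) (J : ℕ) {x : E} (hx : x ∈ A) :
    ∑ j ∈ Finset.range J, extendPiece η L A f j x = mollPrev η L J (mollPrev η L J f) x := by
  induction J with
  | zero => rfl
  | succ J ih =>
    have hE : EqOn (A.indicator (band η L J f)) (band η L J f) A := eqOn_indicator
    rw [Finset.sum_range_succ, ih, extendPiece, h.moll_eqOn hE J hx, h.mollPrev_eqOn hE J hx]
    have h1 : band η L J f = fun x => moll η L J f x - mollPrev η L J f x := rfl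
    rw [h1, moll_sub (hf.moll L J) (hf.mollPrev L J), mollPrev_sub (hf.moll L J) (hf.mollPrev L J)]
    have h2 : moll η L J (mollPrev η L J f) x = mollPrev η L J (moll η L J f) x := by
      cases J with
      | zero =>
        have h3 := congrFun (moll_sub (η := η) hf hf L 0) x
        simpa [mollPrev] using h3
      | succ J => exact moll_comm hf _ _ _
    rw [show mollPrev η L (J + 1) (mollPrev η L (J + 1) f) x = moll η L J (moll η L J f) x from rfl]
    linear_combination -h2

include h'

/-- Truncation to `A` destroys the smoothness of the band but not its `Lᵖ` bound `2^{-jσ} b_j`, now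
valid on the whole space. Mollifying once more at scale `2^{-j}` restores smoothness, and its
derivatives cost exactly `2^{jm}`. -/
theorem isDecomposition_extendPiece (hp : 1 ≤ p) (hpt : p ≠ ⊤) (hq : 1 ≤ q) (hσ : 0 < σ)
    (hσL : σ < L) (hf : IsDominated f) (hF : IsDecomposition {A} p q σ F)
    (happ : Approximates {A} p F f) :
    IsDecomposition {(univ : Set E)} p q σ (extendPiece η L A f) := by
  have hA : MeasurableSet A := h.adm.meas A rfl
  have hB := h.isDecomposition_band hp hq hσ hσL hf hF happ
  obtain ⟨b, hb, hle⟩ := hB.bound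
  obtain ⟨C, hC, hle⟩ := hle 0
  have hN : ∀ j, supNorm {(univ : Set E)} p (A.indicator (band η L j f)) =
      derivNorm {A} p 0 (band η L j f) := fun j => by
    rw [supNorm_univ, eLpNorm_indicator_eq_eLpNorm_restrict hA, derivNorm_zero, supNorm_singleton]
  have hd : ∀ j, IsDominated (A.indicator (band η L j f)) := fun j => by
    have hm : StronglyMeasurable (A.indicator (band η L j f)) :=
      (hf.isBddSmooth_band L j).1.continuous.stronglyMeasurable.indicator hA
    refine .of_memLp hm hp hpt ⟨hm.aestronglyMeasurable, ?_⟩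
    rw [← supNorm_univ, hN]
    exact (hB.derivNorm_ne_top hq 0 j).lt_top
  have hs₁ := fun j => (hd j).isBddSmooth_moll (η := η) L j
  have hs₂ := fun j => (hd j).isBddSmooth_mollPrev (η := η) L j
  refine ⟨fun j => (hs₁ j).add (hs₂ j), b, hb, fun m => ?_⟩
  obtain ⟨C₁, hC₁, h₁⟩ := h'.derivNorm_moll_le hp L m
  obtain ⟨C₂, hC₂, h₂⟩ := h'.derivNorm_mollPrev_le hp L m
  refine ⟨(C₁ + C₂) * C, ENNReal.mul_ne_top (ENNReal.add_ne_top.2 ⟨hC₁, hC₂⟩) hC, fun j => ?_⟩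
  refine (derivNorm_add_le hp (hs₁ j) (hs₂ j) m).trans ?_
  calc _ ≤ C₁ * pow2 (j * m) * (C * (pow2 (j * ((0 : ℕ) - σ)) * b j)) +
        C₂ * pow2 (j * m) * (C * (pow2 (j * ((0 : ℕ) - σ)) * b j)) := by
        gcongr
        · exact (h₁ j _ (hd j)).trans (by rw [hN]; gcongr; exact hle j)
        · exact (h₂ j _ (hd j)).trans (by rw [hN]; gcongr; exact hle j)
    _ = (C₁ + C₂) * C * ((pow2 (j * m) * pow2 (j * ((0 : ℕ) - σ))) * b j) := by ring
    _ = _ := by rw [← pow2_add]; congr 3; push_cast; ring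

/-- A function on `A` admitting a decomposition extends to the whole space. -/
theorem exists_extension (hp : 1 ≤ p) (hpt : p ≠ ⊤) (hq : 1 ≤ q) (hσ : 0 < σ)
    (hf : IsDominated f) (hF : IsDecomposition {A} p q σ F) (happ : Approximates {A} p F f) :
    ∃ (G : ℕ → E → ℂ) (g : E → ℂ), IsDecomposition {univ} p q σ G ∧ StronglyMeasurable g ∧
      MemLp g p volume ∧ Approximates {univ} p G g ∧ g =ᵐ[volume.restrict A] f := by
  obtain ⟨L, hL⟩ := exists_nat_gt σ
  have hL0 : 0 < L := by exact_mod_cast hσ.trans hL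
  have hG := h.isDecomposition_extendPiece h' hp hpt hq hσ hL hf hF happ
  obtain ⟨g, hgm, hgp, hg⟩ := hG.exists_limit hp hq hσ
  refine ⟨_, g, hG, hgm, hgp, hg, ?_⟩
  obtain ⟨C, hC, hle⟩ := h.derivNorm_moll_le hp L 0
  have happ' := (h.approximates_band_self (L := L) hp hq hL0 hσ hf hF happ)
  -- On `A` the error is `f - S_J² f = (f - S_J f) + S_J (f - S_J f)`, and `S_J` is bounded
  -- uniformly in `J`.
  have hlim : Tendsto (fun J => supNorm {A} p (fun x =>
      f x - ∑ j ∈ Finset.range (J + 1), extendPiece η L A f j x)) atTop (𝓝 0) := by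
    have h1 : Tendsto (fun J => supNorm {A} p (fun x => f x - moll η L J f x)) atTop (𝓝 0) := by
      refine (happ'.comp (tendsto_add_atTop_nat 1)).congr fun J => ?_
      simp only [Function.comp, sum_band]; rfl
    have h2 := h1.add (ENNReal.Tendsto.const_mul (a := C) h1 (Or.inr hC))
    rw [mul_zero, add_zero] at h2
    refine tendsto_of_tendsto_of_tendsto_of_le_of_le tendsto_const_nhds h2 (fun _ => bot_le)
      fun J => ?_
    have hd : IsDominated fun x => f x - moll η L J f x := hf.sub (hf.moll L J)
    have hA : MeasurableSet A := h.adm.meas A rfl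
    have e1 : supNorm {A} p (fun x => f x - ∑ j ∈ Finset.range (J + 1), extendPiece η L A f j x) =
        supNorm {A} p (fun x => (f x - moll η L J f x) +
          moll η L J (fun x => f x - moll η L J f x) x) := by
      rw [supNorm_singleton, supNorm_singleton]
      refine eLpNorm_congr_ae ((ae_restrict_iff' hA).2 (ae_of_all _ fun x hx => ?_))
      simp only [h.sum_extendPiece hf _ hx, moll_sub hf (hf.moll L J), mollPrev]
      ring
    rw [e1]
    refine (supNorm_add_le hp hd.1.aestronglyMeasurable
      (hd.moll L J).1.aestronglyMeasurable).trans (add_le_add le_rfl ?_)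
    rw [← derivNorm_zero]
    simpa [pow2_zero] using hle J _ hd
  have hlim' : Tendsto (fun J => supNorm {A} p (fun x =>
      g x - ∑ j ∈ Finset.range (J + 1), extendPiece η L A f j x)) atTop (𝓝 0) :=
    (hg.mono_family (𝒜 := {A}) (by simp)).comp (tendsto_add_atTop_nat 1)
  have h0 : supNorm {A} p (fun x => g x - f x) = 0 := by
    refine le_antisymm ?_ bot_le
    have h3 := hlim'.add hlim
    rw [add_zero] at h3
    refine ge_of_tendsto' h3 fun J => ?_
    have hm : AEStronglyMeasurable fun x =>
        ∑ j ∈ Finset.range (J + 1), extendPiece η L A f j x :=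
      (IsBddSmooth.sum _ fun k _ => hG.smooth k).1.continuous.aestronglyMeasurable
    refine (supNorm_sub_le_add hp hgm.aestronglyMeasurable hm hf.1.aestronglyMeasurable).trans ?_
    rw [supNorm_sub_comm (fun x => ∑ j ∈ Finset.range (J + 1), extendPiece η L A f j x)]
  rw [supNorm_singleton] at h0
  replace h0 := (eLpNorm_eq_zero_iff (hgm.sub hf.1).aestronglyMeasurable
    (zero_lt_one.trans_le hp).ne').1 h0
  filter_upwards [h0] with x hx
  exact sub_eq_zero.1 hx

end IsMollifier

end Extension

/-! ### Fourier multipliers as convolutions. -/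

section FourierKernel

open FourierTransform

variable {E : Type} [NormedAddCommGroup E] [InnerProductSpace ℝ E] [FiniteDimensional ℝ E]
  [MeasurableSpace E] [BorelSpace E]
  {p q : ℝ≥0∞} {σ s : ℝ} {F : ℕ → E → ℂ} {f g u v w : E → ℂ}

/-- The rescaled function `x ↦ κ (c x)`. -/
noncomputable def scale (c : ℝ) (hc : c ≠ 0) (κ : 𝓢(E, ℂ)) : 𝓢(E, ℂ) :=
  SchwartzMap.compCLMOfContinuousLinearEquiv ℝ (ContinuousLinearEquiv.smulLeft (Units.mk0 c hc)) κ

theorem scale_apply (c : ℝ) (hc : c ≠ 0) (κ : 𝓢(E, ℂ)) (x : E) : scale c hc κ x = κ (c • x) := rfl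

theorem norm_iteratedFDeriv_scale (m : ℕ) {c : ℝ} (hc : 0 < c) (κ : 𝓢(E, ℂ)) (x : E) :
    ‖iteratedFDeriv ℝ m (scale c hc.ne' κ) x‖ = c ^ m * ‖iteratedFDeriv ℝ m κ (c • x)‖ := by
  have h1 : (scale c hc.ne' κ : E → ℂ) = fun x => κ (c • x) := rfl
  rw [h1, iteratedFDeriv_comp_const_smul (𝕜 := ℝ) c (κ.smooth m), norm_smul, norm_pow,
    Real.norm_of_nonneg hc.le]

theorem fourier_dilate (j : ℕ) (κ : 𝓢(E, ℂ)) (ξ : E) :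
    𝓕 (dilate j κ) ξ = 𝓕 κ (((2 : ℝ) ^ j)⁻¹ • ξ) := by
  have hc : (0 : ℝ) < 2 ^ j := by positivity
  rw [SchwartzMap.fourier_coe, SchwartzMap.fourier_coe, Real.fourier_eq, Real.fourier_eq]
  have h1 := Measure.integral_comp_smul (volume : Measure E)
    (fun x => Real.fourierChar (-inner ℝ x (((2 : ℝ) ^ j)⁻¹ • ξ)) • κ x) ((2 : ℝ) ^ j)
  have h2 : ∀ x : E, inner ℝ ((2 : ℝ) ^ j • x) (((2 : ℝ) ^ j)⁻¹ • ξ) = inner ℝ x ξ := fun x => by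
    rw [real_inner_smul_left, real_inner_smul_right, mul_inv_cancel_left₀ hc.ne']
  simp only [h2] at h1
  simp only [dilate_apply, smul_comm _ (((2 : ℝ) ^ j) ^ Module.finrank ℝ E)]
  rw [integral_smul, h1, smul_smul, abs_of_pos (by positivity), mul_inv_cancel₀ (by positivity),
    one_smul]

theorem fourier_schwartzConv (κ κ' : 𝓢(E, ℂ)) (ξ : E) :
    𝓕 (schwartzConv κ κ') ξ = 𝓕 κ ξ * 𝓕 κ' ξ := by
  rw [schwartzConv, SchwartzMap.fourier_convolution]; rfl

theorem eq_conv_of_fourier {κ κ' κ'' : 𝓢(E, ℂ)} (h : ∀ ξ, 𝓕 κ'' ξ = 𝓕 κ ξ * 𝓕 κ' ξ) (z : E) :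
    κ'' z = conv κ κ' z := by
  rw [← schwartzConv_apply]
  have h1 : 𝓕 κ'' = 𝓕 (schwartzConv κ κ') := by
    ext ξ; rw [h, fourier_schwartzConv]
  have h2 := congrArg (fun ψ : 𝓢(E, ℂ) => 𝓕⁻ ψ) h1
  simp only [fourierInv_fourier_eq] at h2
  rw [h2]

/-- A Fourier multiplier with Schwartz symbol acts on `Lᵖ` functions by convolution. -/
theorem integral_fourierMultiplier_mul (hf : IsDominated f) (κ ψ : 𝓢(E, ℂ)) :
    ∫ x, 𝓕 (SchwartzMap.smulLeftCLM ℂ (fun ξ => 𝓕 κ ξ) (𝓕⁻ ψ)) x * f x =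
      ∫ x, ψ x * conv κ f x := by
  -- With `ψ'` the reflection of `ψ`, both sides are convolutions evaluated at the origin, and the
  -- claim becomes `(κ * ψ') * f = ψ' * (κ * f)`.
  set ψ' : 𝓢(E, ℂ) := scale (-1) (by norm_num) ψ
  have hψ' : ∀ x, ψ' x = ψ (-x) := fun x => by rw [scale_apply, neg_one_smul]
  have h1 : ∀ x, 𝓕 (SchwartzMap.smulLeftCLM ℂ (fun ξ => 𝓕 κ ξ) (𝓕⁻ ψ)) x =
      schwartzConv κ ψ' (-x) := by
    intro x
    have h2 : 𝓕 (schwartzConv κ ψ') = SchwartzMap.smulLeftCLM ℂ (fun ξ => 𝓕 κ ξ) (𝓕⁻ ψ) := by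
      ext ξ
      rw [fourier_schwartzConv, SchwartzMap.smulLeftCLM_apply_apply (𝓕 κ).hasTemperateGrowth,
        smul_eq_mul, SchwartzMap.fourierInv_coe, Real.fourierInv_eq_fourier_comp_neg,
        SchwartzMap.fourier_coe ψ']
      simp only [← hψ']
    have h3 : schwartzConv κ ψ' = 𝓕⁻ (𝓕 (schwartzConv κ ψ')) := by simp
    rw [h3, h2, SchwartzMap.fourierInv_coe, SchwartzMap.fourier_coe, Real.fourierInv_eq_fourier_neg,
      neg_neg]
  simp only [h1]
  have h4 : ∫ x, schwartzConv κ ψ' (-x) * f x = conv (schwartzConv κ ψ') f 0 := by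
    rw [conv, ← integral_neg_eq_self]
    simp
  have h5 : ∫ x, ψ x * conv κ f x = conv ψ' (conv κ f) 0 := by
    rw [conv, ← integral_neg_eq_self]
    simp [hψ']
  rw [h4, h5, conv_comm hf, conv_conv hf (schwartzConv_apply κ ψ')]

theorem memLp_conv (hp : 1 ≤ p) (κ : 𝓢(E, ℂ)) (hf : StronglyMeasurable f) (hfp : MemLp f p volume) :
    MemLp (conv κ f) p volume := by
  refine ⟨(stronglyMeasurable_conv κ hf).aestronglyMeasurable, ?_⟩
  have h1 : Admissible {(univ : Set E)} univ := ⟨by simp, by simp, by simp⟩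
  have := supNorm_conv_le h1 hp κ (by simp) hf
  rw [supNorm_univ, supNorm_univ] at this
  exact this.trans_lt (ENNReal.mul_lt_top (kernelNorm_lt_top _ _) hfp.2)

theorem fourierMultiplierCLM_toTemperedDistribution [Fact (1 ≤ p)] (κ : 𝓢(E, ℂ))
    (hf : IsDominated f) (hfp : MemLp f p volume) (hc : MemLp (conv κ f) p volume) :
    TemperedDistribution.fourierMultiplierCLM ℂ (fun ξ => 𝓕 κ ξ)
        (Lp.toTemperedDistribution (hfp.toLp f)) =
      Lp.toTemperedDistribution (hc.toLp (conv κ f)) := by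
  ext ψ
  rw [TemperedDistribution.fourierMultiplierCLM_apply_apply, Lp.toTemperedDistribution_apply,
    Lp.toTemperedDistribution_apply]
  have h1 := integral_fourierMultiplier_mul hf κ ψ
  calc _ = ∫ x, 𝓕 (SchwartzMap.smulLeftCLM ℂ (fun ξ => 𝓕 κ ξ) (𝓕⁻ ψ)) x * f x := by
        refine integral_congr_ae ?_
        filter_upwards [hfp.coeFn_toLp] with x hx
        rw [hx, smul_eq_mul]
    _ = _ := by
        rw [h1]
        refine integral_congr_ae ?_
        filter_upwards [hc.coeFn_toLp] with x hx
        rw [hx, smul_eq_mul]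

/-- The `L¹` norm of an inverse Fourier transform is controlled by Schwartz seminorms. -/
theorem exists_kernelNorm_fourierInv_le (B : ℕ → ℕ → ℝ) : ∃ C : ℝ≥0∞, C ≠ ⊤ ∧ ∀ ψ : 𝓢(E, ℂ),
    (∀ k m x, ‖x‖ ^ k * ‖iteratedFDeriv ℝ m ψ x‖ ≤ B k m) → kernelNorm 0 (𝓕⁻ ψ) ≤ C := by
  -- The inverse Fourier transform followed by the inclusion into `L¹` is continuous, hence
  -- dominated by finitely many seminorms; the resulting constant depends only on `B`.
  let T : 𝓢(E, ℂ) →L[ℂ] Lp ℂ 1 (volume : Measure E) :=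
    (SchwartzMap.toLpCLM ℂ ℂ 1 volume).comp (fourierInvCLM ℂ 𝓢(E, ℂ))
  let Q : Seminorm ℂ 𝓢(E, ℂ) := (normSeminorm ℂ (Lp ℂ 1 (volume : Measure E))).comp T.toLinearMap
  have hQ : Continuous Q := continuous_norm.comp T.continuous
  obtain ⟨S, C, -, hC⟩ := Seminorm.bound_of_continuous (schwartz_withSeminorms ℂ E ℂ) Q hQ
  refine ⟨ENNReal.ofReal (C * ∑ i ∈ S, |B i.1 i.2|), ENNReal.ofReal_ne_top, fun ψ hψ => ?_⟩
  have h1 : kernelNorm 0 (𝓕⁻ ψ) = ENNReal.ofReal (Q ψ) := by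
    have h2 : Q ψ = ‖(𝓕⁻ ψ).toLp 1 volume‖ := rfl
    rw [kernelNorm_zero, h2, ← eLpNorm_one_eq_lintegral_enorm, SchwartzMap.toLp, Lp.norm_toLp,
      ENNReal.ofReal_toReal ((𝓕⁻ ψ).memLp 1 volume).2.ne]
  rw [h1]
  refine ENNReal.ofReal_le_ofReal ((hC ψ).trans ?_)
  rw [smul_apply, NNReal.smul_def, smul_eq_mul]
  refine mul_le_mul_of_nonneg_left ?_ C.2
  refine Seminorm.finset_sup_apply_le (Finset.sum_nonneg fun _ _ => abs_nonneg _) fun i hi => ?_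
  refine le_trans ?_ (Finset.single_le_sum (f := fun i : ℕ × ℕ => |B i.1 i.2|)
    (fun _ _ => abs_nonneg _) hi)
  exact SchwartzMap.seminorm_le_bound ℂ _ _ _ (abs_nonneg _) fun x =>
    (hψ _ _ x).trans (le_abs_self _)

/-- A smooth radial cutoff, as a Schwartz function. -/
theorem exists_schwartz_cutoff {r : ℝ} (hr : 0 < r) : ∃ χ : 𝓢(E, ℂ),
    (∀ x, ‖x‖ ≤ r → χ x = 1) ∧ ∀ x, 2 * r ≤ ‖x‖ → χ x = 0 := by
  let b : ContDiffBump (0 : E) := ⟨r, 2 * r, hr, by linarith⟩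
  refine ⟨HasCompactSupport.toSchwartzMap (f := fun x => ((b x : ℝ) : ℂ))
    (b.hasCompactSupport.comp_left (g := fun t : ℝ => (t : ℂ)) Complex.ofReal_zero)
    (Complex.ofRealCLM.contDiff.comp b.contDiff), fun x hx => ?_, fun x hx => ?_⟩
  · change ((b x : ℝ) : ℂ) = 1
    rw [b.one_of_mem_closedBall (by simpa [b] using hx), Complex.ofReal_one]
  · change ((b x : ℝ) : ℂ) = 0
    rw [b.zero_of_le_dist (by simpa [b] using hx), Complex.ofReal_zero]

end FourierKernel

/-! ### Littlewood–Paley kernels: decompositions give Besov membership. -/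

section LittlewoodPaley

open FourierTransform

variable {n : ℕ} (Φ : DyadicPartition n)

theorem DyadicPartition.tsupport_subset (l : ℕ) :
    tsupport (Φ.φ l) ⊆ Metric.ball 0 ((2 : ℝ) ^ (l + 1)) := by
  cases l with
  | zero => simpa using Φ.tsupport_zero
  | succ l => exact (Φ.tsupport_succ l).trans sdiff_subset

/-- The symbol `φ_l(2π 2^l ·)`, which lives at frequencies of order one. -/
noncomputable def baseSymbol (l : ℕ) : 𝓢(EuclideanSpace ℝ (Fin n), ℂ) :=
  scale (2 * Real.pi * 2 ^ l) (by positivity) (Φ.φ l)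

/-- The support radius `2^{l+1}` divided by `2π 2^l` is `1/π < 1`. -/
theorem norm_le_of_baseSymbol {l : ℕ} {x : EuclideanSpace ℝ (Fin n)}
    (hx : (2 * Real.pi * 2 ^ l) • x ∈ tsupport (Φ.φ l)) : ‖x‖ ≤ 1 := by
  have h1 := Φ.tsupport_subset l hx
  rw [mem_ball_zero_iff, norm_smul, Real.norm_of_nonneg (by positivity), pow_succ] at h1
  have h2 : (0 : ℝ) < 2 ^ l := by positivity
  by_contra! h3
  have h4 := Real.pi_gt_three
  have h5 : (2 : ℝ) ^ l * 2 ≤ 2 * Real.pi * 2 ^ l * ‖x‖ := by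
    have : 1 ≤ Real.pi * ‖x‖ := by nlinarith
    nlinarith
  linarith

/-- The decay `2^{-lm}` of the derivatives of `φ_l` cancels the factor `2^{lm}` of the rescaling,
and the weights `‖x‖^k` are at most one on the support. Uniformity in `l` is what bounds the kernels
uniformly in `L¹`. -/
theorem exists_baseSymbol_bound (m : ℕ) : ∃ B : ℝ, ∀ (k l : ℕ) (x : EuclideanSpace ℝ (Fin n)),
    ‖x‖ ^ k * ‖iteratedFDeriv ℝ m (baseSymbol Φ l) x‖ ≤ B := by
  obtain ⟨c, hc⟩ := Φ.deriv_bound m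
  refine ⟨(2 * Real.pi) ^ m * c, fun k l x => ?_⟩
  have hc0 : 0 ≤ c := by
    have := (norm_nonneg _).trans (hc 0 0)
    simpa using this
  rw [baseSymbol, norm_iteratedFDeriv_scale m (by positivity)]
  by_cases hx : (2 * Real.pi * 2 ^ l) • x ∈ tsupport (Φ.φ l)
  · have h1 := norm_le_of_baseSymbol Φ hx
    calc _ ≤ 1 * ((2 * Real.pi * 2 ^ l) ^ m * (c * ((2 : ℝ) ^ (l * m))⁻¹)) := by
          gcongr
          · exact pow_le_one₀ (norm_nonneg _) h1
          · exact hc l _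
      _ = _ := by
        rw [one_mul, mul_pow (2 * Real.pi), pow_mul]
        have : ((2 : ℝ) ^ l) ^ m ≠ 0 := by positivity
        field_simp
  · have h2 : iteratedFDeriv ℝ m (Φ.φ l) ((2 * Real.pi * 2 ^ l) • x) = 0 := by
      by_contra h3
      exact hx (support_iteratedFDeriv_subset m h3)
    rw [h2, norm_zero, mul_zero, mul_zero]
    positivity

/-- The convolution kernel of the `l`-th Littlewood–Paley projection. -/
noncomputable def lpKernel (l : ℕ) : 𝓢(EuclideanSpace ℝ (Fin n), ℂ) :=
  dilate l (𝓕⁻ (baseSymbol Φ l))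

theorem fourier_lpKernel (l : ℕ) (ξ : EuclideanSpace ℝ (Fin n)) :
    𝓕 (lpKernel Φ l) ξ = Φ.φ l ((2 * Real.pi) • ξ) := by
  rw [lpKernel, fourier_dilate, fourier_fourierInv_eq, baseSymbol, scale_apply, smul_smul,
    mul_assoc, mul_inv_cancel₀ (by positivity), mul_one]

theorem exists_kernelNorm_lpKernel_le : ∃ C : ℝ≥0∞, C ≠ ⊤ ∧ ∀ l, kernelNorm 0 (lpKernel Φ l) ≤ C := by
  choose B hB using exists_baseSymbol_bound Φ
  obtain ⟨C, hC, hle⟩ := exists_kernelNorm_fourierInv_le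
    (E := EuclideanSpace ℝ (Fin n)) fun _ m => B m
  refine ⟨C, hC, fun l => ?_⟩
  rw [lpKernel, kernelNorm_dilate]
  simpa [pow2_zero] using hle _ fun k m x => hB m k l x

/-- There is a kernel whose dilates reproduce all the Littlewood–Paley kernels. -/
theorem exists_reproducing_kernel : ∃ Q : 𝓢(EuclideanSpace ℝ (Fin n), ℂ), ∀ l ξ,
    𝓕 (lpKernel Φ l) ξ = 𝓕 (dilate l Q) ξ * 𝓕 (lpKernel Φ l) ξ := by
  obtain ⟨χ, h1, -⟩ := exists_schwartz_cutoff (E := EuclideanSpace ℝ (Fin n)) one_pos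
  refine ⟨𝓕⁻ χ, fun l ξ => ?_⟩
  rw [lpKernel, fourier_dilate, fourier_dilate, fourier_fourierInv_eq, fourier_fourierInv_eq]
  set x := ((2 : ℝ) ^ l)⁻¹ • ξ
  by_cases hx : (2 * Real.pi * 2 ^ l) • x ∈ tsupport (Φ.φ l)
  · rw [h1 x (norm_le_of_baseSymbol Φ hx), one_mul]
  · rw [baseSymbol, scale_apply, image_eq_zero_of_notMem_tsupport hx, mul_zero]

/-- There is a kernel of mean zero whose dilates reproduce all the Littlewood–Paley kernels but
the first one. -/
theorem exists_reproducing_kernel_integral_zero : ∃ P : 𝓢(EuclideanSpace ℝ (Fin n), ℂ),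
    ∫ x, P x = 0 ∧ ∀ l ξ, 0 < l →
    𝓕 (lpKernel Φ l) ξ = 𝓕 (dilate l P) ξ * 𝓕 (lpKernel Φ l) ξ := by
  obtain ⟨χ, h1, -⟩ := exists_schwartz_cutoff (E := EuclideanSpace ℝ (Fin n)) one_pos
  -- For `l > 0` the rescaled symbol lives where `‖x‖ ≥ 1/(4π) > 1/16`, so a cutoff vanishing for
  -- `‖x‖ ≥ 2 · (1/32)` can be subtracted without effect there. The difference vanishes at the
  -- origin, which is the vanishing of the integral of the kernel.
  obtain ⟨χ', h2, h3⟩ := exists_schwartz_cutoff (E := EuclideanSpace ℝ (Fin n))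
    (r := 1 / 32) (by norm_num)
  refine ⟨𝓕⁻ (χ - χ'), ?_, fun l ξ hl => ?_⟩
  · have h4 : 𝓕 (𝓕⁻ (χ - χ')) 0 = (χ - χ') 0 := by rw [fourier_fourierInv_eq]
    rw [SchwartzMap.fourier_coe, Real.fourier_eq] at h4
    simpa [h1 0 (by simp), h2 0 (by simp)] using h4
  · rw [lpKernel, fourier_dilate, fourier_dilate, fourier_fourierInv_eq, fourier_fourierInv_eq]
    set x := ((2 : ℝ) ^ l)⁻¹ • ξ
    by_cases hx : (2 * Real.pi * 2 ^ l) • x ∈ tsupport (Φ.φ l)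
    · have h5 : 2 * (1 / 32) ≤ ‖x‖ := by
        obtain ⟨l, rfl⟩ := Nat.exists_eq_succ_of_ne_zero hl.ne'
        have h6 := (Φ.tsupport_succ l hx).2
        rw [mem_ball_zero_iff, not_lt, norm_smul, Real.norm_of_nonneg (by positivity),
          pow_succ] at h6
        have h7 : (0 : ℝ) < 2 ^ l := by positivity
        have h8 := Real.pi_lt_four
        by_contra! h9
        have : 2 * Real.pi * 2 * ‖x‖ < 1 := by nlinarith [norm_nonneg x]
        nlinarith
      rw [sub_apply, h1 x (norm_le_of_baseSymbol Φ hx), h3 x h5, sub_zero,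
        one_mul]
    · rw [baseSymbol, scale_apply, image_eq_zero_of_notMem_tsupport hx, mul_zero]

theorem admissible_univ {E : Type} [NormedAddCommGroup E] [InnerProductSpace ℝ E]
    [FiniteDimensional ℝ E] [MeasurableSpace E] [BorelSpace E] :
    Admissible {(univ : Set E)} univ := ⟨by simp, by simp, by simp⟩

variable {𝒜 : Set (Set (EuclideanSpace ℝ (Fin n)))} {p q : ℝ≥0∞} {σ : ℝ}
  {F : ℕ → EuclideanSpace ℝ (Fin n) → ℂ} {f : EuclideanSpace ℝ (Fin n) → ℂ}

/-- A Littlewood–Paley piece `g` of positive index satisfies `g = P_l * g` with `P_l` of integral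
zero, so its norm is at most `2^{-l}` times that of its derivative, up to the moment of `P`. After
`M` iterations the derivatives are moved onto `f`. -/
theorem exists_supNorm_lpKernel_le_of_smooth (h𝒜 : Admissible 𝒜 univ) (hp : 1 ≤ p) (M : ℕ) :
    ∃ C : ℝ≥0∞, C ≠ ⊤ ∧ ∀ (l : ℕ) (f : EuclideanSpace ℝ (Fin n) → ℂ), 0 < l → IsBddSmooth f →
      supNorm 𝒜 p (conv (lpKernel Φ l) f) ≤ C * pow2 (-(l * M)) * derivNorm 𝒜 p M f := by
  obtain ⟨P, hP, hrep⟩ := exists_reproducing_kernel_integral_zero Φ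
  obtain ⟨C, hC, hle⟩ := exists_kernelNorm_lpKernel_le Φ
  refine ⟨kernelMoment P ^ M * C, ENNReal.mul_ne_top
    (ENNReal.pow_ne_top (kernelMoment_lt_top P).ne) hC, fun l f hl hf => ?_⟩
  have hg := hf.isDominated.isBddSmooth_conv (lpKernel Φ l)
  set g := conv (lpKernel Φ l) f
  have hgg : g = conv (dilate l P) g :=
    (conv_conv hf.isDominated (eq_conv_of_fourier fun ξ => hrep l ξ hl)).symm
  have hstep : ∀ m, derivNorm 𝒜 p m g ≤
      kernelMoment P * pow2 (-l) * derivNorm 𝒜 p (m + 1) g := fun m => by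
    have h1 := derivNorm_conv_sub_le h𝒜 hp (dilate l P) (by simp) hg m
    rw [integral_dilate, hP, ← hgg, kernelMoment_dilate] at h1
    simpa [mul_comm] using h1
  have hiter : ∀ M : ℕ, derivNorm 𝒜 p 0 g ≤
      kernelMoment P ^ M * pow2 (-(l * M)) * derivNorm 𝒜 p M g := fun M => by
    induction M with
    | zero => simp [pow2_zero]
    | succ M ih =>
      refine ih.trans ?_
      calc _ ≤ kernelMoment P ^ M * pow2 (-(l * M)) *
            (kernelMoment P * pow2 (-l) * derivNorm 𝒜 p (M + 1) g) := by gcongr; exact hstep M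
        _ = kernelMoment P ^ (M + 1) * (pow2 (-(l * M)) * pow2 (-l)) *
            derivNorm 𝒜 p (M + 1) g := by ring
        _ = _ := by rw [← pow2_add]; congr 3; push_cast; ring
  rw [← derivNorm_zero]
  refine (hiter M).trans ?_
  calc _ ≤ kernelMoment P ^ M * pow2 (-(l * M)) * (C * derivNorm 𝒜 p M f) := by
        gcongr
        exact (derivNorm_conv_le h𝒜 hp _ (by simp) hf M).trans (by gcongr; exact hle l)
    _ = _ := by ring

/-- The Littlewood–Paley characterisation: the Littlewood–Paley pieces of a decomposition of
smoothness `σ` have the right total size. -/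
theorem IsDecomposition.exists_tsum_supNorm_lpKernel_le (h𝒜 : Admissible 𝒜 univ) (hp : 1 ≤ p)
    (hq : 1 ≤ q) (hσ : 0 < σ) (hF : IsDecomposition 𝒜 p q σ F) :
    ∃ b, MemEllq q b ∧ ∃ C : ℝ≥0∞, C ≠ ⊤ ∧ ∀ l : ℕ,
      pow2 (σ * l) * ∑' k, supNorm 𝒜 p (conv (lpKernel Φ l) (F k)) ≤ C * b l := by
  obtain ⟨M, hM⟩ := exists_nat_gt σ
  obtain ⟨hs, b, hb, hle⟩ := hF
  choose C hC hm using hle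
  obtain ⟨C₁, hC₁, h₁⟩ := exists_kernelNorm_lpKernel_le Φ
  obtain ⟨C₂, hC₂, h₂⟩ := exists_supNorm_lpKernel_le_of_smooth Φ h𝒜 hp M
  have h0 : ∀ (l k : ℕ), supNorm 𝒜 p (conv (lpKernel Φ l) (F k)) ≤
      C₁ * supNorm 𝒜 p (F k) := fun l k =>
    (supNorm_conv_le h𝒜 hp _ (by simp) (hs k).isDominated.1).trans (by gcongr; exact h₁ l)
  refine ⟨geomConv σ (M - σ) b, memEllq_geomConv hq hσ (sub_pos.2 hM) hb,
    C₁ * C 0 + C₂ * C M, ENNReal.add_ne_top.2 ⟨ENNReal.mul_ne_top hC₁ (hC _),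
    ENNReal.mul_ne_top hC₂ (hC _)⟩, fun l => ?_⟩
  have h4 := tsum_le_geomConv (σ := σ) (L := M) (m := 0) b
    (a := fun l k => supNorm 𝒜 p (conv (lpKernel Φ l) (F k))) (C := C₁ * C 0 + C₂ * C M)
    (fun l k => ?_) (fun l k hkl => ?_) l
  · calc _ ≤ pow2 (σ * l) * ((C₁ * C 0 + C₂ * C M) * pow2 (l * ((0 : ℕ) - σ)) *
          geomConv σ (M - σ) b l) := by gcongr
      _ = (C₁ * C 0 + C₂ * C M) * (pow2 (σ * l) * pow2 (l * ((0 : ℕ) - σ))) *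
          geomConv σ (M - σ) b l := by ring
      _ = _ := by
        rw [← pow2_add, show σ * l + l * ((0 : ℕ) - σ) = 0 by push_cast; ring, pow2_zero, mul_one]
  · refine (h0 l k).trans ?_
    rw [← derivNorm_zero]
    calc _ ≤ C₁ * (C 0 * (pow2 (k * ((0 : ℕ) - σ)) * b k)) := by gcongr; exact hm 0 k
      _ = C₁ * C 0 * pow2 (l * (0 : ℕ)) * (pow2 (-(k * σ)) * b k) := by
        rw [show (k : ℝ) * ((0 : ℕ) - σ) = -(k * σ) by push_cast; ring]
        simp only [Nat.cast_zero, mul_zero, pow2_zero, mul_one]; ring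
      _ ≤ _ := by gcongr; simp
  · refine (h₂ l _ (by omega) (hs k)).trans ?_
    calc _ ≤ C₂ * pow2 (-(l * M)) * (C M * (pow2 (k * (M - σ)) * b k)) := by
          gcongr; exact hm _ k
      _ = C₂ * C M * pow2 (-(l * M)) * (pow2 (k * ((0 : ℕ) + M - σ)) * b k) := by
        rw [Nat.cast_zero, zero_add]; ring
      _ ≤ _ := by gcongr; simp

theorem IsDecomposition.exists_supNorm_lpKernel_le (h𝒜 : Admissible 𝒜 univ) (hp : 1 ≤ p)
    (hq : 1 ≤ q) (hσ : 0 < σ) (hf : IsDominated f) (hF : IsDecomposition 𝒜 p q σ F)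
    (happ : Approximates 𝒜 p F f) : ∃ b, MemEllq q b ∧ ∃ C : ℝ≥0∞, C ≠ ⊤ ∧
      ∀ l : ℕ, pow2 (σ * l) * supNorm 𝒜 p (conv (lpKernel Φ l) f) ≤ C * b l := by
  obtain ⟨b, hb, C, hC, hle⟩ := hF.exists_tsum_supNorm_lpKernel_le Φ h𝒜 hp hq hσ
  refine ⟨b, hb, C, hC, fun l => le_trans ?_ (hle l)⟩
  have h3 := derivNorm_le_tsum (T := conv (lpKernel Φ l)) (m := 0) hp
    (fun f g hf hg => conv_sub hf hg _) (fun f hf => hf.isBddSmooth_conv _)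
    (kernelNorm_lt_top 0 (lpKernel Φ l)).ne (fun f hf => by
      rw [derivNorm_zero]; exact supNorm_conv_le h𝒜 hp _ (by simp) hf.1) hf hF.smooth happ
  simp only [derivNorm_zero] at h3
  gcongr

/-- `ℓ^q` membership of real sequences in terms of `MemEllq`. -/
theorem memℓp_iff_memEllq {b : ℕ → ℝ} (hq : 1 ≤ q) :
    Memℓp b q ↔ MemEllq q fun k => ‖b k‖ₑ := by
  have h0 : MemEllq q (fun k => ‖b k‖ₑ) ↔ eLpNorm b q Measure.count < ⊤ := by
    rw [MemEllq]
    have : eLpNorm (fun k => ‖b k‖ₑ) q Measure.count = eLpNorm b q Measure.count :=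
      eLpNorm_congr_enorm_ae (ae_of_all _ fun k => by simp)
    rw [this]
  rw [h0]
  rcases eq_or_ne q ⊤ with rfl | hqt
  · rw [memℓp_infty_iff, eLpNorm_exponent_top, eLpNormEssSup]
    have h1 : essSup (fun k => ‖b k‖ₑ) Measure.count = ⨆ k, ‖b k‖ₑ := by
      rw [essSup_count]
    rw [h1]
    constructor
    · rintro ⟨B, hB⟩
      refine lt_of_le_of_lt (iSup_le fun k => ?_) (ENNReal.ofReal_lt_top (r := B))
      rw [← ofReal_norm]
      exact ENNReal.ofReal_le_ofReal (hB ⟨k, rfl⟩)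
    · intro h
      refine ⟨(⨆ k, ‖b k‖ₑ).toReal, ?_⟩
      rintro _ ⟨k, rfl⟩
      simp only [← toReal_enorm]
      exact ENNReal.toReal_mono h.ne (le_iSup (fun k => ‖b k‖ₑ) k)
  · have hq0 : 0 < q.toReal := ENNReal.toReal_pos (zero_lt_one.trans_le hq).ne' hqt
    rw [memℓp_gen_iff hq0, eLpNorm_lt_top_iff_lintegral_rpow_enorm_lt_top
      (zero_lt_one.trans_le hq).ne' hqt, lintegral_count]
    have h1 : ∀ k, ‖b k‖ₑ ^ q.toReal = ENNReal.ofReal (‖b k‖ ^ q.toReal) := fun k => by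
      rw [← ofReal_norm, ENNReal.ofReal_rpow_of_nonneg (norm_nonneg _) hq0.le]
    simp only [h1]
    constructor
    · intro h
      rw [← ENNReal.ofReal_tsum_of_nonneg (fun k => by positivity) h]
      exact ENNReal.ofReal_lt_top
    · intro h
      have := ENNReal.summable_toReal h.ne
      refine this.congr fun k => ?_
      rw [ENNReal.toReal_ofReal (by positivity)]

theorem MemEllq.const_mul {b : ℕ → ℝ≥0∞} (hb : MemEllq q b) {C : ℝ≥0∞} (hC : C ≠ ⊤) :
    MemEllq q fun k => C * b k := by
  lift C to NNReal using hC
  have h1 : eLpNorm (fun k => (C : ℝ≥0∞) * b k) q Measure.count ≤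
      C * eLpNorm b q Measure.count := by
    refine (eLpNorm_le_nnreal_smul_eLpNorm_of_ae_le_mul' (c := C) (ae_of_all _ fun k => ?_) q).trans
      (le_of_eq rfl)
    simp
  exact h1.trans_lt (ENNReal.mul_lt_top ENNReal.coe_lt_top hb)

theorem lpPiece_toTemperedDistribution [Fact (1 ≤ p)] (hf : IsDominated f)
    (hfp : MemLp f p volume) (l : ℕ) (hc : MemLp (conv (lpKernel Φ l) f) p volume) :
    lpPiece Φ l (Lp.toTemperedDistribution (hfp.toLp f)) =
      Lp.toTemperedDistribution (hc.toLp (conv (lpKernel Φ l) f)) := by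
  rw [← fourierMultiplierCLM_toTemperedDistribution (lpKernel Φ l) hf hfp hc, lpPiece]
  simp only [fourier_lpKernel]

theorem IsDecomposition.memBesov [Fact (1 ≤ p)] (hpt : p ≠ ⊤) (hq : 1 ≤ q) (hσ : 0 < σ)
    (hF : IsDecomposition {univ} p q σ F) (hf : StronglyMeasurable f) (hfp : MemLp f p volume)
    (happ : Approximates {univ} p F f) :
    MemBesov Φ σ p q (Lp.toTemperedDistribution (hfp.toLp f)) := by
  have hp : 1 ≤ p := Fact.out
  have hd : IsDominated f := .of_memLp hf hp hpt hfp
  have hc := fun l => memLp_conv hp (lpKernel Φ l) hf hfp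
  refine ⟨fun l => (hc l).toLp _, fun l => (lpPiece_toTemperedDistribution Φ hd hfp l (hc l)).symm,
    ?_⟩
  obtain ⟨b, hb, C, hC, hle⟩ := hF.exists_supNorm_lpKernel_le Φ admissible_univ hp hq hσ hd happ
  rw [memℓp_iff_memEllq hq]
  refine (hb.const_mul hC).mono fun l => (le_of_eq ?_).trans (hle l)
  rw [supNorm_univ, enorm_mul, Lp.norm_toLp, ← ofReal_two_rpow,
    Real.enorm_of_nonneg (by positivity), Real.enorm_of_nonneg (by positivity),
    ENNReal.ofReal_toReal (hc l).2.ne]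

end LittlewoodPaley

/-! ### Besov distributions of positive smoothness are functions with a decomposition. -/

section LittlewoodPaleySum

open FourierTransform

variable {n : ℕ} (Φ : DyadicPartition n) {p q : ℝ≥0∞} {σ s : ℝ}

local notation "𝔼" => EuclideanSpace ℝ (Fin n)

/-- The symbol `φ_l(2π ·)` of the `l`-th Littlewood–Paley projection. -/
noncomputable def lpSymbol (l : ℕ) : 𝓢(𝔼, ℂ) := scale (2 * Real.pi) (by positivity) (Φ.φ l)

theorem lpSymbol_apply (l : ℕ) (ξ : 𝔼) : lpSymbol Φ l ξ = Φ.φ l ((2 * Real.pi) • ξ) := rfl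

/-- For positive index the symbol is supported in `2π‖x‖ ≥ 2^{l-1}`, so one power of `‖x‖` pays for
a factor `2^{-l}`. That factor makes the partition of unity summable in every Schwartz seminorm. -/
theorem two_pow_neg_le_of_mem_tsupport {l : ℕ} {x : 𝔼}
    (hx : (2 * Real.pi) • x ∈ tsupport (Φ.φ l)) :
    1 ≤ ((2 : ℝ)⁻¹) ^ l * (1 + 4 * Real.pi * ‖x‖) := by
  have hpi := Real.pi_pos
  cases l with
  | zero => simp only [pow_zero, one_mul]; nlinarith [norm_nonneg x]
  | succ l =>
    have h1 := (Φ.tsupport_succ l hx).2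
    rw [mem_ball_zero_iff, not_lt, norm_smul, Real.norm_of_nonneg (by positivity)] at h1
    have h2 : (0 : ℝ) < 2 ^ l := by positivity
    rw [inv_pow, ← div_eq_inv_mul, le_div_iff₀ (by positivity), pow_succ]
    linarith

theorem exists_iteratedFDeriv_lpSymbol_le (m : ℕ) : ∃ C : ℝ, 0 ≤ C ∧ ∀ (l : ℕ) (x : 𝔼),
    ‖iteratedFDeriv ℝ m (lpSymbol Φ l) x‖ ≤ C * ((2 : ℝ)⁻¹ ^ l * (1 + 4 * Real.pi * ‖x‖)) := by
  obtain ⟨c, hc⟩ := Φ.deriv_bound m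
  have hc0 : 0 ≤ c := by simpa using (norm_nonneg _).trans (hc 0 0)
  refine ⟨(2 * Real.pi) ^ m * c, by positivity, fun l x => ?_⟩
  rw [lpSymbol, norm_iteratedFDeriv_scale m (by positivity)]
  by_cases hx : (2 * Real.pi) • x ∈ tsupport (Φ.φ l)
  · have h1 : ‖iteratedFDeriv ℝ m (Φ.φ l) ((2 * Real.pi) • x)‖ ≤ c :=
      (hc l _).trans (mul_le_of_le_one_right hc0 (inv_le_one_of_one_le₀ (one_le_pow₀ one_le_two)))
    calc _ ≤ (2 * Real.pi) ^ m * c := by gcongr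
      _ ≤ _ := le_mul_of_one_le_right (by positivity) (two_pow_neg_le_of_mem_tsupport Φ hx)
  · have h2 : iteratedFDeriv ℝ m (Φ.φ l) ((2 * Real.pi) • x) = 0 := by
      by_contra h3
      exact hx (support_iteratedFDeriv_subset m h3)
    rw [h2, norm_zero, mul_zero]
    positivity

/-- The product of a Schwartz function with the `l`-th symbol. -/
noncomputable def symbolMul (l : ℕ) (v : 𝓢(𝔼, ℂ)) : 𝓢(𝔼, ℂ) :=
  SchwartzMap.smulLeftCLM ℂ (fun ξ => Φ.φ l ((2 * Real.pi) • ξ)) v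

theorem symbolMul_apply (l : ℕ) (v : 𝓢(𝔼, ℂ)) (x : 𝔼) :
    symbolMul Φ l v x = Φ.φ l ((2 * Real.pi) • x) * v x :=
  SchwartzMap.smulLeftCLM_apply_apply (lpSymbol Φ l).hasTemperateGrowth v x

theorem exists_seminorm_symbolMul_le (k m : ℕ) (v : 𝓢(𝔼, ℂ)) : ∃ C : ℝ, 0 ≤ C ∧ ∀ l,
    SchwartzMap.seminorm ℂ k m (symbolMul Φ l v) ≤ C * (2 : ℝ)⁻¹ ^ l := by
  choose C hC0 hC using exists_iteratedFDeriv_lpSymbol_le Φ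
  have hpi := Real.pi_pos
  refine ⟨∑ i ∈ Finset.range (m + 1), (m.choose i : ℝ) * (C i *
    (SchwartzMap.seminorm ℂ k (m - i) v + 4 * Real.pi * SchwartzMap.seminorm ℂ (k + 1) (m - i) v)),
    Finset.sum_nonneg fun i _ => mul_nonneg (by positivity) (mul_nonneg (hC0 i)
      (add_nonneg (apply_nonneg _ _) (mul_nonneg (by positivity) (apply_nonneg _ _)))),
    fun l => ?_⟩
  have hnn : ∀ i, 0 ≤ C i * (SchwartzMap.seminorm ℂ k (m - i) v +
      4 * Real.pi * SchwartzMap.seminorm ℂ (k + 1) (m - i) v) := fun i => mul_nonneg (hC0 i)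
      (add_nonneg (apply_nonneg _ _) (mul_nonneg (by positivity) (apply_nonneg _ _)))
  refine SchwartzMap.seminorm_le_bound ℂ k m _
    (mul_nonneg (Finset.sum_nonneg fun i _ => mul_nonneg (by positivity) (hnn i))
      (by positivity)) fun x => ?_
  have h1 : (symbolMul Φ l v : 𝔼 → ℂ) = fun x => lpSymbol Φ l x * v x :=
    funext fun x => symbolMul_apply Φ l v x
  have h2 := norm_iteratedFDeriv_mul_le (n := m) (N := ∞) (𝕜 := ℝ) ((lpSymbol Φ l).smooth ⊤)
    (v.smooth ⊤) x (by exact_mod_cast le_top)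
  rw [h1]
  calc _ ≤ ‖x‖ ^ k * ∑ i ∈ Finset.range (m + 1), (m.choose i : ℝ) *
        ‖iteratedFDeriv ℝ i (lpSymbol Φ l) x‖ * ‖iteratedFDeriv ℝ (m - i) v x‖ := by gcongr
    _ = ∑ i ∈ Finset.range (m + 1), (m.choose i : ℝ) * (‖iteratedFDeriv ℝ i (lpSymbol Φ l) x‖ *
        (‖x‖ ^ k * ‖iteratedFDeriv ℝ (m - i) v x‖)) := by
      rw [Finset.mul_sum]; exact Finset.sum_congr rfl fun i _ => by ring
    _ ≤ ∑ i ∈ Finset.range (m + 1), (m.choose i : ℝ) * (C i *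
        (SchwartzMap.seminorm ℂ k (m - i) v +
          4 * Real.pi * SchwartzMap.seminorm ℂ (k + 1) (m - i) v)) * (2 : ℝ)⁻¹ ^ l := by
      refine Finset.sum_le_sum fun i _ => ?_
      have h3 := SchwartzMap.le_seminorm ℂ k (m - i) v x
      have h4 := SchwartzMap.le_seminorm ℂ (k + 1) (m - i) v x
      rw [mul_assoc (m.choose i : ℝ)]
      refine mul_le_mul_of_nonneg_left ?_ (by positivity)
      calc _ ≤ C i * ((2 : ℝ)⁻¹ ^ l * (1 + 4 * Real.pi * ‖x‖)) *
            (‖x‖ ^ k * ‖iteratedFDeriv ℝ (m - i) v x‖) := by gcongr; exact hC i l x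
        _ = C i * (‖x‖ ^ k * ‖iteratedFDeriv ℝ (m - i) v x‖ + 4 * Real.pi *
            (‖x‖ ^ (k + 1) * ‖iteratedFDeriv ℝ (m - i) v x‖)) * (2 : ℝ)⁻¹ ^ l := by ring
        _ ≤ _ := by
          have := hC0 i
          gcongr
    _ = _ := by rw [Finset.sum_mul]

theorem sum_symbolMul_apply {R : ℕ} {x : 𝔼} (v : 𝓢(𝔼, ℂ)) (hx : 2 * Real.pi * ‖x‖ < 2 ^ R) :
    ∑ l ∈ Finset.range (R + 1), symbolMul Φ l v x = v x := by
  have h1 : ∀ l ∉ Finset.range (R + 1), Φ.φ l ((2 * Real.pi) • x) = 0 := fun l hl => by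
    rw [Finset.mem_range, not_lt] at hl
    obtain ⟨d, rfl⟩ := Nat.exists_eq_add_of_le hl
    refine image_eq_zero_of_notMem_tsupport fun h2 => ?_
    rw [show R + 1 + d = R + d + 1 by ring] at h2
    have h3 := (Φ.tsupport_succ _ h2).2
    rw [mem_ball_zero_iff, not_lt, norm_smul, Real.norm_of_nonneg (by positivity)] at h3
    have h4 : (2 : ℝ) ^ R ≤ 2 ^ (R + d) := pow_le_pow_right₀ one_le_two (Nat.le_add_right _ _)
    linarith
  have h2 := (hasSum_sum_of_ne_finset_zero h1).unique (Φ.sum_eq_one ((2 * Real.pi) • x))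
  simp only [symbolMul_apply]
  rw [← Finset.sum_mul, h2, one_mul]

theorem tendsto_sum_symbolMul (v : 𝓢(𝔼, ℂ)) :
    Tendsto (fun J => ∑ l ∈ Finset.range J, symbolMul Φ l v) atTop (𝓝 v) := by
  rw [(schwartz_withSeminorms ℂ 𝔼 ℂ).tendsto_nhds]
  rintro ⟨k, m⟩ ε hε
  obtain ⟨C, hC0, hC⟩ := exists_seminorm_symbolMul_le Φ k m v
  have hlim : Tendsto (fun J : ℕ => C * ((2 : ℝ)⁻¹ ^ J / (1 - 2⁻¹))) atTop (𝓝 0) := by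
    have := ((tendsto_pow_atTop_nhds_zero_of_lt_one (r := (2 : ℝ)⁻¹) (by norm_num)
      (by norm_num)).div_const (1 - (2 : ℝ)⁻¹)).const_mul C
    simpa using this
  filter_upwards [hlim.eventually (gt_mem_nhds hε)] with J hJ
  refine lt_of_le_of_lt ?_ hJ
  refine SchwartzMap.seminorm_le_bound ℂ k m _ (by positivity) fun x => ?_
  obtain ⟨R, hR⟩ := pow_unbounded_of_one_lt (2 * Real.pi * (‖x‖ + 1)) (one_lt_two (α := ℝ))
  set R' := max R J
  have hR' : 2 * Real.pi * (‖x‖ + 1) < 2 ^ R' :=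
    hR.trans_le (pow_le_pow_right₀ one_le_two (le_max_left _ _))
  have hJR : J ≤ R' + 1 := (le_max_right _ _).trans (Nat.le_succ _)
  -- Only finitely many symbols are nonzero on the unit ball about `x`, so the remainder agrees near
  -- `x`, derivatives included, with minus a finite block starting at `J`. The seminorms of such
  -- blocks are bounded by a geometric tail that does not depend on `x`.
  have h1 : (∑ l ∈ Finset.range J, symbolMul Φ l v - v : 𝓢(𝔼, ℂ)) =ᶠ[𝓝 x]
      (-∑ l ∈ Finset.Ico J (R' + 1), symbolMul Φ l v : 𝓢(𝔼, ℂ)) := by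
    filter_upwards [Metric.ball_mem_nhds x one_pos] with y hy
    have hy' : ‖y‖ < ‖x‖ + 1 := by
      have := norm_le_norm_add_norm_sub' y x
      rw [mem_ball_iff_norm] at hy
      linarith
    have h2 := sum_symbolMul_apply Φ (R := R') (x := y) v (lt_trans (by gcongr) hR')
    rw [← Finset.sum_range_add_sum_Ico _ hJR] at h2
    rw [sub_apply, neg_apply, sum_apply, sum_apply, ← h2]
    ring
  rw [(h1.iteratedFDeriv ℝ m).eq_of_nhds]
  refine (SchwartzMap.le_seminorm ℂ k m _ x).trans ?_
  rw [map_neg_eq_map]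
  refine (Finset.le_sum_of_subadditive (SchwartzMap.seminorm ℂ k m) (map_zero _).le (map_add_le_add _) _ _).trans ?_
  calc _ ≤ ∑ l ∈ Finset.Ico J (R' + 1), C * (2 : ℝ)⁻¹ ^ l := Finset.sum_le_sum fun l _ => hC l
    _ ≤ _ := by
      rw [← Finset.mul_sum]
      gcongr
      exact geom_sum_Ico_le_of_lt_one (by norm_num) (by norm_num)

theorem lpPiece_apply (l : ℕ) (g : 𝓢'(𝔼, ℂ)) (ψ : 𝓢(𝔼, ℂ)) :
    lpPiece Φ l g ψ = g (𝓕 (symbolMul Φ l (𝓕⁻ ψ))) := rfl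

theorem tendsto_sum_lpPiece (g : 𝓢'(𝔼, ℂ)) (ψ : 𝓢(𝔼, ℂ)) :
    Tendsto (fun J => ∑ l ∈ Finset.range J, lpPiece Φ l g ψ) atTop (𝓝 (g ψ)) := by
  have h1 := (g.continuous.comp (fourierCLM ℂ 𝓢(𝔼, ℂ)).continuous).tendsto (𝓕⁻ ψ) |>.comp
    (tendsto_sum_symbolMul Φ (𝓕⁻ ψ))
  have h2 : g (𝓕 (𝓕⁻ ψ)) = g ψ := by rw [fourier_fourierInv_eq]
  rw [← h2]
  refine h1.congr fun J => ?_
  simp only [Function.comp, map_sum, lpPiece_apply]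
  exact map_sum g _ _

theorem toTemperedDistribution_injective [Fact (1 ≤ p)] :
    Function.Injective (Lp.toTemperedDistribution : Lp ℂ p (volume : Measure 𝔼) → 𝓢'(𝔼, ℂ)) :=
  LinearMap.ker_eq_bot.1 (Lp.ker_toTemperedDistributionCLM_eq_bot (F := ℂ) (p := p)
    (μ := (volume : Measure 𝔼)))

/-- Elements of a Besov space of positive smoothness are functions with a decomposition. -/
theorem MemBesov.exists_decomposition [Fact (1 ≤ p)] (hpt : p ≠ ⊤) (hq : 1 ≤ q) (hs : 0 < s)
    {g : 𝓢'(𝔼, ℂ)} (hg : MemBesov Φ s p q g) :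
    ∃ (F : ℕ → 𝔼 → ℂ) (f : 𝔼 → ℂ) (hfp : MemLp f p volume), StronglyMeasurable f ∧
      IsDecomposition {univ} p q s F ∧ Approximates {univ} p F f ∧
      g = Lp.toTemperedDistribution (hfp.toLp f) := by
  have hp : 1 ≤ p := Fact.out
  obtain ⟨G, hG, hGq⟩ := hg
  obtain ⟨Q, hQ⟩ := exists_reproducing_kernel Φ
  have hGm : ∀ l, StronglyMeasurable (G l) := fun l => Lp.stronglyMeasurable _
  have hd : ∀ l, IsDominated (G l) := fun l => .of_memLp (hGm l) hp hpt (Lp.memLp _)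
  -- The transform of `dilate l Q` is one on the support of the `l`-th symbol, so `F l` is a smooth
  -- representative of the `l`-th piece. Putting `m` derivatives on this kernel costs `2^{lm}`,
  -- which gives the decomposition bounds.
  set F : ℕ → 𝔼 → ℂ := fun l => conv (dilate l Q) (G l)
  have hFp : ∀ l, MemLp (F l) p volume := fun l => memLp_conv hp _ (hGm l) (Lp.memLp _)
  have hFG : ∀ l, (hFp l).toLp (F l) = G l := fun l => by
    apply toTemperedDistribution_injective
    have h1 := fourierMultiplierCLM_toTemperedDistribution (dilate l Q) (hd l) (Lp.memLp (G l))
      (hFp l)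
    rw [Lp.toLp_coeFn, hG] at h1
    have h3 : (fun ξ : 𝔼 => Φ.φ l ((2 * Real.pi) • ξ)) = lpSymbol Φ l := rfl
    rw [← h1, hG, lpPiece, h3,
      TemperedDistribution.fourierMultiplierCLM_fourierMultiplierCLM_apply
        (lpSymbol Φ l).hasTemperateGrowth (𝓕 (dilate l Q)).hasTemperateGrowth]
    congr 2
    ext ξ
    have h2 := hQ l ξ
    rw [fourier_lpKernel] at h2
    rw [Pi.mul_apply, lpSymbol_apply, mul_comm, ← h2]
  have hF : IsDecomposition {univ} p q s F := by
    refine ⟨fun l => (hd l).isBddSmooth_conv _, _, (memℓp_iff_memEllq hq).1 hGq, fun m =>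
      ⟨kernelNorm m Q, (kernelNorm_lt_top _ _).ne, fun l => ?_⟩⟩
    simp only [F]
    rw [conv_eq_kconv]
    refine (derivNorm_kconv_le admissible_univ isClosed_univ hp m _ (by simp) (hd l)).trans ?_
    rw [kernelNorm_dilate, supNorm_univ, enorm_mul, Real.enorm_of_nonneg (by positivity),
      ofReal_two_rpow, enorm_norm, Lp.enorm_def, ← mul_assoc (pow2 _), ← pow2_add,
      show (l : ℝ) * (m - s) + s * l = l * m by ring]
    exact le_of_eq (by ring)
  obtain ⟨f, hfm, hfp, happ⟩ := hF.exists_limit hp hq hs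
  refine ⟨F, f, hfp, hfm, hF, happ, ?_⟩
  have h1 := (approximates_univ_iff hFp hfp).1 happ
  ext ψ
  have h2 := (PointwiseConvergenceCLM.tendsto_iff_forall_tendsto.1
    (((Lp.toTemperedDistributionCLM ℂ (volume : Measure 𝔼) p).continuous.tendsto _).comp h1)) ψ
  refine tendsto_nhds_unique (tendsto_sum_lpPiece Φ g ψ) (h2.congr fun J => ?_)
  simp only [Function.comp, map_sum, hFG, Lp.toTemperedDistributionCLM_apply, hG]
  exact sum_apply _ _ _

end LittlewoodPaleySum

/-! ### The product near a point. -/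

section LocalProduct

variable {E : Type} [NormedAddCommGroup E] [InnerProductSpace ℝ E] [FiniteDimensional ℝ E]
  [MeasurableSpace E] [BorelSpace E]
  {A D Ω : Set E} {p q : ℝ≥0∞} {σ s : ℝ} {η : 𝓢(E, ℂ)} {F G : ℕ → E → ℂ}
  {f g u v w : E → ℂ} {L : ℕ}

theorem IsBddSmooth.of_hasCompactSupport (hf : ContDiff ℝ ∞ f) (hc : HasCompactSupport f) :
    IsBddSmooth f := by
  refine ⟨hf, fun m => ?_⟩
  exact (hc.iteratedFDeriv m).exists_bound_of_continuous
    (hf.continuous_iteratedFDeriv (by exact_mod_cast le_top))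

theorem exists_bump (x : E) {r : ℝ} (hr : 0 < r) : ∃ χ : E → ℂ, IsBddSmooth χ ∧
    (∀ y ∈ Metric.ball x r, χ y = 1) ∧ ∀ y ∉ Metric.ball x (2 * r), χ y = 0 := by
  let b : ContDiffBump x := ⟨r, 2 * r, hr, by linarith⟩
  refine ⟨fun y => ((b y : ℝ) : ℂ), .of_hasCompactSupport
    (Complex.ofRealCLM.contDiff.comp b.contDiff)
    (b.hasCompactSupport.comp_left (g := fun t : ℝ => (t : ℂ)) Complex.ofReal_zero),
    fun y hy => ?_, fun y hy => ?_⟩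
  · beta_reduce
    rw [b.one_of_mem_closedBall (Metric.ball_subset_closedBall hy), Complex.ofReal_one]
  · beta_reduce
    rw [b.zero_of_le_dist (by simpa [b] using hy), Complex.ofReal_zero]

theorem fderiv_mul_apply (hf : IsBddSmooth f) (hg : IsBddSmooth g) (e x : E) :
    fderiv ℝ (fun y => f y * g y) x e = fderiv ℝ f x e * g x + f x * fderiv ℝ g x e := by
  rw [fderiv_fun_mul (hf.differentiable x) (hg.differentiable x)]
  simp only [add_apply, smul_apply, smul_eq_mul]
  ring

/-- `g` belongs to the Besov space of smoothness `σ`, as witnessed by a decomposition. -/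
def HasDecomposition (p q : ℝ≥0∞) (σ : ℝ) (g : E → ℂ) : Prop :=
  StronglyMeasurable g ∧ MemLp g p volume ∧
    ∃ G : ℕ → E → ℂ, IsDecomposition {univ} p q σ G ∧ Approximates {univ} p G g

theorem IsBddSmooth.memLp_mul {χ : E → ℂ} (hχ : IsBddSmooth χ) (hg : MemLp g p volume) :
    MemLp (fun x => χ x * g x) p volume := by
  obtain ⟨C, hC⟩ := hχ.norm_le
  refine MemLp.of_le_mul hg (hχ.1.continuous.aestronglyMeasurable.mul hg.1) (c := C)
    (ae_of_all _ fun x => ?_)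
  rw [norm_mul]
  gcongr
  exact hC x

theorem HasDecomposition.mul_left (hp : 1 ≤ p) {χ : E → ℂ} (hχ : IsBddSmooth χ)
    (hg : HasDecomposition p q σ g) : HasDecomposition p q σ fun x => χ x * g x := by
  obtain ⟨hgm, hgp, G, hG, happ⟩ := hg
  exact ⟨hχ.1.continuous.stronglyMeasurable.mul hgm, hχ.memLp_mul hgp, _, hG.mul_left hp hχ,
    happ.mul_left hχ hG.smooth hgm.aestronglyMeasurable⟩

theorem HasDecomposition.add (hp : 1 ≤ p) (hq : 1 ≤ q) (hf : HasDecomposition p q σ f)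
    (hg : HasDecomposition p q σ g) : HasDecomposition p q σ fun x => f x + g x := by
  obtain ⟨hfm, hfp, F, hF, hFa⟩ := hf
  obtain ⟨hgm, hgp, G, hG, hGa⟩ := hg
  exact ⟨hfm.add hgm, hfp.add hgp, _, hF.add hp hq hG, hFa.add hp hF.smooth hG.smooth
    hfm.aestronglyMeasurable hgm.aestronglyMeasurable hGa⟩

theorem HasDecomposition.zero : HasDecomposition p q σ fun _ : E => (0 : ℂ) :=
  ⟨stronglyMeasurable_const, MemLp.zero', _, .zero, by simp [Approximates, supNorm_zero]⟩

variable (h : IsMollifier {A} D η) (h' : IsMollifier {univ} D η)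
include h h'

/-- The product theorem near a point `x` at which `Ω` coincides with a set `A` that is stable
under the displacements of a mollifier. -/
theorem IsMollifier.exists_local_product (hp : 1 ≤ p) (hpt : p ≠ ⊤) (hq : 1 ≤ q) (hs : 1 < s)
    (hu : StronglyMeasurable u) (hup : MemLp u p volume) (hv : StronglyMeasurable v)
    (hvp : MemLp v p volume) (hw : StronglyMeasurable w) (hwp : MemLp w p volume)
    (hF : IsDecomposition {univ} p q s F) (hFa : Approximates {univ} p F u)
    (hG : IsDecomposition {univ} p q s G) (hGa : Approximates {univ} p G v) {e : E}
    (hwa : Approximates {univ} p (fun k x => fderiv ℝ (G k) x e) w) {x : E} {r M : ℝ} (hr : 0 < r)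
    (hA : A ∩ Metric.ball x (2 * r) = Ω ∩ Metric.ball x (2 * r))
    (hub : ∀ᵐ y, y ∈ Ω → ‖u y‖ ≤ M) (hvb : ∀ᵐ y, y ∈ Ω → ‖v y‖ ≤ M) :
    ∃ g, HasDecomposition p q (s - 1) g ∧
      ∀ᵐ y, y ∈ Ω ∩ Metric.ball x r → g y = u y * w y := by
  obtain ⟨χ, hχ, hχ1, hχ0⟩ := exists_bump x hr
  obtain ⟨L, hL⟩ := exists_nat_gt s
  have hAm : MeasurableSet A := h.adm.meas A rfl
  -- The bound on `u` is known only on `Ω`, but `χ` vanishes off the ball on which `A` and `Ω`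
  -- agree, so `χ u` is bounded on all of `A`.
  have hbd : ∀ {u : E → ℂ}, (∀ᵐ y, y ∈ Ω → ‖u y‖ ≤ M) →
      supNorm {A} ⊤ (fun y => χ y * u y) ≠ ⊤ := by
    intro u hub
    obtain ⟨C, hC⟩ := hχ.norm_le
    have hC0 : 0 ≤ C := (norm_nonneg _).trans (hC 0)
    rw [supNorm_singleton, eLpNorm_exponent_top]
    refine (eLpNormEssSup_lt_top_of_ae_bound (C := C * |M|) ?_).ne
    rw [ae_restrict_iff' hAm]
    filter_upwards [hub] with y hy hyA
    by_cases hyb : y ∈ Metric.ball x (2 * r)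
    · rw [norm_mul]
      exact mul_le_mul (hC y) ((hy (hA.subset ⟨hyA, hyb⟩).1).trans (le_abs_self M)) (norm_nonneg _)
        hC0
    · rw [hχ0 y hyb, zero_mul, norm_zero]
      positivity
  have hdom : ∀ {u : E → ℂ}, StronglyMeasurable u → MemLp u p volume →
      IsDominated fun y => χ y * u y := fun hu hup =>
    .of_memLp (hχ.1.continuous.stronglyMeasurable.mul hu) hp hpt (hχ.memLp_mul hup)
  have hle : ∀ B ∈ ({A} : Set (Set E)), ∃ B' ∈ ({univ} : Set (Set E)), B ⊆ B' := by simp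
  have hχ' := hχ.fderiv_apply e
  -- By the product rule this is the weak derivative of `χ v`, so it is the limit of the
  -- differentiated pieces of `χ v`.
  set w' : E → ℂ := fun y => fderiv ℝ χ y e * v y + χ y * w y
  have hw'm : StronglyMeasurable w' := (hχ'.1.continuous.stronglyMeasurable.mul hv).add
    (hχ.1.continuous.stronglyMeasurable.mul hw)
  have hw'p : MemLp w' p volume := (hχ'.memLp_mul hvp).add (hχ.memLp_mul hwp)
  have hw'a : Approximates {univ} p (fun k x => fderiv ℝ (fun y => χ y * G k y) x e) w' := by
    have h1 := (hGa.mul_left hχ' hG.smooth hv.aestronglyMeasurable).add hp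
      (fun k => hχ'.mul (hG.smooth k)) (fun k => hχ.mul ((hG.smooth k).fderiv_apply e))
      (hχ'.1.continuous.aestronglyMeasurable.mul hv.aestronglyMeasurable)
      (hχ.1.continuous.aestronglyMeasurable.mul hw.aestronglyMeasurable)
      (hwa.mul_left hχ (fun k => (hG.smooth k).fderiv_apply e) hw.aestronglyMeasurable)
    simp only [fderiv_mul_apply hχ (hG.smooth _)]
    exact h1
  have hF' := (hF.mul_left hp hχ).mono_family hle
  have hFa' := (hFa.mul_left hχ hF.smooth hu.aestronglyMeasurable).mono_family hle
  have hG' := (hG.mul_left hp hχ).mono_family hle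
  have hGa' := (hGa.mul_left hχ hG.smooth hv.aestronglyMeasurable).mono_family hle
  have hP := h.isDecomposition_productPiece hp hq (by linarith) hL (hdom hu hup) (hdom hv hvp)
    (hbd hub) (hbd hvb) hF' hFa' hG' hGa' e
  have hPa := h.approximates_productPiece hp hq hs hL (hdom hu hup) (hdom hv hvp)
    (hbd hub) (hbd hvb) hF' hFa' hG' hGa' e hw'm.aestronglyMeasurable (hw'a.mono_family hle)
  set f₀ : E → ℂ := fun y => χ y * u y * w' y
  have hfm : StronglyMeasurable (A.indicator f₀) :=
    ((hχ.1.continuous.stronglyMeasurable.mul hu).mul hw'm).indicator hAm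
  have hfp : MemLp (A.indicator f₀) p volume := by
    refine ⟨hfm.aestronglyMeasurable, ?_⟩
    rw [eLpNorm_indicator_eq_eLpNorm_restrict hAm, ← supNorm_singleton]
    refine (supNorm_mul_le hw'm.aestronglyMeasurable).trans_lt
      (ENNReal.mul_lt_top (hbd hub).lt_top ?_)
    rw [supNorm_singleton]
    exact hw'p.restrict A |>.2
  have hPa' : Approximates {A} p (productPiece η L e (fun y => χ y * u y) fun y => χ y * v y)
      (A.indicator f₀) := by
    refine hPa.congr fun K => ?_
    rw [supNorm_singleton, supNorm_singleton]
    refine eLpNorm_congr_ae ((ae_restrict_iff' hAm).2 (ae_of_all _ fun y hy => ?_))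
    simp only [indicator_of_mem hy, f₀]
  obtain ⟨H, g, hH, hgm, hgp, hga, hgA⟩ := h.exists_extension h' hp hpt hq (by linarith)
    (.of_memLp hfm hp hpt hfp) hP hPa'
  refine ⟨g, ⟨hgm, hgp, H, hH, hga⟩, ?_⟩
  filter_upwards [(ae_restrict_iff' hAm).1 hgA] with y hy hyΩ
  have hyb : y ∈ Metric.ball x (2 * r) := Metric.ball_subset_ball (by linarith) hyΩ.2
  have hyA : y ∈ A := (hA.superset ⟨hyΩ.1, hyb⟩).1
  -- On the inner ball `χ` is locally one, so the localised product reduces to `u w`.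
  have h0 : fderiv ℝ χ y = 0 := by
    have : χ =ᶠ[𝓝 y] fun _ => 1 := by
      filter_upwards [Metric.isOpen_ball.mem_nhds hyΩ.2] with z hz using hχ1 z hz
    rw [this.fderiv_eq]; simp
  rw [hy hyA, indicator_of_mem hyA]
  simp only [f₀, w', h0, hχ1 y hyΩ.2, zero_apply]
  ring

end LocalProduct

/-! ### Weak derivatives as limits of differentiated decompositions. -/

section WeakDerivative

variable {E : Type} [NormedAddCommGroup E] [InnerProductSpace ℝ E] [FiniteDimensional ℝ E]
  [MeasurableSpace E] [BorelSpace E] {p : ℝ≥0∞} {G : ℕ → E → ℂ} {v w : E → ℂ}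

theorem IsBddSmooth.integral_fderiv_mul {g : E → ℂ} (hg : IsBddSmooth g) (ψ : 𝓢(E, ℂ)) (e : E) :
    ∫ x, _root_.fderiv ℝ ψ x e * g x = -∫ x, ψ x * _root_.fderiv ℝ g x e := by
  have hb : ∀ {g : E → ℂ}, IsBddSmooth g → ∀ ψ : 𝓢(E, ℂ), Integrable fun x => ψ x * g x := by
    intro g hg ψ
    obtain ⟨C, hC⟩ := hg.norm_le
    exact ψ.integrable.mul_bdd hg.1.continuous.aestronglyMeasurable (ae_of_all _ hC)
  rw [integral_mul_fderiv_eq_neg_fderiv_mul_of_integrable (f := ψ) (g := g) (v := e)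
    (hb hg (∂_{e} ψ)) (hb (hg.fderiv_apply e) ψ) (hb hg ψ) (fun x _ => ψ.differentiableAt)
    (fun x _ => hg.differentiable x), neg_neg]

theorem toTemperedDistribution_toLp_apply [Fact (1 ≤ p)] {f : E → ℂ} (hf : MemLp f p volume)
    (ψ : 𝓢(E, ℂ)) : Lp.toTemperedDistribution (hf.toLp f) ψ = ∫ x, ψ x * f x := by
  rw [Lp.toTemperedDistribution_apply]
  refine integral_congr_ae ?_
  filter_upwards [hf.coeFn_toLp] with x hx
  rw [hx, smul_eq_mul]

theorem tendsto_sum_integral_mul [Fact (1 ≤ p)] (hGp : ∀ k, MemLp (G k) p volume)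
    (hv : MemLp v p volume) (happ : Approximates {univ} p G v) (ψ : 𝓢(E, ℂ)) :
    Tendsto (fun K => ∑ k ∈ Finset.range K, ∫ x, ψ x * G k x) atTop (𝓝 (∫ x, ψ x * v x)) := by
  have h1 := (approximates_univ_iff hGp hv).1 happ
  have h2 := (PointwiseConvergenceCLM.tendsto_iff_forall_tendsto.1
    (((Lp.toTemperedDistributionCLM ℂ (volume : Measure E) p).continuous.tendsto _).comp h1)) ψ
  rw [Lp.toTemperedDistributionCLM_apply, toTemperedDistribution_toLp_apply] at h2
  refine h2.congr fun K => ?_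
  simp only [Function.comp, map_sum, Lp.toTemperedDistributionCLM_apply]
  rw [sum_apply]
  simp only [toTemperedDistribution_toLp_apply]

/-- Approximation of a function and of its derivatives gives a weak derivative. -/
theorem integral_fderiv_mul_of_approximates [Fact (1 ≤ p)] (hGs : ∀ k, IsBddSmooth (G k)) {e : E}
    (hGp : ∀ k, MemLp (G k) p volume) (hGp' : ∀ k, MemLp (fun x => fderiv ℝ (G k) x e) p volume)
    (hv : MemLp v p volume) (hw : MemLp w p volume) (happ : Approximates {univ} p G v)
    (happ' : Approximates {univ} p (fun k x => fderiv ℝ (G k) x e) w) (ψ : 𝓢(E, ℂ)) :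
    ∫ x, fderiv ℝ ψ x e * v x = -∫ x, ψ x * w x := by
  refine tendsto_nhds_unique (tendsto_sum_integral_mul hGp hv happ (∂_{e} ψ)) ?_
  refine (tendsto_sum_integral_mul hGp' hw happ' ψ).neg.congr fun K => ?_
  rw [← Finset.sum_neg_distrib]
  refine Finset.sum_congr rfl fun k _ => ?_
  rw [← (hGs k).integral_fderiv_mul ψ e]
  rfl

end WeakDerivative

/-! ### Bounded domains: from local to global products. -/

section Domain

variable {n : ℕ} (Φ : DyadicPartition n) {p q : ℝ≥0∞} {s : ℝ}

local notation "𝔼" => EuclideanSpace ℝ (Fin n)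

theorem toDistribution_apply {Ω : Opens 𝔼} {f : 𝔼 → ℂ} (hf : LocallyIntegrableOn f Ω volume)
    (ψ : 𝓓(Ω, ℝ)) : toDistribution Ω f ψ = ∫ x, (ψ x : ℂ) * f x := by
  refine (TestFunction.integralAgainstBilinCLM_eq_integral hf).trans ?_
  simp

theorem locallyIntegrableOn_of_memLp {Ω : Opens 𝔼} {f : 𝔼 → ℂ} (hp : 1 ≤ p)
    (hf : MemLp f p (volume.restrict Ω)) : LocallyIntegrableOn f Ω volume :=
  locallyIntegrableOn_of_locallyIntegrable_restrict (hf.locallyIntegrable hp)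

theorem ae_eq_of_toDistribution_eq [Fact (1 ≤ p)] {Ω : Opens 𝔼} {u f : 𝔼 → ℂ}
    (hu : LocallyIntegrableOn u Ω volume) (hf : MemLp f p volume)
    (h : ∀ ψ : 𝓓(Ω, ℝ), toDistribution Ω u ψ =
      Lp.toTemperedDistribution (hf.toLp f) (testToSchwartz ψ)) :
    ∀ᵐ x, x ∈ (Ω : Set 𝔼) → u x = f x := by
  have hf' : LocallyIntegrableOn f Ω volume :=
    locallyIntegrableOn_of_memLp (Fact.out : 1 ≤ p) (hf.restrict _)
  have h0 := Ω.2.ae_eq_zero_of_integral_contDiff_smul_eq_zero (μ := volume) (hu.sub hf')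
    fun g hg hgc hgs => by
      let ψ : 𝓓(Ω, ℝ) := ⟨g, hg, hgc, hgs⟩
      have h1 : ∫ x, g x • u x = ∫ x, g x • f x := by
        have h2 := h ψ
        rw [toDistribution_apply hu, toTemperedDistribution_toLp_apply] at h2
        simpa [testToSchwartz, ψ] using h2
      have hi : ∀ {f : 𝔼 → ℂ}, LocallyIntegrableOn f Ω volume → Integrable fun x => g x • f x :=
        fun hf => TestFunction.integrable_bilin (ContinuousLinearMap.lsmul ℝ ℝ) hf ψ
      simp only [Pi.sub_apply, smul_sub]
      rw [integral_sub (hi hu) (hi hf'), h1, sub_self]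
  filter_upwards [h0] with x hx hxΩ
  exact sub_eq_zero.1 (hx hxΩ)

theorem integral_test_mul_congr {Ω : Opens 𝔼} {f g : 𝔼 → ℂ}
    (h : ∀ᵐ x, x ∈ (Ω : Set 𝔼) → f x = g x) {ψ : 𝔼 → ℂ} (hψ : ∀ x ∉ (Ω : Set 𝔼), ψ x = 0) :
    ∫ x, ψ x * f x = ∫ x, ψ x * g x := by
  refine integral_congr_ae ?_
  filter_upwards [h] with x hx
  by_cases hxΩ : x ∈ (Ω : Set 𝔼)
  · rw [hx hxΩ]
  · rw [hψ x hxΩ, zero_mul, zero_mul]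

theorem test_eq_zero {Ω : Opens 𝔼} (ψ : 𝓓(Ω, ℝ)) {x : 𝔼} (hx : x ∉ (Ω : Set 𝔼)) : ψ x = 0 :=
  image_eq_zero_of_notMem_tsupport fun h => hx (ψ.tsupport_subset h)

/-- Near `x`, the set `Ω` coincides with a set that is stable under the displacements of a
mollifier. -/
def HasLocalMollifier (Ω : Set 𝔼) (x : 𝔼) : Prop :=
  ∃ r > 0, ∃ (A D : Set 𝔼) (η : 𝓢(𝔼, ℂ)), IsMollifier {A} D η ∧ IsMollifier {univ} D η ∧
    A ∩ Metric.ball x (2 * r) = Ω ∩ Metric.ball x (2 * r)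

/-- A finite subcover of the closure is processed one ball at a time instead of by a partition of
unity: the cutoff `θ` of the region already treated is replaced by `χ + (1 - χ) θ`, which equals one
wherever `χ` or `θ` does. The local identity is needed on the double ball because that is where `χ`
may be nonzero. -/
theorem exists_global_of_local {Ω : Opens 𝔼} (hp : 1 ≤ p) (hq : 1 ≤ q)
    (hΩ : Bornology.IsBounded (Ω : Set 𝔼)) {f : 𝔼 → ℂ}
    (hloc : ∀ x ∈ closure (Ω : Set 𝔼), ∃ r > 0, ∃ g, HasDecomposition p q s g ∧
      ∀ᵐ y, y ∈ (Ω : Set 𝔼) ∩ Metric.ball x (2 * r) → g y = f y) :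
    ∃ g, HasDecomposition p q s g ∧ ∀ᵐ y, y ∈ (Ω : Set 𝔼) → g y = f y := by
  choose! r hr g hg hgf using hloc
  obtain ⟨t, ht, hcov⟩ := hΩ.isCompact_closure.elim_nhds_subcover (fun x => Metric.ball x (r x))
    fun x hx => Metric.ball_mem_nhds x (hr x hx)
  have key : ∀ t : Finset 𝔼, (∀ x ∈ t, x ∈ closure (Ω : Set 𝔼)) → ∃ (θ G : 𝔼 → ℂ),
      HasDecomposition p q s G ∧ (∀ᵐ y, y ∈ (Ω : Set 𝔼) → G y = θ y * f y) ∧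
      ∀ x ∈ t, ∀ y ∈ Metric.ball x (r x), θ y = 1 := by
    classical
    intro t
    induction t using Finset.induction_on with
    | empty => exact fun _ => ⟨fun _ => 0, fun _ => 0, .zero, by simp, by simp⟩
    | insert x t hx ih =>
      intro ht
      obtain ⟨θ, G, hG, hGf, hθ⟩ := ih fun y hy => ht y (Finset.mem_insert_of_mem hy)
      have hx' := ht x (Finset.mem_insert_self x t)
      obtain ⟨χ, hχ, hχ1, hχ0⟩ := exists_bump x (hr x hx')
      have hχ' : IsBddSmooth fun y => 1 - χ y :=
        IsBddSmooth.sub ⟨contDiff_const, fun m => by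
          cases m with
          | zero => exact ⟨1, fun x => by simp⟩
          | succ m => exact ⟨0, fun x => by
              rw [iteratedFDeriv_const_of_ne (Nat.succ_ne_zero m)]; simp⟩⟩ hχ
      refine ⟨fun y => χ y + (1 - χ y) * θ y, fun y => χ y * g x y + (1 - χ y) * G y,
        ((hg x hx').mul_left hp hχ).add hp hq (hG.mul_left hp hχ'), ?_, ?_⟩
      · filter_upwards [hGf, hgf x hx'] with y h1 h2 hy
        rw [h1 hy]
        by_cases hyb : y ∈ Metric.ball x (2 * r x)
        · rw [h2 ⟨hy, hyb⟩]; ring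
        · rw [hχ0 y hyb]; ring
      · intro z hz y hy
        rcases Finset.mem_insert.1 hz with rfl | hz
        · simp only [hχ1 y hy]; ring
        · simp only [hθ z hz y hy]; ring
  obtain ⟨θ, G, hG, hGf, hθ⟩ := key t ht
  refine ⟨G, hG, ?_⟩
  filter_upwards [hGf] with y hy hyΩ
  obtain ⟨x, hx, hyx⟩ := mem_iUnion₂.1 (hcov (subset_closure hyΩ))
  rw [hy hyΩ, hθ x hx y hyx, one_mul]

theorem exists_ae_bound_of_memLp_top {Ω : Opens 𝔼} {u : 𝔼 → ℂ} (hu : MemLp u ⊤ (volume.restrict Ω)) :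
    ∃ M : ℝ, ∀ᵐ y, y ∈ (Ω : Set 𝔼) → ‖u y‖ ≤ M := by
  refine ⟨(eLpNorm u ⊤ (volume.restrict Ω)).toReal, ?_⟩
  have h1 := ae_le_eLpNormEssSup (f := u) (μ := volume.restrict Ω)
  replace h1 := (ae_restrict_iff' Ω.isOpen.measurableSet).1 h1
  filter_upwards [h1] with y hy hyΩ
  rw [← toReal_enorm]
  exact ENNReal.toReal_mono hu.2.ne (hy hyΩ)

/-- The extensions `u'` and `v'` to `ℝⁿ` are decomposable but possibly unbounded outside `Ω`, so
their product cannot be treated globally. The local products use their values only where the bounds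
on `u` and `v` apply, and it is the extensions of these products that are patched. -/
theorem memBesovOn_mul_weak_deriv [Fact (1 ≤ p)] (hpt : p ≠ ⊤) (hq : 1 ≤ q) (hs : 1 < s)
    {Ω : Opens 𝔼} (hΩ : Bornology.IsBounded (Ω : Set 𝔼))
    (hloc : ∀ x ∈ closure (Ω : Set 𝔼), HasLocalMollifier (Ω : Set 𝔼) x) {u v : 𝔼 → ℂ}
    (hu : MemLp u ⊤ (volume.restrict Ω)) (hv : MemLp v ⊤ (volume.restrict Ω))
    (huB : MemBesovOn Φ s p q Ω (toDistribution Ω u))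
    (hvB : MemBesovOn Φ s p q Ω (toDistribution Ω v)) (e : 𝔼) :
    ∃ w : 𝔼 → ℂ, MemLp w p (volume.restrict Ω) ∧
      ∂_{e} (toDistribution Ω v) = toDistribution Ω w ∧
      MemBesovOn Φ (s - 1) p q Ω (toDistribution Ω fun x => u x * w x) := by
  have hp : 1 ≤ p := Fact.out
  have hs0 : 0 < s := by linarith
  obtain ⟨gu, hgu, hguu⟩ := huB
  obtain ⟨F, u', hu'p, hu'm, hF, hFa, rfl⟩ := hgu.exists_decomposition Φ hpt hq hs0
  obtain ⟨gv, hgv, hgvv⟩ := hvB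
  obtain ⟨G, v', hv'p, hv'm, hG, hGa, rfl⟩ := hgv.exists_decomposition Φ hpt hq hs0
  have huL := locallyIntegrableOn_of_memLp le_top hu
  have hvL := locallyIntegrableOn_of_memLp le_top hv
  have huu' := ae_eq_of_toDistribution_eq huL hu'p hguu
  have hvv' := ae_eq_of_toDistribution_eq hvL hv'p hgvv
  have hG' := hG.fderiv_apply e
  -- The differentiated pieces of `v'` form a decomposition of smoothness `s - 1 > 0`, so their
  -- series converges in `Lᵖ`; its sum is the weak derivative.
  obtain ⟨w, hwm, hwp, hwa⟩ := hG'.exists_limit hp hq (by linarith)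
  have hwL := locallyIntegrableOn_of_memLp hp (hwp.restrict Ω)
  obtain ⟨M₁, hM₁⟩ := exists_ae_bound_of_memLp_top hu
  obtain ⟨M₂, hM₂⟩ := exists_ae_bound_of_memLp_top hv
  obtain ⟨g, ⟨hgm, hgp, H, hH, hga⟩, hgf⟩ := exists_global_of_local (Ω := Ω) (p := p) (q := q)
    (s := s - 1) hp hq hΩ (f := fun y => u' y * w y) fun x hx => by
      obtain ⟨r, hr, A, D, η, h, h', hA⟩ := hloc x hx
      -- The local product is identified on the ball of radius `r`, which must be the double of the
      -- ball used for patching.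
      refine ⟨r / 2, by positivity, ?_⟩
      rw [mul_div_cancel₀ r two_ne_zero]
      refine h.exists_local_product h' hp hpt hq hs hu'm hu'p hv'm hv'p hwm hwp hF hFa hG hGa hwa
        (M := max M₁ M₂) hr hA ?_ ?_
      · filter_upwards [huu', hM₁] with y h1 h2 hy
        rw [← h1 hy]; exact (h2 hy).trans (le_max_left _ _)
      · filter_upwards [hvv', hM₂] with y h1 h2 hy
        rw [← h1 hy]; exact (h2 hy).trans (le_max_right _ _)
  have hgu : ∀ᵐ y, y ∈ (Ω : Set 𝔼) → u y * w y = g y := by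
    filter_upwards [hgf, huu'] with y h1 h2 hy
    rw [h1 hy, h2 hy]
  refine ⟨w, hwp.restrict _, ?_, Lp.toTemperedDistribution (hgp.toLp g),
    hH.memBesov Φ hpt hq (by linarith) hgm hgp hga, fun ψ => ?_⟩
  · ext ψ
    rw [Distribution.lineDerivOp_apply_apply, map_neg, toDistribution_apply hvL,
      toDistribution_apply hwL]
    have hψ : ∀ x, (((∂_{e} ψ) x : ℝ) : ℂ) = fderiv ℝ (testToSchwartz ψ) x e := fun x => by
      have h1 : (testToSchwartz ψ : 𝔼 → ℂ) = fun x => Complex.ofRealCLM (ψ x) := rfl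
      have h2 : (∂_{e} ψ) x = lineDeriv ℝ ψ x e :=
        TestFunction.lineDerivCLM_apply_of_le (by simp)
      have h3 : DifferentiableAt ℝ ψ x := ψ.contDiff.differentiable (by simp) x
      rw [h1, h2, h3.lineDeriv_eq_fderiv,
        fderiv_fun_comp x (Complex.ofRealCLM.differentiableAt) h3]
      simp
    simp only [hψ]
    rw [integral_test_mul_congr hvv' fun x hx => by
        rw [← hψ, test_eq_zero (∂_{e} ψ) hx, Complex.ofReal_zero],
      integral_fderiv_mul_of_approximates hG.smooth (hG.memLp hq) (hG'.memLp hq) hv'p hwp hGa hwa,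
      neg_neg]
    rfl
  · have hL : LocallyIntegrableOn (fun x => u x * w x) Ω volume := by
      refine locallyIntegrableOn_of_memLp hp ((hgp.restrict Ω).ae_eq ?_)
      exact EventuallyEq.symm ((ae_restrict_iff' Ω.isOpen.measurableSet).2 hgu)
    rw [toDistribution_apply hL, toTemperedDistribution_toLp_apply,
      integral_test_mul_congr hgu fun x hx => by rw [test_eq_zero ψ hx, Complex.ofReal_zero]]
    rfl

end Domain

/-! ### Inner cones at points of smooth domains and of the cube. -/

section Cones

variable {n : ℕ}

local notation "𝔼" => EuclideanSpace ℝ (Fin n)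

/-- Moving from a point of `Ω` near `x` in a direction close to `e` does not leave `Ω`. -/
def HasInnerCone (Ω : Set 𝔼) (x : 𝔼) : Prop :=
  ∃ (e : 𝔼) (c δ : ℝ), 0 < c ∧ 0 < δ ∧ ∀ y ∈ Ω ∩ Metric.ball x δ, ∀ k ∈ Metric.closedBall e c,
    ∀ t : ℝ, 0 ≤ t → y + t • k ∈ Metric.ball x δ → y + t • k ∈ Ω

theorem exists_kernel_supported_in_ball (e : 𝔼) {c : ℝ} (hc : 0 < c) :
    ∃ η : 𝓢(𝔼, ℂ), (∀ y, η y ≠ 0 → y ∈ Metric.ball e c) ∧ ∫ y, η y = 1 := by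
  let b : ContDiffBump e := ⟨c / 2, c, by positivity, by linarith⟩
  refine ⟨HasCompactSupport.toSchwartzMap (f := fun y => ((b.normed volume y : ℝ) : ℂ))
    (b.hasCompactSupport_normed.comp_left (g := fun t : ℝ => (t : ℂ)) Complex.ofReal_zero)
    (Complex.ofRealCLM.contDiff.comp b.contDiff_normed), fun y hy => ?_, ?_⟩
  · have h1 : ((b.normed volume y : ℝ) : ℂ) ≠ 0 := hy
    have h2 : y ∈ Function.support (b.normed volume) := fun h => h1 (by rw [h, Complex.ofReal_zero])
    rwa [b.support_normed_eq] at h2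
  · change ∫ y, ((b.normed volume y : ℝ) : ℂ) = 1
    rw [integral_complex_ofReal, b.integral_normed, Complex.ofReal_one]

/-- Convexity of the ball: two successive moves in directions from the ball amount to a single move
of the total duration in such a direction. -/
theorem exists_combination {e k k' : 𝔼} {c t t' : ℝ} (hk : k ∈ Metric.closedBall e c)
    (hk' : k' ∈ Metric.closedBall e c) (ht : 0 ≤ t) (ht' : 0 ≤ t') :
    ∃ k'' ∈ Metric.closedBall e c, t • k + t' • k' = (t + t') • k'' := by
  rcases (add_nonneg ht ht').eq_or_lt with h0 | h0
  · obtain rfl : t = 0 := by linarith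
    obtain rfl : t' = 0 := by linarith
    exact ⟨k, hk, by simp⟩
  · refine ⟨(t / (t + t')) • k + (t' / (t + t')) • k', convex_closedBall e c hk hk'
      (by positivity) (by positivity) (by field_simp), ?_⟩
    rw [smul_add, smul_smul, smul_smul, mul_div_cancel₀ _ h0.ne', mul_div_cancel₀ _ h0.ne']

/-- `A` is the region swept out from `Ω` near `x` by the cone of directions close to `e`. The cone
is convex, so `A` is stable under further moves, and the inner cone condition says exactly that
within the ball the sweeping adds nothing to `Ω`. `D` is the reflected cone, truncated, since
convolution looks at `x - y`. -/
theorem HasInnerCone.hasLocalMollifier {Ω : Set 𝔼} (hΩ : IsOpen Ω) {x : 𝔼}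
    (h : HasInnerCone Ω x) : HasLocalMollifier Ω x := by
  obtain ⟨e, c, δ, hc, hδ, hcone⟩ := h
  set D : Set 𝔼 := (fun z : ℝ × 𝔼 => -(z.1 • z.2)) '' (Icc 0 1 ×ˢ Metric.closedBall e c)
  set A : Set 𝔼 := ⋃ z ∈ Ici (0 : ℝ) ×ˢ Metric.closedBall e c,
    (fun y => y - z.1 • z.2) ⁻¹' (Ω ∩ Metric.ball x δ)
  have hA : IsOpen A := isOpen_biUnion fun z _ =>
    (hΩ.inter Metric.isOpen_ball).preimage (by fun_prop)
  have hD : IsClosed D := ((isCompact_Icc.prod (isCompact_closedBall e c)).image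
    (by fun_prop)).isClosed
  -- The kernel is centred at `-e`, inside the end `τ = 1` of the truncated cone `D`.
  obtain ⟨η, hη, hη1⟩ := exists_kernel_supported_in_ball (-e) hc
  have hηD : ∀ y, η y ≠ 0 → y ∈ D := fun y hy => by
    refine ⟨(1, -y), ⟨⟨zero_le_one, le_rfl⟩, ?_⟩, by simp⟩
    have := Metric.ball_subset_closedBall (hη y hy)
    rw [mem_closedBall_iff_norm] at this ⊢
    rwa [show (1, -y).2 - e = -(y - -e) by simp only [sub_neg_eq_add, neg_add]; abel, norm_neg]
  have hDs : ∀ y ∈ D, ∀ t ∈ Icc (0 : ℝ) 1, t • y ∈ D := by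
    rintro _ ⟨⟨τ, k⟩, ⟨hτ, hk⟩, rfl⟩ t ht
    exact ⟨(t * τ, k), ⟨⟨mul_nonneg ht.1 hτ.1, mul_le_one₀ ht.2 hτ.1 hτ.2⟩, hk⟩, by
      simp only [smul_neg, mul_smul]⟩
  refine ⟨δ / 2, by positivity, A, D, η, ⟨⟨by simpa using hA.measurableSet, ?_, hDs⟩, hD, hηD, hη1⟩,
    ⟨⟨by simp, by simp, hDs⟩, hD, hηD, hη1⟩, ?_⟩
  · rintro _ ⟨⟨τ, k⟩, ⟨hτ, hk⟩, rfl⟩ A' rfl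
    refine ⟨_, rfl, fun y hy => ?_⟩
    simp only [A, mem_iUnion] at hy ⊢
    obtain ⟨⟨t, k'⟩, ⟨ht, hk'⟩, hy⟩ := hy
    obtain ⟨k'', hk'', heq⟩ := exists_combination hk' hk ht hτ.1
    refine ⟨(t + τ, k''), ⟨add_nonneg ht hτ.1, hk''⟩, ?_⟩
    rw [mem_preimage] at hy ⊢
    dsimp only at hy ⊢
    rw [← heq]
    convert hy using 1
    abel
  · rw [mul_div_cancel₀ δ two_ne_zero]
    ext y
    refine and_congr_left fun hy => ⟨fun hyA => ?_, fun hyΩ => ?_⟩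
    · simp only [A, mem_iUnion] at hyA
      obtain ⟨⟨t, k⟩, ⟨ht, hk⟩, hyA⟩ := hyA
      have h1 : y - t • k + t • k = y := sub_add_cancel _ _
      have := hcone _ hyA k hk t ht (by rw [h1]; exact hy)
      rwa [h1] at this
    · refine mem_biUnion (x := (0, e)) ⟨mem_Ici.2 le_rfl, Metric.mem_closedBall_self hc.le⟩ ?_
      simpa using ⟨hyΩ, hy⟩

theorem hasInnerCone_of_mem {Ω : Set 𝔼} (hΩ : IsOpen Ω) {x : 𝔼} (hx : x ∈ Ω) :
    HasInnerCone Ω x := by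
  obtain ⟨δ, hδ, hsub⟩ := Metric.isOpen_iff.1 hΩ x hx
  exact ⟨0, 1, δ, one_pos, hδ, fun _ _ _ _ _ _ h => hsub h⟩

/-- Each coordinate is pushed away from the face nearer to `x`. A ball of radius `1/2` about `x`
cannot reach the opposite face from the side of `x`, so faces, edges and corners are all covered at
once. -/
theorem hasInnerCone_unitCube (x : 𝔼) : HasInnerCone (unitCube n : Set 𝔼) x := by
  refine ⟨WithLp.toLp 2 fun i => if x i ≤ 1 / 2 then 1 else -1, 1 / 2, 1 / 2, by norm_num,
    by norm_num, fun y hy k hk t ht hz i => ?_⟩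
  have h1 := hy.1 i
  have h2 : |k i - if x i ≤ 1 / 2 then 1 else -1| ≤ 1 / 2 := by
    rw [mem_closedBall_iff_norm] at hk
    exact (PiLp.norm_apply_le (k - WithLp.toLp 2 fun i => if x i ≤ 1 / 2 then (1 : ℝ) else -1)
      i).trans hk
  have h3 : |y i + t * k i - x i| < 1 / 2 := by
    rw [mem_ball_iff_norm] at hz
    exact (PiLp.norm_apply_le (y + t • k - x) i).trans_lt hz
  rw [abs_le] at h2
  rw [abs_lt] at h3
  change 0 < y i + t * k i ∧ y i + t * k i < 1
  obtain ⟨h4, h5⟩ : 0 < y i ∧ y i < 1 := h1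
  split_ifs at h2 with h
  · constructor <;> nlinarith
  · constructor <;> nlinarith

/-- A direction `e` with `dρ_x(e) > 0` exists since the differential is nonzero. By continuity `ρ`
increases along all directions near `e` near `x`, so positivity of `ρ` persists along such moves. -/
theorem hasInnerCone_of_smooth {Ω U : Set 𝔼} {x : 𝔼} (hU : U ∈ 𝓝 x) {ρ : 𝔼 → ℝ}
    (hρ : ContDiff ℝ ∞ ρ) (hx : fderiv ℝ ρ x ≠ 0) (hΩ : ∀ y ∈ U, (y ∈ Ω ↔ 0 < ρ y)) :
    HasInnerCone Ω x := by
  obtain ⟨e, he⟩ : ∃ e, 0 < fderiv ℝ ρ x e := by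
    obtain ⟨e, he⟩ := DFunLike.ne_iff.1 hx
    rcases lt_or_gt_of_ne he with h | h
    · exact ⟨-e, by rw [map_neg]; simpa using h⟩
    · exact ⟨e, by simpa using h⟩
  have hcont : Continuous fun z : 𝔼 × 𝔼 => fderiv ℝ ρ z.1 z.2 :=
    ((hρ.continuous_fderiv (by simp)).comp continuous_fst).clm_apply continuous_snd
  have hev : ∀ᶠ z in 𝓝 (x, e), 0 < fderiv ℝ ρ z.1 z.2 :=
    hcont.continuousAt.eventually (lt_mem_nhds he)
  obtain ⟨δ₁, hδ₁, h₁⟩ := Metric.eventually_nhds_iff_ball.1 hev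
  obtain ⟨δ₂, hδ₂, h₂⟩ := Metric.mem_nhds_iff.1 hU
  set δ := min δ₁ δ₂
  refine ⟨e, δ₁ / 2, δ, by positivity, lt_min hδ₁ hδ₂, fun y hy k hk t ht hz => ?_⟩
  have hδU : Metric.ball x δ ⊆ U := (Metric.ball_subset_ball (min_le_right _ _)).trans h₂
  have hseg : ∀ τ ∈ Icc (0 : ℝ) t, y + τ • k ∈ Metric.ball x δ := by
    intro τ hτ
    have h3 := (convex_ball x δ).segment_subset hy.2 hz
    refine h3 ?_
    rcases ht.eq_or_lt with rfl | ht
    · obtain rfl : τ = 0 := le_antisymm hτ.2 hτ.1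
      simp
    · rw [segment_eq_image']
      refine ⟨τ / t, ⟨div_nonneg hτ.1 ht.le, (div_le_one ht).2 hτ.2⟩, ?_⟩
      simp only [add_sub_cancel_left, smul_smul]
      rw [div_mul_cancel₀ _ ht.ne']
  have hder : ∀ τ, HasDerivAt (fun τ : ℝ => ρ (y + τ • k)) (fderiv ℝ ρ (y + τ • k) k) τ := by
    intro τ
    have h3 : HasDerivAt (fun τ : ℝ => y + τ • k) k τ := by
      simpa using ((hasDerivAt_id τ).smul_const k).const_add y
    exact ((hρ.differentiable (by simp) _).hasFDerivAt).comp_hasDerivAt τ h3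
  have hmono : MonotoneOn (fun τ : ℝ => ρ (y + τ • k)) (Icc 0 t) := by
    refine monotoneOn_of_deriv_nonneg (convex_Icc 0 t)
      (fun τ _ => (hder τ).continuousAt.continuousWithinAt)
      (fun τ _ => (hder τ).differentiableAt.differentiableWithinAt) fun τ hτ => ?_
    rw [(hder τ).deriv]
    refine (h₁ (y + τ • k, k) ?_).le
    rw [Metric.mem_ball, Prod.dist_eq]
    refine max_lt ((hseg τ (interior_subset hτ)).trans_le (min_le_left _ _)) ?_
    exact (Metric.mem_closedBall.1 hk).trans_lt (by linarith)
  have h3 := hmono ⟨le_rfl, ht⟩ ⟨ht, le_rfl⟩ ht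
  have h4 := (hΩ y (hδU hy.2)).1 hy.1
  simp only [zero_smul, add_zero] at h3
  exact (hΩ _ (hδU hz)).2 (h4.trans_le h3)

theorem hasLocalMollifier_of_smoothBoundary {Ω : Opens 𝔼} (hΩ : HasSmoothBoundary Ω) {x : 𝔼}
    (hx : x ∈ closure (Ω : Set 𝔼)) : HasLocalMollifier (Ω : Set 𝔼) x := by
  refine HasInnerCone.hasLocalMollifier Ω.isOpen ?_
  by_cases hxΩ : x ∈ (Ω : Set 𝔼)
  · exact hasInnerCone_of_mem Ω.isOpen hxΩ
  · obtain ⟨U, hU, ρ, hρ, hne, hρΩ⟩ := hΩ x ⟨hx, by rwa [Ω.isOpen.interior_eq]⟩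
    exact hasInnerCone_of_smooth hU hρ hne hρΩ

theorem isBounded_unitCube : Bornology.IsBounded (unitCube n : Set 𝔼) := by
  have h1 : Bornology.IsBounded (WithLp.ofLp ⁻¹' Icc (0 : Fin n → ℝ) 1 : Set 𝔼) :=
    (PiLp.antilipschitzWith_ofLp 2 fun _ : Fin n => ℝ).isBounded_preimage
      (Metric.isBounded_Icc 0 1)
  exact h1.subset fun x hx => ⟨fun i => (hx i).1.le, fun i => (hx i).2.le⟩

theorem memBesovOn_mul_weak_deriv_of_domain (Φ : DyadicPartition n) {p q : ℝ≥0∞} {s : ℝ}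
    [Fact (1 ≤ p)] (hpt : p ≠ ⊤) (hq : 1 ≤ q) (hs : 1 < s) {Ω : Opens 𝔼}
    (hΩ : (Bornology.IsBounded (Ω : Set 𝔼) ∧ HasSmoothBoundary Ω) ∨ Ω = unitCube n) {u v : 𝔼 → ℂ}
    (hu : MemLp u ⊤ (volume.restrict Ω)) (hv : MemLp v ⊤ (volume.restrict Ω))
    (huB : MemBesovOn Φ s p q Ω (toDistribution Ω u))
    (hvB : MemBesovOn Φ s p q Ω (toDistribution Ω v)) (e : 𝔼) :
    ∃ w : 𝔼 → ℂ, MemLp w p (volume.restrict Ω) ∧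
      ∂_{e} (toDistribution Ω v) = toDistribution Ω w ∧
      MemBesovOn Φ (s - 1) p q Ω (toDistribution Ω fun x => u x * w x) := by
  rcases hΩ with ⟨hb, hsm⟩ | rfl
  · exact memBesovOn_mul_weak_deriv Φ hpt hq hs hb
      (fun x hx => hasLocalMollifier_of_smoothBoundary hsm hx) hu hv huB hvB e
  · exact memBesovOn_mul_weak_deriv Φ hpt hq hs isBounded_unitCube
      (fun x _ => (hasInnerCone_unitCube x).hasLocalMollifier (unitCube n).isOpen) hu hv huB hvB e

end Cones

/-! ### Periodic functions on `ℝⁿ` and functions on the torus. -/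

section Torus

variable {n : ℕ} {p q : ℝ≥0∞}

local notation "𝔼" => EuclideanSpace ℝ (Fin n)
local notation "𝕋" => UnitAddTorus (Fin n)

instance : IsProbabilityMeasure (torusMeasure n) := by
  unfold torusMeasure; infer_instance

instance : (torusMeasure n).IsAddLeftInvariant := by
  unfold torusMeasure; infer_instance

/-- The quotient map `ℝⁿ → 𝕋ⁿ`. -/
def toTorus (x : 𝔼) : 𝕋 := fun k => (x k : UnitAddCircle)

theorem toTorus_add (x y : 𝔼) : toTorus (x + y) = toTorus x + toTorus y := by
  ext k; simp [toTorus]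

theorem toTorus_sub (x y : 𝔼) : toTorus (x - y) = toTorus x - toTorus y := by
  ext k; simp [toTorus]

theorem toTorus_single (i : Fin n) (h : ℝ) :
    toTorus (EuclideanSpace.single i h) = Pi.single i (h : UnitAddCircle) := by
  ext k
  simp only [toTorus, PiLp.single_apply, Pi.single_apply]
  split_ifs <;> simp

theorem continuous_toTorus : Continuous (toTorus (n := n)) :=
  continuous_pi fun k => (AddCircle.continuous_mk' 1).comp (EuclideanSpace.proj (𝕜 := ℝ) k).continuous

/-- A representative in `(0,1]ⁿ` of a point of the torus. -/
noncomputable def representative (t : 𝕋) : 𝔼 :=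
  WithLp.toLp 2 fun k => (AddCircle.equivIoc 1 0 (t k) : ℝ)

theorem toTorus_representative (t : 𝕋) : toTorus (representative t) = t := by
  ext k
  exact AddCircle.coe_equivIoc

theorem measurable_representative : Measurable (representative (n := n)) :=
  (PiLp.continuous_toLp 2 _).measurable.comp (measurable_pi_lambda _ fun k =>
    measurable_subtype_coe.comp ((AddCircle.measurableEquivIoc 1 0).measurable.comp
      (measurable_pi_apply k)))

theorem norm_representative_le (t : 𝕋) : ‖representative t‖ ≤ √n := by
  rw [EuclideanSpace.norm_eq]
  refine Real.sqrt_le_sqrt ?_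
  calc ∑ k, ‖representative t k‖ ^ 2 ≤ ∑ k : Fin n, (1 : ℝ) := by
        refine Finset.sum_le_sum fun k _ => ?_
        have h := (AddCircle.equivIoc 1 0 (t k)).2
        have h1 : representative t k = (AddCircle.equivIoc 1 0 (t k) : ℝ) := rfl
        rw [h1, Real.norm_of_nonneg h.1.le]
        exact pow_le_one₀ h.1.le (by simpa using h.2)
    _ = n := by simp

/-- The half-open unit cube with corner `y`. -/
def unitBox (y : 𝔼) : Set 𝔼 := {x | ∀ i, x i ∈ Ioc (y i) (y i + 1)}

/-- The family of all half-open unit cubes. -/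
def unitBoxes (n : ℕ) : Set (Set (EuclideanSpace ℝ (Fin n))) := range unitBox

theorem unitBox_eq (y : 𝔼) :
    unitBox y = (WithLp.ofLp) ⁻¹' (univ.pi fun i => Ioc (y i) (y i + 1)) := by
  ext x; simp [unitBox]

theorem measurableSet_unitBox (y : 𝔼) : MeasurableSet (unitBox y) := by
  rw [unitBox_eq]
  exact (PiLp.continuous_ofLp 2 _).measurable (MeasurableSet.univ_pi fun i => measurableSet_Ioc)

/-- The family contains all translates of a unit box rather than one fundamental cell; this is what
makes every displacement admissible. -/
theorem admissible_unitBoxes : Admissible (unitBoxes n) univ := by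
  refine ⟨?_, ?_, by simp⟩
  · rintro _ ⟨y, rfl⟩
    exact measurableSet_unitBox y
  · rintro z - _ ⟨y, rfl⟩
    refine ⟨_, ⟨y - z, rfl⟩, fun x hx i => ?_⟩
    have := hx i
    simp only [PiLp.sub_apply, mem_Ioc] at this ⊢
    constructor <;> linarith

theorem measurePreserving_toTorus (y : 𝔼) :
    MeasurePreserving toTorus (volume.restrict (unitBox y)) (torusMeasure n) := by
  have h1 := (PiLp.volume_preserving_ofLp (Fin n)).restrict_preimage
    (MeasurableSet.univ_pi fun i => measurableSet_Ioc (a := y i) (b := y i + 1))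
  rw [← unitBox_eq, volume_pi, Measure.restrict_pi_pi] at h1
  have h2 : ∀ i, MeasurePreserving (fun a : ℝ => (a : UnitAddCircle))
      (volume.restrict (Ioc (y i) (y i + 1))) AddCircle.haarAddCircle := fun i => by
    have := UnitAddCircle.measurePreserving_mk (y i)
    rw [AddCircle.volume_eq_smul_haarAddCircle] at this
    simpa using this
  exact (measurePreserving_pi _ _ h2).comp h1

/-- Every unit box is a fundamental domain, so all the norms in the supremum coincide. -/
theorem supNorm_comp_toTorus {G : Type} [NormedAddCommGroup G] {g : 𝕋 → G} (hg : StronglyMeasurable g) :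
    supNorm (unitBoxes n) p (fun x => g (toTorus x)) = eLpNorm g p (torusMeasure n) := by
  have h : ∀ y : 𝔼, eLpNorm (fun x => g (toTorus x)) p (volume.restrict (unitBox y)) =
      eLpNorm g p (torusMeasure n) := fun y =>
    eLpNorm_comp_measurePreserving hg.aestronglyMeasurable (measurePreserving_toTorus y)
  refine le_antisymm (supNorm_le ?_) ?_
  · rintro _ ⟨y, rfl⟩
    exact (h y).le
  · rw [← h 0]
    exact eLpNorm_le_supNorm (mem_range_self (0 : 𝔼)) _

/-- Functions on `ℝⁿ` that are periodic with respect to `ℤⁿ`. -/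
def IsTorusPeriodic {G : Type} (F : 𝔼 → G) : Prop := ∀ c, toTorus c = 0 → ∀ x, F (x + c) = F x

/-- The function on the torus induced by a periodic function. -/
noncomputable def descend {G : Type} (F : 𝔼 → G) (t : 𝕋) : G := F (representative t)

theorem isTorusPeriodic_comp {G : Type} (g : 𝕋 → G) :
    IsTorusPeriodic fun x : 𝔼 => g (toTorus x) := fun c hc x => by
  simp only [toTorus_add, hc, add_zero]

theorem IsTorusPeriodic.eq {G : Type} {F : 𝔼 → G} (hF : IsTorusPeriodic F) {x y : 𝔼}
    (h : toTorus x = toTorus y) : F x = F y := by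
  have := hF (x - y) (by rw [toTorus_sub, h, sub_self]) y
  rwa [add_sub_cancel] at this

theorem IsTorusPeriodic.descend_toTorus {G : Type} {F : 𝔼 → G} (hF : IsTorusPeriodic F) (x : 𝔼) :
    descend F (toTorus x) = F x := hF.eq (toTorus_representative _)

theorem descend_comp_toTorus {G : Type} (g : 𝕋 → G) :
    descend (fun x : 𝔼 => g (toTorus x)) = g := by
  ext t; simp only [descend, toTorus_representative]

theorem stronglyMeasurable_descend {G : Type} [NormedAddCommGroup G] {F : 𝔼 → G}
    (hF : StronglyMeasurable F) : StronglyMeasurable (descend F) :=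
  hF.comp_measurable measurable_representative

theorem IsTorusPeriodic.supNorm_eq {G : Type} [NormedAddCommGroup G] {F : 𝔼 → G}
    (hF : IsTorusPeriodic F) (hm : StronglyMeasurable F) :
    supNorm (unitBoxes n) p F = eLpNorm (descend F) p (torusMeasure n) := by
  rw [← supNorm_comp_toTorus (stronglyMeasurable_descend hm)]
  simp only [hF.descend_toTorus]

theorem IsTorusPeriodic.exists_bound {G : Type} [NormedAddCommGroup G] {F : 𝔼 → G}
    (hF : IsTorusPeriodic F) (hc : Continuous F) : ∃ C, ∀ x, ‖F x‖ ≤ C := by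
  obtain ⟨C, hC⟩ := (isCompact_closedBall (0 : 𝔼) (√n)).exists_bound_of_continuousOn hc.continuousOn
  refine ⟨C, fun x => ?_⟩
  rw [← hF.descend_toTorus]
  exact hC _ (by simpa using norm_representative_le (toTorus x))

/-- The integral over the torus of a partial derivative vanishes. -/
theorem IsTorusPeriodic.integral_fderiv {W : 𝔼 → ℂ} (hW : IsTorusPeriodic W) (hc : ContDiff ℝ 1 W)
    (e : 𝔼) : ∫ t, descend (fun x => fderiv ℝ W x e) t ∂(torusMeasure n) = 0 := by
  have hcd : Continuous fun x => fderiv ℝ W x e :=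
    (hc.continuous_fderiv one_ne_zero).clm_apply continuous_const
  have hper : IsTorusPeriodic fun x => fderiv ℝ W x e := fun c hc x => by
    simp only [fderiv_periodic (hW c hc) x]
  obtain ⟨C, hC⟩ := hW.exists_bound hc.continuous
  obtain ⟨C', hC'⟩ := hper.exists_bound hcd
  have hmeas : ∀ {H : 𝔼 → ℂ}, Continuous H → ∀ h : ℝ,
      AEStronglyMeasurable (fun t => H (representative t + h • e)) (torusMeasure n) := fun hH h =>
    (hH.stronglyMeasurable.comp_measurable
      (measurable_representative.add_const _)).aestronglyMeasurable
  -- By invariance of Haar measure the integral of the translate of `W` by `h • e` does not depend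
  -- on `h`; the claim is its derivative at `h = 0`, taken under the integral sign.
  have h1 := (hasDerivAt_integral_of_dominated_loc_of_deriv_le (μ := torusMeasure n) (x₀ := (0 : ℝ))
    (F := fun h t => W (representative t + h • e))
    (F' := fun h t => fderiv ℝ W (representative t + h • e) e) (bound := fun _ => C')
    univ_mem (Eventually.of_forall fun h => hmeas hc.continuous h)
    ((integrable_const C).mono' (hmeas hc.continuous 0) (ae_of_all _ fun t => hC _))
    (hmeas hcd 0) (ae_of_all _ fun t h _ => hC' _) (integrable_const C')
    (ae_of_all _ fun t h _ => ?_)).2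
  · have h2 : ∀ h : ℝ, ∫ t, W (representative t + h • e) ∂(torusMeasure n) =
        ∫ t, descend W t ∂(torusMeasure n) := fun h => by
      rw [← integral_add_right_eq_self (descend W) (toTorus (h • e))]
      refine integral_congr_ae (ae_of_all _ fun t => hW.eq ?_)
      rw [toTorus_add, toTorus_representative, toTorus_representative]
    simp only [h2] at h1
    have h3 := h1.unique (hasDerivAt_const _ _)
    simpa only [zero_smul, add_zero] using! h3
  · have h4 : HasDerivAt (fun h : ℝ => representative t + h • e) e h := by
      simpa using ((hasDerivAt_id h).smul_const e).const_add (representative t)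
    exact ((hc.differentiable one_ne_zero) _).hasFDerivAt.comp_hasDerivAt h h4

end Torus

/-! ### Fourier coefficients on the torus and convolution with kernels on `ℝⁿ`. -/

section TorusFourier

open FourierTransform UnitAddTorus

variable {n : ℕ} {p q : ℝ≥0∞}

local notation "𝔼" => EuclideanSpace ℝ (Fin n)
local notation "𝕋" => UnitAddTorus (Fin n)

theorem mFourierCoeff_eq (f : 𝕋 → ℂ) (m : Fin n → ℤ) :
    mFourierCoeff f m = ∫ t, mFourier (-m) t * f t ∂(torusMeasure n) := rfl

theorem norm_mFourier_apply (m : Fin n → ℤ) (t : 𝕋) : ‖mFourier m t‖ = 1 := by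
  simp only [mFourier, ContinuousMap.coe_mk, norm_prod, fourier_apply, Circle.norm_coe,
    Finset.prod_const_one]

theorem mFourier_sub (m : Fin n → ℤ) (t s : 𝕋) :
    mFourier (-m) t = mFourier (-m) (t - s) * mFourier (-m) s := by
  simp only [mFourier, ContinuousMap.coe_mk, ← Finset.prod_mul_distrib]
  refine Finset.prod_congr rfl fun i _ => ?_
  rw [fourier_apply, fourier_apply, fourier_apply, ← Circle.coe_mul, ← AddCircle.toCircle_add,
    ← smul_add, Pi.sub_apply, sub_add_cancel]

/-- The point of `ℝⁿ` with integer coordinates `m`. -/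
noncomputable def latticePoint (m : Fin n → ℤ) : 𝔼 := WithLp.toLp 2 fun i => (m i : ℝ)

theorem mFourier_toTorus (m : Fin n → ℤ) (y : 𝔼) :
    mFourier (-m) (toTorus y) = (Real.fourierChar (-(inner ℝ y (latticePoint m))) : ℂ) := by
  rw [Real.fourierChar_apply]
  simp only [mFourier, ContinuousMap.coe_mk, toTorus, fourier_coe_apply, ← Complex.exp_sum]
  congr 1
  simp only [PiLp.inner_apply, latticePoint, Pi.neg_apply, RCLike.inner_apply, conj_trivial]
  push_cast
  rw [← Finset.sum_neg_distrib, Finset.mul_sum, Finset.sum_mul]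
  refine Finset.sum_congr rfl fun i _ => ?_
  ring

theorem integrable_mFourier_mul {f : 𝕋 → ℂ} (hf : Integrable f (torusMeasure n)) (m : Fin n → ℤ) :
    Integrable (fun t => mFourier m t * f t) (torusMeasure n) :=
  hf.bdd_mul (c := 1) (mFourier m).continuous.aestronglyMeasurable
    (ae_of_all _ fun t => (norm_mFourier_apply m t).le)

theorem mFourierCoeff_congr {f g : 𝕋 → ℂ} (h : f =ᵐ[torusMeasure n] g) (m : Fin n → ℤ) :
    mFourierCoeff f m = mFourierCoeff g m :=
  integral_congr_ae (h.mono fun t ht => by simp only [ht])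

theorem mFourierCoeff_sub {f g : 𝕋 → ℂ} (hf : Integrable f (torusMeasure n))
    (hg : Integrable g (torusMeasure n)) (m : Fin n → ℤ) :
    mFourierCoeff (fun t => f t - g t) m = mFourierCoeff f m - mFourierCoeff g m := by
  simp only [mFourierCoeff_eq, mul_sub]
  exact integral_sub (integrable_mFourier_mul hf _) (integrable_mFourier_mul hg _)

theorem mFourierCoeff_sum {ι : Type*} (s : Finset ι) {f : ι → 𝕋 → ℂ}
    (hf : ∀ i ∈ s, Integrable (f i) (torusMeasure n)) (m : Fin n → ℤ) :
    mFourierCoeff (fun t => ∑ i ∈ s, f i t) m = ∑ i ∈ s, mFourierCoeff (f i) m := by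
  simp only [mFourierCoeff_eq, Finset.mul_sum]
  exact integral_finsetSum s fun i hi => integrable_mFourier_mul (hf i hi) _

theorem mFourierCoeff_const_mul (c : ℂ) (f : 𝕋 → ℂ) (m : Fin n → ℤ) :
    mFourierCoeff (fun t => c * f t) m = c * mFourierCoeff f m := by
  simp only [mFourierCoeff_eq, mul_left_comm _ c]
  exact integral_const_mul c _

theorem mFourierCoeff_mFourier (k m : Fin n → ℤ) :
    mFourierCoeff (mFourier k : 𝕋 → ℂ) m = if k = m then 1 else 0 := by
  have h := (orthonormal_iff_ite (𝕜 := ℂ)).1 (orthonormal_mFourier (d := Fin n)) m k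
  rw [ContinuousMap.inner_toLp] at h
  simp only [← mFourier_neg] at h
  rw [mFourierCoeff_eq]
  refine Eq.trans ?_ (h.trans (by simp only [eq_comm]))
  refine integral_congr_ae (ae_of_all _ fun t => ?_)
  simp only [mul_comm]

/-- An integrable function on the torus is determined by its Fourier coefficients. -/
theorem ae_eq_of_mFourierCoeff_eq {f g : 𝕋 → ℂ} (hf : Integrable f (torusMeasure n))
    (hg : Integrable g (torusMeasure n)) (h : ∀ m, mFourierCoeff f m = mFourierCoeff g m) :
    f =ᵐ[torusMeasure n] g := by
  set d : 𝕋 → ℂ := fun t => f t - g t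
  have hd : Integrable d (torusMeasure n) := hf.sub hg
  have h0 : ∀ m, ∫ t, mFourier m t * d t ∂(torusMeasure n) = 0 := fun m => by
    have := mFourierCoeff_sub hf hg (-m)
    rwa [h, sub_self, mFourierCoeff_eq, neg_neg] at this
  have hint : ∀ c : C(𝕋, ℂ), Integrable (fun t => c t * d t) (torusMeasure n) := fun c =>
    hd.bdd_mul (c := ‖c‖) c.continuous.aestronglyMeasurable
      (ae_of_all _ fun t => c.norm_coe_le_norm t)
  -- Pairing with the difference `d` is a continuous functional on `C(𝕋)` that kills the characters,
  -- whose span is dense, so it vanishes. Indicators of closed sets are dominated limits of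
  -- continuous functions, hence `d` has zero integral over every closed set.
  let Λ : C(𝕋, ℂ) →ₗ[ℂ] ℂ :=
    { toFun := fun c => ∫ t, c t * d t ∂(torusMeasure n)
      map_add' := fun a b => by
        simp only [ContinuousMap.add_apply, add_mul]
        exact integral_add (hint a) (hint b)
      map_smul' := fun a b => by
        simp only [ContinuousMap.smul_apply, smul_eq_mul, mul_assoc, RingHom.id_apply]
        exact integral_const_mul a _ }
  let Λc : C(𝕋, ℂ) →L[ℂ] ℂ := Λ.mkContinuous (∫ t, ‖d t‖ ∂(torusMeasure n)) fun c => by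
    calc ‖∫ t, c t * d t ∂(torusMeasure n)‖ ≤ ∫ t, ‖c t * d t‖ ∂(torusMeasure n) :=
          norm_integral_le_integral_norm _
      _ ≤ ∫ t, ‖c‖ * ‖d t‖ ∂(torusMeasure n) := by
        refine integral_mono (hint c).norm (hd.norm.const_mul _) fun t => ?_
        simp only [norm_mul]
        gcongr
        exact c.norm_coe_le_norm t
      _ = _ := by rw [integral_const_mul, mul_comm]
  have hΛ : Λc = 0 := by
    refine ContinuousLinearMap.ext_on (s := range mFourier) ?_ ?_
    · have := span_mFourier_closure_eq_top (d := Fin n)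
      rwa [← Submodule.dense_iff_topologicalClosure_eq_top] at this
    · rintro _ ⟨m, rfl⟩
      exact h0 m
  have hc : ∀ c : C(𝕋, ℂ), ∫ t, c t * d t ∂(torusMeasure n) = 0 := fun c =>
    congrArg (fun L => L c) hΛ
  have hd0 : d =ᵐ[torusMeasure n] 0 := by
    refine ae_eq_zero_of_forall_setIntegral_isClosed_eq_zero hd fun S hS => ?_
    have hδ : ∀ k : ℕ, (0 : ℝ) < 1 / ((k : ℝ) + 1) := fun k => by positivity
    have hlim := thickenedIndicator_tendsto_indicator_closure hδ
      tendsto_one_div_add_atTop_nhds_zero_nat S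
    rw [tendsto_pi_nhds] at hlim
    have hT : Tendsto (fun k : ℕ => ∫ t, ((thickenedIndicator (hδ k) S t : ℝ) : ℂ) * d t
        ∂(torusMeasure n)) atTop (𝓝 (∫ t, S.indicator d t ∂(torusMeasure n))) := by
      refine tendsto_integral_of_dominated_convergence (fun t => ‖d t‖) (fun k => ?_) hd.norm
        (fun k => ae_of_all _ fun t => ?_) (ae_of_all _ fun t => ?_)
      · exact (Continuous.aestronglyMeasurable (by fun_prop)).mul hd.1
      · rw [norm_mul]
        refine mul_le_of_le_one_left (norm_nonneg _) ?_
        simpa using! thickenedIndicator_le_one (hδ k) S t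
      · have h1 := hlim t
        rw [hS.closure_eq] at h1
        have h2 : Tendsto (fun k : ℕ => ((thickenedIndicator (hδ k) S t : ℝ) : ℂ)) atTop
            (𝓝 (((S.indicator (fun _ => (1 : NNReal)) t : NNReal) : ℝ) : ℂ)) :=
          (Complex.continuous_ofReal.tendsto _).comp ((NNReal.continuous_coe.tendsto _).comp h1)
        have h3 := h2.mul_const (d t)
        convert h3 using 2
        by_cases ht : t ∈ S <;> simp [ht]
    have hz : ∀ k : ℕ, ∫ t, ((thickenedIndicator (hδ k) S t : ℝ) : ℂ) * d t
        ∂(torusMeasure n) = 0 := fun k =>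
      hc ⟨fun t => ((thickenedIndicator (hδ k) S t : ℝ) : ℂ), by fun_prop⟩
    simp only [hz] at hT
    rw [← integral_indicator hS.measurableSet]
    exact tendsto_nhds_unique hT tendsto_const_nhds
  filter_upwards [hd0] with t ht
  exact sub_eq_zero.1 ht

/-- Convolution of a Schwartz kernel on `ℝⁿ` with a function on the torus. -/
noncomputable def torusConv (κ : 𝓢(𝔼, ℂ)) (g : 𝕋 → ℂ) (t : 𝕋) : ℂ :=
  ∫ y, κ y * g (t - toTorus y)

theorem conv_comp_toTorus (κ : 𝓢(𝔼, ℂ)) (g : 𝕋 → ℂ) :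
    conv κ (fun x => g (toTorus x)) = fun x => torusConv κ g (toTorus x) := by
  ext x; simp only [conv, torusConv, toTorus_sub, smul_eq_mul]

theorem measurable_sub_toTorus : Measurable fun z : 𝕋 × 𝔼 => z.1 - toTorus z.2 :=
  measurable_fst.sub (continuous_toTorus.measurable.comp measurable_snd)

theorem stronglyMeasurable_torusConv (κ : 𝓢(𝔼, ℂ)) {g : 𝕋 → ℂ} (hg : StronglyMeasurable g) :
    StronglyMeasurable (torusConv κ g) := by
  have h : StronglyMeasurable (Function.uncurry fun (t : 𝕋) (y : 𝔼) => κ y * g (t - toTorus y)) :=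
    (κ.continuous.stronglyMeasurable.comp_measurable measurable_snd).mul
      (hg.comp_measurable measurable_sub_toTorus)
  exact h.integral_prod_right

theorem norm_torusConv_le (κ : 𝓢(𝔼, ℂ)) {g : 𝕋 → ℂ} {C : ℝ} (hC : ∀ t, ‖g t‖ ≤ C) (t : 𝕋) :
    ‖torusConv κ g t‖ ≤ (∫ y, ‖κ y‖) * C := by
  rw [← integral_mul_const]
  refine norm_integral_le_of_norm_le (κ.integrable.norm.mul_const C) (ae_of_all _ fun y => ?_)
  rw [norm_mul]
  gcongr
  exact hC _

theorem integrable_of_bounded {g : 𝕋 → ℂ} (hg : StronglyMeasurable g) {C : ℝ}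
    (hC : ∀ t, ‖g t‖ ≤ C) : Integrable g (torusMeasure n) :=
  (integrable_const C).mono' hg.aestronglyMeasurable (ae_of_all _ hC)

/-- Fubini's theorem and translation invariance: translating `g` by `y` multiplies its coefficient
by a character of `y`, and integrating that character against `κ` gives the Fourier transform of `κ`
at the lattice point. -/
theorem mFourierCoeff_torusConv (κ : 𝓢(𝔼, ℂ)) {g : 𝕋 → ℂ} (hg : StronglyMeasurable g) {C : ℝ}
    (hC : ∀ t, ‖g t‖ ≤ C) (m : Fin n → ℤ) :
    mFourierCoeff (torusConv κ g) m = 𝓕 κ (latticePoint m) * mFourierCoeff g m := by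
  have hsm : StronglyMeasurable (Function.uncurry fun (t : 𝕋) (y : 𝔼) =>
      mFourier (-m) t * (κ y * g (t - toTorus y))) :=
    ((mFourier (-m)).continuous.stronglyMeasurable.comp_measurable measurable_fst).mul
      ((κ.continuous.stronglyMeasurable.comp_measurable measurable_snd).mul
        (hg.comp_measurable measurable_sub_toTorus))
  have hint : Integrable (Function.uncurry fun (t : 𝕋) (y : 𝔼) =>
      mFourier (-m) t * (κ y * g (t - toTorus y))) ((torusMeasure n).prod volume) := by
    have h1 : Integrable (fun z : 𝕋 × 𝔼 => (1 : ℝ) * (‖κ z.2‖ * C)) ((torusMeasure n).prod volume) :=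
      (integrable_const (1 : ℝ)).mul_prod (κ.integrable.norm.mul_const C)
    refine h1.mono' hsm.aestronglyMeasurable (ae_of_all _ fun z => ?_)
    simp only [Function.uncurry, norm_mul, norm_mFourier_apply]
    gcongr
    exact hC _
  have h2 : ∀ y : 𝔼, ∫ t, mFourier (-m) t * (κ y * g (t - toTorus y)) ∂(torusMeasure n) =
      (Real.fourierChar (-(inner ℝ y (latticePoint m))) : ℂ) * κ y * mFourierCoeff g m := fun y => by
    rw [← mFourier_toTorus, mFourierCoeff_eq, ← integral_const_mul,
      ← integral_sub_right_eq_self (fun t => mFourier (-m) (toTorus y) * κ y *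
        (mFourier (-m) t * g t)) (toTorus y)]
    refine integral_congr_ae (ae_of_all _ fun t => ?_)
    simp only
    rw [mFourier_sub m t (toTorus y)]
    ring
  rw [mFourierCoeff_eq]
  simp only [torusConv, ← integral_const_mul]
  rw [integral_integral_swap hint]
  simp only [h2]
  rw [integral_mul_const, SchwartzMap.fourier_coe, Real.fourier_eq]
  rfl

end TorusFourier

/-! ### Periodic decompositions of bounded Besov functions on the torus. -/

section TorusBesov

open FourierTransform UnitAddTorus

variable {n : ℕ} (Φ : DyadicPartition n) {p q : ℝ≥0∞} {s σ : ℝ}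

local notation "𝔼" => EuclideanSpace ℝ (Fin n)
local notation "𝕋" => UnitAddTorus (Fin n)

theorem two_pi_smul_latticePoint (m : Fin n → ℤ) :
    (2 * Real.pi) • latticePoint m = WithLp.toLp 2 fun i => 2 * Real.pi * (m i : ℝ) := rfl

theorem finite_setOf_mem_tsupport (l : ℕ) :
    {m : Fin n → ℤ | (2 * Real.pi) • latticePoint m ∈ tsupport (Φ.φ l)}.Finite := by
  obtain ⟨N, hN⟩ := exists_nat_gt ((2 : ℝ) ^ (l + 1))
  refine (Set.finite_Icc (fun _ : Fin n => -(N : ℤ)) fun _ => (N : ℤ)).subset fun m hm => ?_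
  have h1 := Φ.tsupport_subset l hm
  rw [mem_ball_zero_iff, norm_smul, Real.norm_of_nonneg (by positivity)] at h1
  have h2 : ∀ i, |m i| ≤ (N : ℤ) := fun i => by
    have h3 := PiLp.norm_apply_le (latticePoint m) i
    have h4 : latticePoint m i = (m i : ℝ) := rfl
    rw [h4, Real.norm_eq_abs] at h3
    have h5 := Real.pi_gt_three
    have h6 := norm_nonneg (latticePoint m)
    have h7 : |(m i : ℝ)| ≤ N := by nlinarith
    exact_mod_cast h7
  exact ⟨fun i => (abs_le.1 (h2 i)).1, fun i => (abs_le.1 (h2 i)).2⟩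

theorem exists_torusPiece_eq_sum (l : ℕ) : ∃ S : Finset (Fin n → ℤ), ∀ (a : (Fin n → ℤ) → ℂ)
    (t : 𝕋), torusPiece Φ l a t =
      ∑ m ∈ S, a m * Φ.φ l ((2 * Real.pi) • latticePoint m) * mFourier m t := by
  refine ⟨(finite_setOf_mem_tsupport Φ l).toFinset, fun a t => tsum_eq_sum fun m hm => ?_⟩
  have h1 : (2 * Real.pi) • latticePoint m ∉ tsupport (Φ.φ l) := by simpa using hm
  rw [← two_pi_smul_latticePoint, image_eq_zero_of_notMem_tsupport h1, mul_zero, zero_mul]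

theorem continuous_torusPiece (l : ℕ) (a : (Fin n → ℤ) → ℂ) : Continuous (torusPiece Φ l a) := by
  obtain ⟨S, hS⟩ := exists_torusPiece_eq_sum Φ l
  rw [funext (hS a)]
  fun_prop

theorem memLp_torusPiece (l : ℕ) (a : (Fin n → ℤ) → ℂ) :
    MemLp (torusPiece Φ l a) p (torusMeasure n) := by
  obtain ⟨C, hC⟩ := isCompact_univ.exists_bound_of_continuousOn
    (continuous_torusPiece Φ l a).continuousOn
  exact MemLp.of_bound (continuous_torusPiece Φ l a).aestronglyMeasurable C
    (ae_of_all _ fun t => hC t (mem_univ t))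

theorem mFourierCoeff_torusPiece (l : ℕ) (a : (Fin n → ℤ) → ℂ) (m : Fin n → ℤ) :
    mFourierCoeff (torusPiece Φ l a) m = Φ.φ l ((2 * Real.pi) • latticePoint m) * a m := by
  let S := (finite_setOf_mem_tsupport Φ l).toFinset
  have hS : ∀ m ∉ S, Φ.φ l ((2 * Real.pi) • latticePoint m) = 0 := fun m hm =>
    image_eq_zero_of_notMem_tsupport (by simpa [S] using hm)
  have h1 : torusPiece Φ l a = fun t => ∑ m ∈ S,
      a m * Φ.φ l ((2 * Real.pi) • latticePoint m) * mFourier m t := funext fun t =>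
    tsum_eq_sum fun m hm => by rw [← two_pi_smul_latticePoint, hS m hm, mul_zero, zero_mul]
  rw [h1, mFourierCoeff_sum]
  · simp only [mFourierCoeff_const_mul, mFourierCoeff_mFourier, mul_ite, mul_one, mul_zero]
    rw [Finset.sum_ite_eq']
    split_ifs with hm
    · ring
    · rw [hS m hm, zero_mul]
  · exact fun k _ => (integrable_of_bounded (mFourier k).continuous.stronglyMeasurable
      fun t => (norm_mFourier_apply k t).le).const_mul _

theorem torusPiece_ae_eq (l : ℕ) {g : 𝕋 → ℂ} (hg : StronglyMeasurable g) {C : ℝ}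
    (hC : ∀ t, ‖g t‖ ≤ C) :
    torusPiece Φ l (mFourierCoeff g) =ᵐ[torusMeasure n] torusConv (lpKernel Φ l) g := by
  refine ae_eq_of_mFourierCoeff_eq (memLp_one_iff_integrable.1 (memLp_torusPiece Φ l _))
    (integrable_of_bounded (stronglyMeasurable_torusConv _ hg) (norm_torusConv_le _ hC))
    fun m => ?_
  rw [mFourierCoeff_torusPiece, mFourierCoeff_torusConv _ hg hC, fourier_lpKernel]

theorem tendsto_integral_mul_of_tendsto_eLpNorm (hp : 1 ≤ p) {f : 𝕋 → ℂ} {S : ℕ → 𝕋 → ℂ}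
    {c : 𝕋 → ℂ} (hf : MemLp f p (torusMeasure n)) (hS : ∀ K, MemLp (S K) p (torusMeasure n))
    (h : Tendsto (fun K => eLpNorm (fun t => f t - S K t) p (torusMeasure n)) atTop (𝓝 0))
    (hc : AEStronglyMeasurable c (torusMeasure n)) {C : ℝ} (hC : ∀ t, ‖c t‖ ≤ C) :
    Tendsto (fun K => ∫ t, c t * S K t ∂(torusMeasure n)) atTop
      (𝓝 (∫ t, c t * f t ∂(torusMeasure n))) := by
  have hint : ∀ {g : 𝕋 → ℂ}, MemLp g p (torusMeasure n) →
      Integrable (fun t => c t * g t) (torusMeasure n) := fun hg =>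
    (hg.integrable hp).bdd_mul hc (ae_of_all _ hC)
  refine tendsto_integral_of_L1' _ (hint hf).1 (Eventually.of_forall fun K => hint (hS K)) ?_
  have h1 := ENNReal.Tendsto.const_mul (a := ENNReal.ofReal C) h (Or.inr ENNReal.ofReal_ne_top)
  rw [mul_zero] at h1
  refine tendsto_of_tendsto_of_tendsto_of_le_of_le tendsto_const_nhds h1 (fun _ => bot_le)
    fun K => ?_
  calc eLpNorm ((fun t => c t * S K t) - fun t => c t * f t) 1 (torusMeasure n)
      ≤ ENNReal.ofReal C * eLpNorm (fun t => f t - S K t) 1 (torusMeasure n) := by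
        refine eLpNorm_le_mul_eLpNorm_of_ae_le_mul (ae_of_all _ fun t => ?_) 1
        rw [Pi.sub_apply, ← mul_sub, norm_mul, norm_sub_rev]
        gcongr
        exact hC t
    _ ≤ _ := by
        gcongr
        exact eLpNorm_le_eLpNorm_of_exponent_le hp (hf.sub (hS K)).1

theorem tendsto_mFourierCoeff (hp : 1 ≤ p) {f : 𝕋 → ℂ} {h : ℕ → 𝕋 → ℂ}
    (hf : MemLp f p (torusMeasure n)) (hh : ∀ k, MemLp (h k) p (torusMeasure n))
    (hlim : Tendsto (fun K => eLpNorm (fun t => f t - ∑ k ∈ Finset.range K, h k t) p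
      (torusMeasure n)) atTop (𝓝 0)) (m : Fin n → ℤ) :
    Tendsto (fun K => ∑ k ∈ Finset.range K, mFourierCoeff (h k) m) atTop
      (𝓝 (mFourierCoeff f m)) := by
  have h1 := tendsto_integral_mul_of_tendsto_eLpNorm hp (c := mFourier (-m)) (C := 1) hf
    (fun K => memLp_finsetSum _ fun k _ => hh k) hlim
    (mFourier (-m)).continuous.aestronglyMeasurable fun t => (norm_mFourier_apply _ t).le
  refine h1.congr fun K => ?_
  rw [← mFourierCoeff_sum _ fun k _ => (hh k).integrable hp]
  rfl

variable {F : ℕ → EuclideanSpace ℝ (Fin n) → ℂ} {g : UnitAddTorus (Fin n) → ℂ}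

theorem memLp_descend {H : 𝔼 → ℂ} (hH : IsBddSmooth H) :
    MemLp (descend H) p (torusMeasure n) := by
  obtain ⟨C, hC⟩ := hH.norm_le
  exact MemLp.of_bound
    (stronglyMeasurable_descend hH.1.continuous.stronglyMeasurable).aestronglyMeasurable C
    (ae_of_all _ fun t => hC _)

theorem approximates_unitBoxes_iff (hper : ∀ k, IsTorusPeriodic (F k))
    (hF : ∀ k, IsBddSmooth (F k)) (hg : StronglyMeasurable g) :
    Approximates (unitBoxes n) p F (fun x => g (toTorus x)) ↔
      Tendsto (fun K => eLpNorm (fun t => g t - ∑ k ∈ Finset.range K, descend (F k) t) p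
        (torusMeasure n)) atTop (𝓝 0) := by
  refine iff_of_eq (congrArg (fun a : ℕ → ℝ≥0∞ => Tendsto a atTop (𝓝 0)) (funext fun K => ?_))
  have hm : StronglyMeasurable fun t => g t - ∑ k ∈ Finset.range K, descend (F k) t :=
    hg.sub (Finset.stronglyMeasurable_fun_sum _ fun k _ =>
      stronglyMeasurable_descend (hF k).1.continuous.stronglyMeasurable)
  rw [← supNorm_comp_toTorus hm]
  simp only [(hper _).descend_toTorus]

theorem IsDecomposition.exists_torus_limit (hp : 1 ≤ p) (hq : 1 ≤ q) (hσ : 0 < σ)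
    (hper : ∀ k, IsTorusPeriodic (F k)) (hF : IsDecomposition (unitBoxes n) p q σ F) :
    ∃ g : 𝕋 → ℂ, StronglyMeasurable g ∧ MemLp g p (torusMeasure n) ∧
      Approximates (unitBoxes n) p F fun x => g (toTorus x) := by
  have h := hF.tsum_derivNorm_ne_top (m := 0) hq (by simpa using hσ)
  simp only [derivNorm_zero,
    fun k => (hper k).supNorm_eq (p := p) (hF.smooth k).1.continuous.stronglyMeasurable] at h
  obtain ⟨g, hg, hgp, hlim⟩ := exists_limit_of_tsum_eLpNorm_ne_top hp
    (fun k => memLp_descend (hF.smooth k)) h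
  exact ⟨g, hg, hgp, (approximates_unitBoxes_iff hper hF.smooth hg).2 hlim⟩

/-- Bounded functions on the torus in a Besov space of positive smoothness have a periodic
decomposition. -/
theorem MemBesovTorus.exists_decomposition (hp : 1 ≤ p) (hq : 1 ≤ q) (hs : 0 < s)
    (hg : StronglyMeasurable g) {C : ℝ} (hC : ∀ t, ‖g t‖ ≤ C)
    (h : MemBesovTorus Φ s p q (mFourierCoeff g)) :
    ∃ F : ℕ → 𝔼 → ℂ, (∀ k, IsTorusPeriodic (F k)) ∧ IsDecomposition (unitBoxes n) p q s F ∧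
      Approximates (unitBoxes n) p F fun x => g (toTorus x) := by
  obtain ⟨Q, hQ⟩ := exists_reproducing_kernel Φ
  have hd : IsDominated fun x : 𝔼 => g (toTorus x) :=
    .of_bounded (hg.comp_measurable continuous_toTorus.measurable) fun x => hC _
  set F : ℕ → 𝔼 → ℂ := fun l => conv (lpKernel Φ l) fun x => g (toTorus x)
  have hFt : ∀ l, F l = fun x => torusConv (lpKernel Φ l) g (toTorus x) := fun l =>
    conv_comp_toTorus _ g
  have hper : ∀ l, IsTorusPeriodic (F l) := fun l => by
    rw [hFt]; exact isTorusPeriodic_comp _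
  have hFd : ∀ l, descend (F l) = torusConv (lpKernel Φ l) g := fun l => by
    rw [hFt]; exact descend_comp_toTorus _
  -- Reproduction by a kernel of scale `2^{-l}` allows derivatives of `F l` to be put on that
  -- kernel, which turns the norm of the piece itself into the bounds for all its derivatives.
  have hFQ : ∀ l, conv (dilate l Q) (F l) = F l := fun l =>
    conv_conv hd (eq_conv_of_fourier fun ξ => hQ l ξ)
  have hF : IsDecomposition (unitBoxes n) p q s F := by
    refine ⟨fun l => hd.isBddSmooth_conv _, _, (memℓp_iff_memEllq hq).1 h, fun m =>
      ⟨kernelNorm m Q, (kernelNorm_lt_top _ _).ne, fun l => ?_⟩⟩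
    have h1 := derivNorm_kconv_le (p := p) admissible_unitBoxes isClosed_univ hp m (dilate l Q)
      (by simp) (hd.isBddSmooth_conv (lpKernel Φ l)).isDominated
    rw [← conv_eq_kconv] at h1
    change derivNorm _ p m (conv _ (F l)) ≤ _ * supNorm _ p (F l) at h1
    rw [hFQ, hFt, supNorm_comp_toTorus (stronglyMeasurable_torusConv _ hg),
      ← eLpNorm_congr_ae (torusPiece_ae_eq Φ l hg hC), kernelNorm_dilate, ← hFt] at h1
    refine h1.trans ?_
    rw [enorm_mul, Real.enorm_of_nonneg (by positivity), ofReal_two_rpow,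
      Real.enorm_of_nonneg (by positivity), ENNReal.ofReal_toReal (memLp_torusPiece Φ l _).2.ne,
      ← mul_assoc (pow2 _), ← pow2_add, show (l : ℝ) * (m - s) + s * l = l * m by ring]
    exact le_of_eq (by ring)
  refine ⟨F, hper, hF, ?_⟩
  obtain ⟨G, hG, hGp, happ⟩ := hF.exists_torus_limit hp hq hs hper
  rw [approximates_unitBoxes_iff hper hF.smooth hG] at happ
  rw [approximates_unitBoxes_iff hper hF.smooth hg]
  -- The series converges to some `G`. Since the symbols sum to one at each lattice point, `G` and
  -- `g` have the same Fourier coefficients.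
  have hGg : G =ᵐ[torusMeasure n] g := by
    refine ae_eq_of_mFourierCoeff_eq (hGp.integrable hp) (integrable_of_bounded hg hC) fun m => ?_
    have h1 := tendsto_mFourierCoeff hp hGp (fun k => memLp_descend (hF.smooth k)) happ m
    simp only [hFd, mFourierCoeff_torusConv _ hg hC, fourier_lpKernel, ← Finset.sum_mul] at h1
    have h2 := ((Φ.sum_eq_one ((2 * Real.pi) • latticePoint m)).tendsto_sum_nat).mul_const
      (mFourierCoeff g m)
    rw [one_mul] at h2
    exact tendsto_nhds_unique h1 h2
  refine happ.congr fun K => eLpNorm_congr_ae ?_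
  filter_upwards [hGg] with t ht
  rw [ht]

end TorusBesov

/-! ### Weak derivatives and products on the torus. -/

section TorusProduct

open FourierTransform UnitAddTorus

variable {n : ℕ} (Φ : DyadicPartition n) {p q : ℝ≥0∞} {s σ : ℝ}

local notation "𝔼" => EuclideanSpace ℝ (Fin n)
local notation "𝕋" => UnitAddTorus (Fin n)

theorem IsTorusPeriodic.fderiv_apply {F : 𝔼 → ℂ} (hF : IsTorusPeriodic F) (e : 𝔼) :
    IsTorusPeriodic fun x => fderiv ℝ F x e := fun c hc x => by
  simp only [fderiv_periodic (hF c hc) x]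

theorem IsTorusPeriodic.sum {F : ℕ → 𝔼 → ℂ} (hF : ∀ k, IsTorusPeriodic (F k)) (K : ℕ) :
    IsTorusPeriodic fun x => ∑ k ∈ Finset.range K, F k x := fun c hc x =>
  Finset.sum_congr rfl fun k _ => hF k c hc x

theorem IsTorusPeriodic.productPiece {η : 𝓢(𝔼, ℂ)} {L : ℕ} {u v : 𝔼 → ℂ}
    (hu : IsTorusPeriodic u) (hv : IsTorusPeriodic v) (e : 𝔼) (k : ℕ) :
    IsTorusPeriodic (productPiece η L e u v k) := fun c hc x =>
  productPiece_periodic (hu c hc) (hv c hc) e k x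

theorem deriv_torus_eq_descend {ψ : 𝕋 → ℂ} (hψ : ContDiff ℝ ∞ fun x : 𝔼 => ψ (toTorus x))
    (i : Fin n) (t : 𝕋) :
    deriv (fun h : ℝ => ψ (t + Pi.single i (h : UnitAddCircle))) 0 =
      descend (fun x => fderiv ℝ (fun x : 𝔼 => ψ (toTorus x)) x (EuclideanSpace.single i 1)) t := by
  have h1 : (fun h : ℝ => ψ (t + Pi.single i (h : UnitAddCircle))) = fun h : ℝ =>
      ψ (toTorus (representative t + h • EuclideanSpace.single i (1 : ℝ))) := by
    ext h
    rw [toTorus_add, toTorus_representative, ← toTorus_single]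
    congr 3
    ext k
    simp
  rw [h1]
  refine HasDerivAt.deriv ?_
  have h4 : HasDerivAt (fun h : ℝ => representative t + h • EuclideanSpace.single i (1 : ℝ))
      (EuclideanSpace.single i (1 : ℝ)) 0 := by
    simpa using ((hasDerivAt_id (0 : ℝ)).smul_const (EuclideanSpace.single i (1 : ℝ))).const_add
      (representative t)
  have h5 : HasFDerivAt (fun x : 𝔼 => ψ (toTorus x))
      (fderiv ℝ (fun x : 𝔼 => ψ (toTorus x)) (representative t))
      (representative t + (0 : ℝ) • EuclideanSpace.single i (1 : ℝ)) := by
    rw [zero_smul, add_zero]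
    exact ((hψ.differentiable (by simp)) _).hasFDerivAt
  exact h5.comp_hasDerivAt 0 h4

/-- Integration by parts on the torus. -/
theorem IsTorusPeriodic.integral_mul_fderiv {V Ψ : 𝔼 → ℂ} (hV : IsTorusPeriodic V)
    (hVs : IsBddSmooth V) (hΨ : IsTorusPeriodic Ψ) (hΨs : ContDiff ℝ ∞ Ψ) (e : 𝔼) :
    ∫ t, descend (fun x => fderiv ℝ Ψ x e) t * descend V t ∂(torusMeasure n) =
      -∫ t, descend Ψ t * descend (fun x => fderiv ℝ V x e) t ∂(torusMeasure n) := by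
  have hΨc : Continuous fun x => fderiv ℝ Ψ x e :=
    (hΨs.continuous_fderiv (by simp)).clm_apply continuous_const
  obtain ⟨C, hC⟩ := hΨ.exists_bound hΨs.continuous
  obtain ⟨C', hC'⟩ := (hΨ.fderiv_apply e).exists_bound hΨc
  have h1 := IsTorusPeriodic.integral_fderiv (W := fun x => V x * Ψ x)
    (fun c hc x => by simp only [hV c hc x, hΨ c hc x]) ((hVs.1.mul hΨs).of_le (by simp)) e
  have h2 : ∀ t, descend (fun x => fderiv ℝ (fun x => V x * Ψ x) x e) t =
      descend (fun x => fderiv ℝ Ψ x e) t * descend V t +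
        descend Ψ t * descend (fun x => fderiv ℝ V x e) t := fun t => by
    simp only [descend]
    rw [fderiv_fun_mul (hVs.differentiable _) ((hΨs.differentiable (by simp)) _)]
    simp only [add_apply, smul_apply, smul_eq_mul]
    ring
  simp only [h2] at h1
  rw [integral_add] at h1
  · exact eq_neg_of_add_eq_zero_left h1
  · exact (memLp_one_iff_integrable.1 (memLp_descend hVs)).bdd_mul
      (stronglyMeasurable_descend hΨc.stronglyMeasurable).aestronglyMeasurable
      (ae_of_all _ fun t => hC' _)
  · exact (memLp_one_iff_integrable.1 (memLp_descend (hVs.fderiv_apply e))).bdd_mul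
      (stronglyMeasurable_descend hΨs.continuous.stronglyMeasurable).aestronglyMeasurable
      (ae_of_all _ fun t => hC _)

theorem isWeakPartialTorus_of_approximates (hp : 1 ≤ p) {v w : 𝕋 → ℂ} {G : ℕ → 𝔼 → ℂ}
    (hv : StronglyMeasurable v) (hvp : MemLp v p (torusMeasure n))
    (hw : StronglyMeasurable w) (hwp : MemLp w p (torusMeasure n))
    (hper : ∀ k, IsTorusPeriodic (G k)) (hG : ∀ k, IsBddSmooth (G k))
    (happ : Approximates (unitBoxes n) p G fun x => v (toTorus x)) (i : Fin n)
    (happw : Approximates (unitBoxes n) p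
      (fun k x => fderiv ℝ (G k) x (EuclideanSpace.single i 1)) fun x => w (toTorus x)) :
    IsWeakPartialTorus i v w := by
  intro ψ hψ
  set e : 𝔼 := EuclideanSpace.single i 1
  set Ψ : 𝔼 → ℂ := fun x => ψ (toTorus x)
  have hΨ : ContDiff ℝ ∞ Ψ := hψ
  have hΨper : IsTorusPeriodic Ψ := isTorusPeriodic_comp ψ
  have hΨc : Continuous fun x => fderiv ℝ Ψ x e :=
    (hΨ.continuous_fderiv (by simp)).clm_apply continuous_const
  obtain ⟨C, hC⟩ := hΨper.exists_bound hΨ.continuous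
  obtain ⟨C', hC'⟩ := (hΨper.fderiv_apply e).exists_bound hΨc
  have hψd : descend Ψ = ψ := descend_comp_toTorus ψ
  rw [approximates_unitBoxes_iff hper hG hv] at happ
  rw [approximates_unitBoxes_iff (fun k => (hper k).fderiv_apply e)
    (fun k => (hG k).fderiv_apply e) hw] at happw
  have h1 := tendsto_integral_mul_of_tendsto_eLpNorm hp hvp
    (fun K => memLp_finsetSum _ fun k _ => memLp_descend (hG k)) happ
    (stronglyMeasurable_descend hΨc.stronglyMeasurable).aestronglyMeasurable fun t => hC' _
  have h2 := tendsto_integral_mul_of_tendsto_eLpNorm hp hwp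
    (fun K => memLp_finsetSum _ fun k _ => memLp_descend ((hG k).fderiv_apply e)) happw
    (stronglyMeasurable_descend hΨ.continuous.stronglyMeasurable).aestronglyMeasurable
    fun t => hC _
  have h3 := tendsto_nhds_unique h1 (h2.neg.congr fun K => ?_)
  · simp only [deriv_torus_eq_descend hψ i]
    rw [hψd] at h3
    simpa only [mul_comm] using h3
  · have h4 := IsTorusPeriodic.integral_mul_fderiv (IsTorusPeriodic.sum hper K)
      (IsBddSmooth.sum _ fun k _ => hG k) hΨper hΨ e
    rw [fderiv_sum_apply hG] at h4
    exact h4.symm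

/-- The function `f` need not be bounded, so the identification of its pieces with convolutions is
applied to the smooth `P k` only. Each piece is a fixed finite combination of Fourier coefficients,
so the pieces of the partial sums converge pointwise, and Fatou's lemma concludes. -/
theorem eLpNorm_torusPiece_le_tsum (hp : 1 ≤ p) {f : 𝕋 → ℂ} {P : ℕ → 𝔼 → ℂ}
    (hf : StronglyMeasurable f) (hfp : MemLp f p (torusMeasure n))
    (hper : ∀ k, IsTorusPeriodic (P k)) (hP : ∀ k, IsBddSmooth (P k))
    (happ : Approximates (unitBoxes n) p P fun x => f (toTorus x)) (l : ℕ) :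
    eLpNorm (torusPiece Φ l (mFourierCoeff f)) p (torusMeasure n) ≤
      ∑' k, supNorm (unitBoxes n) p (conv (lpKernel Φ l) (P k)) := by
  rw [approximates_unitBoxes_iff hper hP hf] at happ
  have hcoeff := tendsto_mFourierCoeff hp hfp (fun k => memLp_descend (hP k)) happ
  obtain ⟨S, hS⟩ := exists_torusPiece_eq_sum Φ l
  have hlim : ∀ t, Tendsto (fun K => ∑ k ∈ Finset.range K,
      torusPiece Φ l (mFourierCoeff (descend (P k))) t) atTop
      (𝓝 (torusPiece Φ l (mFourierCoeff f) t)) := fun t => by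
    simp only [hS]
    refine (tendsto_finsetSum S fun m _ => ((hcoeff m).mul_const
      (Φ.φ l ((2 * Real.pi) • latticePoint m))).mul_const (mFourier m t)).congr fun K => ?_
    rw [Finset.sum_comm]
    simp only [Finset.sum_mul]
  have hpiece : ∀ k, eLpNorm (torusPiece Φ l (mFourierCoeff (descend (P k)))) p (torusMeasure n) =
      supNorm (unitBoxes n) p (conv (lpKernel Φ l) (P k)) := fun k => by
    obtain ⟨C, hC⟩ := (hP k).norm_le
    have hm := stronglyMeasurable_descend (hP k).1.continuous.stronglyMeasurable
    rw [eLpNorm_congr_ae (torusPiece_ae_eq Φ l hm fun t => hC _),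
      ← supNorm_comp_toTorus (stronglyMeasurable_torusConv _ hm), ← conv_comp_toTorus]
    simp only [(hper k).descend_toTorus]
  have hmeas : ∀ k, AEStronglyMeasurable (torusPiece Φ l (mFourierCoeff (descend (P k))))
      (torusMeasure n) := fun k => (continuous_torusPiece Φ l _).aestronglyMeasurable
  refine (Lp.eLpNorm_lim_le_liminf_eLpNorm (f := fun K t => ∑ k ∈ Finset.range K,
      torusPiece Φ l (mFourierCoeff (descend (P k))) t)
    (fun K => Finset.aestronglyMeasurable_fun_sum _ fun k _ => hmeas k) _
    (ae_of_all _ hlim)).trans ?_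
  refine liminf_le_of_frequently_le' (Frequently.of_forall fun K => ?_)
  have h1 := eLpNorm_sum_le (p := p) (s := Finset.range K) (fun k _ => hmeas k) hp
  rw [Finset.sum_fn] at h1
  refine h1.trans ?_
  simp only [hpiece]
  exact ENNReal.sum_le_tsum _

/-- Functions on the torus with a periodic decomposition are in the corresponding Besov space. -/
theorem IsDecomposition.memBesovTorus (hp : 1 ≤ p) (hq : 1 ≤ q) (hσ : 0 < σ) {f : 𝕋 → ℂ}
    {P : ℕ → 𝔼 → ℂ} (hf : StronglyMeasurable f) (hfp : MemLp f p (torusMeasure n))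
    (hper : ∀ k, IsTorusPeriodic (P k)) (hP : IsDecomposition (unitBoxes n) p q σ P)
    (happ : Approximates (unitBoxes n) p P fun x => f (toTorus x)) :
    MemBesovTorus Φ σ p q (mFourierCoeff f) := by
  obtain ⟨b, hb, C, hC, hle⟩ := hP.exists_tsum_supNorm_lpKernel_le Φ admissible_unitBoxes hp hq hσ
  rw [MemBesovTorus, memℓp_iff_memEllq hq]
  refine (hb.const_mul hC).mono fun l => le_trans ?_ (hle l)
  rw [enorm_mul, Real.enorm_of_nonneg (by positivity), ofReal_two_rpow,
    Real.enorm_of_nonneg (by positivity)]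
  gcongr
  exact ENNReal.ofReal_toReal_le.trans
    (eLpNorm_torusPiece_le_tsum Φ hp hf hfp hper hP.smooth happ l)

theorem exists_bounded_representative {u : 𝕋 → ℂ} (hu : MemLp u ⊤ (torusMeasure n)) :
    ∃ (u' : 𝕋 → ℂ) (C : ℝ), StronglyMeasurable u' ∧ (∀ t, ‖u' t‖ ≤ C) ∧
      u =ᵐ[torusMeasure n] u' := by
  obtain ⟨g, hg, hug⟩ := hu.1
  set C := (eLpNormEssSup u (torusMeasure n)).toReal
  have hfin : eLpNormEssSup u (torusMeasure n) ≠ ⊤ := by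
    rw [← eLpNorm_exponent_top]; exact hu.2.ne
  refine ⟨{t | ‖g t‖ ≤ C}.indicator g, C,
    hg.indicator (measurableSet_le hg.norm.measurable measurable_const), fun t => ?_, ?_⟩
  · by_cases ht : ‖g t‖ ≤ C
    · rwa [indicator_of_mem (show t ∈ {t | ‖g t‖ ≤ C} from ht)]
    · rw [indicator_of_notMem (show t ∉ {t | ‖g t‖ ≤ C} from ht), norm_zero]
      exact ENNReal.toReal_nonneg
  · filter_upwards [hug, enorm_ae_le_eLpNormEssSup u (torusMeasure n)] with t h1 h2
    rw [indicator_of_mem, h1]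
    rw [mem_ofPred_eq, ← h1, ← toReal_enorm]
    exact ENNReal.toReal_mono hfin h2

/-- The torus case: the weak derivatives are functions, and the product has one derivative less. -/
theorem memBesovTorus_mul_weak_partial (hp : 1 ≤ p) (hq : 1 ≤ q) (hs : 1 < s)
    {u v : 𝕋 → ℂ} (hu : MemLp u ⊤ (torusMeasure n)) (hv : MemLp v ⊤ (torusMeasure n))
    (huB : MemBesovTorus Φ s p q (mFourierCoeff u)) (hvB : MemBesovTorus Φ s p q (mFourierCoeff v))
    (i : Fin n) : ∃ w : 𝕋 → ℂ, MemLp w p (torusMeasure n) ∧ IsWeakPartialTorus i v w ∧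
      MemBesovTorus Φ (s - 1) p q (mFourierCoeff fun x => u x * w x) := by
  obtain ⟨u', Cu, hum, huC, huu⟩ := exists_bounded_representative hu
  obtain ⟨v', Cv, hvm, hvC, hvv⟩ := exists_bounded_representative hv
  rw [funext (mFourierCoeff_congr huu)] at huB
  rw [funext (mFourierCoeff_congr hvv)] at hvB
  obtain ⟨F, hFper, hF, happu⟩ := huB.exists_decomposition Φ hp hq (by linarith) hum huC
  obtain ⟨G, hGper, hG, happv⟩ := hvB.exists_decomposition Φ hp hq (by linarith) hvm hvC
  set e : 𝔼 := EuclideanSpace.single i 1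
  have hGe := hG.fderiv_apply e
  have hGeper : ∀ k, IsTorusPeriodic fun x => fderiv ℝ (G k) x e := fun k =>
    (hGper k).fderiv_apply e
  obtain ⟨w, hw, hwp, happw⟩ := hGe.exists_torus_limit hp hq (by linarith) hGeper
  have hvp : MemLp v' p (torusMeasure n) :=
    MemLp.of_bound hvm.aestronglyMeasurable Cv (ae_of_all _ hvC)
  have hweak : IsWeakPartialTorus i v' w :=
    isWeakPartialTorus_of_approximates hp hvm hvp hw hwp hGper hG.smooth happv i happw
  refine ⟨w, hwp, fun ψ hψ => ?_, ?_⟩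
  · rw [← hweak ψ hψ]
    refine integral_congr_ae ?_
    filter_upwards [hvv] with t ht
    rw [ht]
  · have h1 : mFourierCoeff (fun x => u x * w x) = mFourierCoeff fun x => u' x * w x :=
      funext (mFourierCoeff_congr (by filter_upwards [huu] with t ht; rw [ht]))
    rw [h1]
    -- All displacements are admissible for the unit boxes, so any kernel of integral one serves as
    -- mollifier.
    obtain ⟨η, -, hη⟩ := exists_kernel_supported_in_ball (0 : 𝔼) one_pos
    obtain ⟨L, hL⟩ := exists_nat_gt s
    have hmol : IsMollifier (unitBoxes n) univ η :=
      ⟨admissible_unitBoxes, isClosed_univ, fun _ _ => mem_univ _, hη⟩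
    have hlift : ∀ {g : 𝕋 → ℂ} {C : ℝ}, StronglyMeasurable g → (∀ t, ‖g t‖ ≤ C) →
        IsDominated (fun x : 𝔼 => g (toTorus x)) ∧
          supNorm (unitBoxes n) ⊤ (fun x : 𝔼 => g (toTorus x)) ≠ ⊤ := fun hg hC => by
      refine ⟨.of_bounded (hg.comp_measurable continuous_toTorus.measurable) fun x => hC _, ?_⟩
      rw [supNorm_comp_toTorus hg]
      exact (MemLp.of_bound hg.aestronglyMeasurable _ (ae_of_all _ hC)).2.ne
    obtain ⟨hud, hub⟩ := hlift hum huC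
    obtain ⟨hvd, hvb⟩ := hlift hvm hvC
    have hwm : AEStronglyMeasurable (fun x : 𝔼 => w (toTorus x)) :=
      (hw.comp_measurable continuous_toTorus.measurable).aestronglyMeasurable
    have hP := hmol.isDecomposition_productPiece hp hq (by linarith) hL hud hvd hub hvb hF happu
      hG happv e
    have happP := hmol.approximates_productPiece hp hq hs hL hud hvd hub hvb hF happu hG happv e
      hwm happw
    refine hP.memBesovTorus Φ hp hq (by linarith) (f := fun t => u' t * w t) (hum.mul hw) ?_
      (fun k => IsTorusPeriodic.productPiece (isTorusPeriodic_comp u') (isTorusPeriodic_comp v') e k)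
      happP
    refine hwp.of_le_mul (c := Cu) (hum.mul hw).aestronglyMeasurable (ae_of_all _ fun t => ?_)
    rw [norm_mul]
    gcongr
    exact huC t

end TorusProduct

end Besov

/-- First part: `Ω` bounded open with smooth boundary, or `Ω = (0,1)ⁿ`. Second part: `Ω = 𝕋ⁿ`.
In both, `w` is the `i`-th component of `∇v`, so that `u w` is the `i`-th component of `u∇v`. -/
theorem lemma6p20 (n : ℕ) (Φ : Besov.DyadicPartition n) (s : ℝ) (hs : 1 < s)
    (p q : ℝ≥0∞) [Fact (1 ≤ p)] (hp : p ≠ ⊤) (hq : 1 ≤ q) :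
    (∀ Ω : Opens (EuclideanSpace ℝ (Fin n)),
      ((Bornology.IsBounded (Ω : Set (EuclideanSpace ℝ (Fin n))) ∧ Besov.HasSmoothBoundary Ω) ∨
        Ω = Besov.unitCube n) →
      ∀ u v : EuclideanSpace ℝ (Fin n) → ℂ,
        MemLp u ⊤ (volume.restrict Ω) → MemLp v ⊤ (volume.restrict Ω) →
        Besov.MemBesovOn Φ s p q Ω (Besov.toDistribution Ω u) →
        Besov.MemBesovOn Φ s p q Ω (Besov.toDistribution Ω v) →
        ∀ i : Fin n, ∃ w : EuclideanSpace ℝ (Fin n) → ℂ,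
          MemLp w p (volume.restrict Ω) ∧
          ∂_{EuclideanSpace.single i (1 : ℝ)} (Besov.toDistribution Ω v) =
            Besov.toDistribution Ω w ∧
          Besov.MemBesovOn Φ (s - 1) p q Ω (Besov.toDistribution Ω fun x => u x * w x)) ∧
    (∀ u v : UnitAddTorus (Fin n) → ℂ,
      MemLp u ⊤ (Besov.torusMeasure n) → MemLp v ⊤ (Besov.torusMeasure n) →
      Besov.MemBesovTorus Φ s p q (UnitAddTorus.mFourierCoeff u) →
      Besov.MemBesovTorus Φ s p q (UnitAddTorus.mFourierCoeff v) →
      ∀ i : Fin n, ∃ w : UnitAddTorus (Fin n) → ℂ,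
        MemLp w p (Besov.torusMeasure n) ∧
        Besov.IsWeakPartialTorus i v w ∧
        Besov.MemBesovTorus Φ (s - 1) p q
          (UnitAddTorus.mFourierCoeff fun x => u x * w x)) :=
  ⟨fun _ hΩ _ _ hu hv huB hvB _ =>
      Besov.memBesovOn_mul_weak_deriv_of_domain Φ hp hq hs hΩ hu hv huB hvB _,
    fun _ _ hu hv huB hvB i =>
      Besov.memBesovTorus_mul_weak_partial Φ Fact.out hq hs hu hv huB hvB i⟩
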